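/- All graphs $G=(V,E)$ are finite, simple and undirected; $R_G$ and $D_G$ denote the radius and the diameter of $G$. A labeling of $G$ is a function $\lambda$ that assigns to every edge a finite set of positive integers (labels); its number of labels is $|\lambda|=\sum_{e\in E}|\lambda(e)|$ and its lifetime $L_\lambda$ is the largest label used. A temporal path from $v$ to $w$ is a path of $G$ from $v$ to $w$ with edges $e_1,\dots,e_k$, together with times $t_1<t_2<\dots<t_k$ such that $t_i\in\lambda(e_i)$ for all $i$. The labeling is temporally connected if for all distinct vertices $v,w$ there is a temporal path from $v$ to $w$. In the Minimum Aged Labeling problem (MAL), an instance is a pair $(G,a)$ of a connected graph $G$ and a nonnegative integer $a$; a solution is a temporally connected labeling $\lambda$ of $G$ with $L_\lambda\le a$; and $\mathrm{OPT}(G,a)$ denotes the minimum of $|\lambda|$ over all solutions. Theorem. (i) There is a polynomial-time algorithm that, for every instance $(G,a)$ of MAL with $a\ge 2R_G$, computes a solution $\lambda$ with $|\lambda|\le \mathrm{OPT}(G,a)+2$. (ii) There is a polynomial-time algorithm that, for every instance $(G,a)$ of MAL with $a\ge 2R_G+1$, computes a solution $\lambda$ with $|\lambda|\le \mathrm{OPT}(G,a)+1$.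 (iii) There is a polynomial-time algorithm that, for every instance $(G,a)$ of MAL with $a\ge 2D_G+2$, computes a solution $\lambda$ with $|\lambda|=\mathrm{OPT}(G,a)$. Here polynomial time means: on a random access machine whose arithmetic operations are addition and truncated subtraction of natural numbers, at unit cost, the number of steps is at most a fixed polynomial in the input size $|V|^2+\lceil\log_2(a+1)\rceil$; the input is $|V|$, the adjacency matrix of $G$ and $a$, and the output is the list of all triples $(u,v,t)$ (up to order, orientation and repetition) with $\{u,v\}\in E$ and $t\in\lambda(\{u,v\})$. -/

import Mathlib

/-! ## Temporal graphs and the Minimum Aged Labeling problem -/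

namespace MAL

/-- A labeling of the edges of `G`: every edge receives a finite set of positive integers.
The function is extended by `∅` to the pairs that are not edges. -/
structure Labeling {V : Type} (G : SimpleGraph V) where
  labels : Sym2 V → Finset ℕ
  eq_empty : ∀ e, e ∉ G.edgeSet → labels e = ∅
  pos : ∀ e, ∀ t ∈ labels e, 0 < t

namespace Labeling

variable {V : Type} {G : SimpleGraph V}

/-- There is a (strict) temporal path from `v` to `w`: a path of `G` with edges `e₁, …, e_k`
and times `t₁ < … < t_k` such that `tᵢ` is a label of `eᵢ`. -/
def Reaches (lam : Labeling G) (v w : V) : Prop :=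
  ∃ (p : G.Walk v w) (ts : List ℕ), p.IsPath ∧
    List.Forall₂ (fun e t => t ∈ lam.labels e) p.edges ts ∧ ts.Pairwise (· < ·)

/-- Every vertex is temporally reachable from every other vertex. -/
def TemporallyConnected (lam : Labeling G) : Prop :=
  ∀ v w : V, v ≠ w → lam.Reaches v w

/-- The lifetime: the largest label (`0` if there are no labels). -/
def lifetime [Fintype V] [DecidableEq V] (lam : Labeling G) : ℕ :=
  Finset.univ.sup fun e => (lam.labels e).sup id

/-- The total number of labels. -/
def numLabels [Fintype V] [DecidableEq V] (lam : Labeling G) : ℕ :=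
  ∑ e, (lam.labels e).card

/-- `lam` is a solution of the instance `(G, a)`. -/
def IsSolution [Fintype V] [DecidableEq V] (lam : Labeling G) (a : ℕ) : Prop :=
  lam.TemporallyConnected ∧ lam.lifetime ≤ a

end Labeling

/-- The minimum number of labels of a solution of `(G, a)`
(only meaningful if there is a solution). -/
noncomputable def opt {V : Type} [Fintype V] [DecidableEq V] (G : SimpleGraph V) (a : ℕ) : ℕ :=
  sInf {k | ∃ lam : Labeling G, lam.IsSolution a ∧ lam.numLabels = k}

/-! ## The machine model

A random access machine, programmed with structured control flow, with natural numbers as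
memory contents.  A program uses finitely many variables and finitely many arrays (each with
indirect addressing).  The only arithmetic operations are addition and truncated subtraction,
each at unit cost, so that `t` steps lengthen numbers by at most `O(t)` bits and the
model is polynomially equivalent to Turing machines. -/

/-- The memory: the variable `x` has the value `var x`, and the `i`-th cell of the
array `A` has the value `arr A i`. -/
structure State where
  var : ℕ → ℕ
  arr : ℕ → ℕ → ℕ

/-- Expressions. -/
inductive Expr where
  | const (k : ℕ)
  | var (x : ℕ)
  | read (A : ℕ) (i : Expr)
  | add (e₁ e₂ : Expr)
  | sub (e₁ e₂ : Expr)

/-- The value of an expression. -/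
def Expr.eval (σ : State) : Expr → ℕ
  | .const k => k
  | .var x => σ.var x
  | .read A i => σ.arr A (i.eval σ)
  | .add e₁ e₂ => e₁.eval σ + e₂.eval σ
  | .sub e₁ e₂ => e₁.eval σ - e₂.eval σ

/-- The number of elementary operations for the evaluation of an expression. -/
def Expr.cost : Expr → ℕ
  | .const _ => 1
  | .var _ => 1
  | .read _ i => i.cost + 1
  | .add e₁ e₂ => e₁.cost + e₂.cost + 1
  | .sub e₁ e₂ => e₁.cost + e₂.cost + 1

/-- Programs. -/
inductive Prog where
  | skip
  | assign (x : ℕ) (e : Expr)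
  | store (A : ℕ) (i e : Expr)
  | seq (p q : Prog)
  | ite (b : Expr) (p q : Prog)
  | loop (b : Expr) (p : Prog)

/-- Assignment to a variable. -/
def State.setVar (σ : State) (x v : ℕ) : State :=
  { σ with var := Function.update σ.var x v }

/-- Assignment to an array cell. -/
def State.setArr (σ : State) (A i v : ℕ) : State :=
  { σ with arr := Function.update σ.arr A (Function.update (σ.arr A) i v) }

/-- `Exec p σ t τ`: started in the state `σ`, the program `p` halts after exactly `t` steps in
the state `τ`.  A test `b` succeeds if its value is not `0`; `loop b p` is
"while `b` do `p`". -/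
inductive Exec : Prog → State → ℕ → State → Prop where
  | skip (σ : State) : Exec .skip σ 1 σ
  | assign (x : ℕ) (e : Expr) (σ : State) :
      Exec (.assign x e) σ (e.cost + 1) (σ.setVar x (e.eval σ))
  | store (A : ℕ) (i e : Expr) (σ : State) :
      Exec (.store A i e) σ (i.cost + e.cost + 1) (σ.setArr A (i.eval σ) (e.eval σ))
  | seq {p q : Prog} {σ₁ σ₂ σ₃ : State} {s t : ℕ} :
      Exec p σ₁ s σ₂ → Exec q σ₂ t σ₃ → Exec (.seq p q) σ₁ (s + t) σ₃
  | ite_true {b : Expr} {p q : Prog} {σ τ : State} {t : ℕ} :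
      b.eval σ ≠ 0 → Exec p σ t τ → Exec (.ite b p q) σ (b.cost + 1 + t) τ
  | ite_false {b : Expr} {p q : Prog} {σ τ : State} {t : ℕ} :
      b.eval σ = 0 → Exec q σ t τ → Exec (.ite b p q) σ (b.cost + 1 + t) τ
  | loop_false {b : Expr} {p : Prog} {σ : State} :
      b.eval σ = 0 → Exec (.loop b p) σ (b.cost + 1) σ
  | loop_true {b : Expr} {p : Prog} {σ₁ σ₂ σ₃ : State} {s t : ℕ} :
      b.eval σ₁ ≠ 0 → Exec p σ₁ s σ₂ → Exec (.loop b p) σ₂ t σ₃ →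
      Exec (.loop b p) σ₁ (b.cost + 1 + s + t) σ₃

/-- Programs are deterministic: the final state and the number of steps are determined by
the program and the initial state. -/
theorem Exec.deterministic {p : Prog} {σ τ : State} {t : ℕ} (h : Exec p σ t τ) :
    ∀ {t' : ℕ} {τ' : State}, Exec p σ t' τ' → t = t' ∧ τ = τ' := by
  induction h with
  | skip => intro _ _ h; cases h; exact ⟨rfl, rfl⟩
  | assign => intro _ _ h; cases h; exact ⟨rfl, rfl⟩
  | store => intro _ _ h; cases h; exact ⟨rfl, rfl⟩
  | seq _ _ ih₁ ih₂ =>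
    intro _ _ h
    cases h with
    | seq h₁ h₂ =>
      obtain ⟨rfl, rfl⟩ := ih₁ h₁
      obtain ⟨rfl, rfl⟩ := ih₂ h₂
      exact ⟨rfl, rfl⟩
  | ite_true hb _ ih =>
    intro _ _ h
    cases h with
    | ite_true _ h₁ => obtain ⟨rfl, rfl⟩ := ih h₁; exact ⟨rfl, rfl⟩
    | ite_false hb' _ => exact absurd hb' hb
  | ite_false hb _ ih =>
    intro _ _ h
    cases h with
    | ite_true hb' _ => exact absurd hb hb'
    | ite_false _ h₁ => obtain ⟨rfl, rfl⟩ := ih h₁; exact ⟨rfl, rfl⟩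
  | loop_false hb =>
    intro _ _ h
    cases h with
    | loop_false _ => exact ⟨rfl, rfl⟩
    | loop_true hb' _ _ => exact absurd hb hb'
  | loop_true hb _ _ ih₁ ih₂ =>
    intro _ _ h
    cases h with
    | loop_false hb' => exact absurd hb' hb
    | loop_true _ h₁ h₂ =>
      obtain ⟨rfl, rfl⟩ := ih₁ h₁
      obtain ⟨rfl, rfl⟩ := ih₂ h₂
      exact ⟨rfl, rfl⟩

/-! ## Polynomial-time algorithms for labeling problems -/

open Classical in
/-- The initial state for the instance `(G, a)`: variable `0` holds the number `n` of vertices,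
variable `1` holds `a`, array `0` holds the adjacency matrix of `G` row by row, and
everything else is `0`. -/
noncomputable def inputState {n : ℕ} (G : SimpleGraph (Fin n)) (a : ℕ) : State where
  var x := if x = 0 then n else if x = 1 then a else 0
  arr A k := if A = 0 ∧ ∃ i j : Fin n, k = i.val * n + j.val ∧ G.Adj i j then 1 else 0

/-- The size of an instance: the number of bits of the adjacency matrix and of `a`. -/
def inputSize (n a : ℕ) : ℕ := n ^ 2 + Nat.size a

/-- The state `σ` holds the labeling `lam` as output: a list of triples `(u, v, t)`, their number
in variable `2`, their components in the arrays `1`, `2`, `3`, where `(u, v, t)`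
means that `t` is a label of the edge `{u, v}`. -/
def Outputs {n : ℕ} {G : SimpleGraph (Fin n)} (σ : State) (lam : Labeling G) : Prop :=
  (∀ i < σ.var 2, ∃ u v : Fin n, σ.arr 1 i = u.val ∧ σ.arr 2 i = v.val ∧
    σ.arr 3 i ∈ lam.labels s(u, v)) ∧
  (∀ u v : Fin n, ∀ t ∈ lam.labels s(u, v), ∃ i < σ.var 2, σ.arr 3 i = t ∧
    (σ.arr 1 i = u.val ∧ σ.arr 2 i = v.val ∨ σ.arr 1 i = v.val ∧ σ.arr 2 i = u.val))

/-- There is a polynomial-time algorithm that computes, for every instance `(G, a)` with the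
property `Inst`, a labeling of `G` with the property `Good`. -/
def PolyTimeComputable (Inst : ∀ n : ℕ, SimpleGraph (Fin n) → ℕ → Prop)
    (Good : ∀ (n : ℕ) (G : SimpleGraph (Fin n)), ℕ → Labeling G → Prop) : Prop :=
  ∃ (p : Prog) (P : Polynomial ℕ), ∀ (n : ℕ) (G : SimpleGraph (Fin n)) (a : ℕ), Inst n G a →
    ∃ (t : ℕ) (σ : State) (lam : Labeling G), Exec p (inputState G a) t σ ∧
      t ≤ P.eval (inputSize n a) ∧ Outputs σ lam ∧ Good n G a lam

end MAL

/-! Read in the order of time, the labels are telephone calls along edges, and temporal connectivity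
says that they carry the information of every person to every other person. By the gossip theorem,
`n ≥ 2` persons need at least `2n - 4` calls, and at least `2n - 3` if the edges allowed for calls
contain no four-cycle.

Conversely, information can be gathered along a tree into a core, exchanged there, and distributed
back along the tree. A core that is a vertex, an edge or a four-cycle gives at most `2n - 2`, `2n -
3` or `2n - 4` labels; the exchange takes 0, 1 or 2 units of time, and the lifetime is twice the
largest distance to the core plus this number. A centre of the graph, or an edge at it, is a
suitable core for the additive errors 2 and 1. If `a ≥ 2D + 2`, where `D` is the diameter, then
every edge and every four-cycle is suitable, and the two bounds agree, whether or not a four-cycle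
exists.

The core of the proof is the lower bound `System.card_lt`. It is stated for families of disjoint
senders and receivers that may be vertices or edges, where one endpoint sending or receiving is
enough; this generality permits induction. In a minimal counterexample no endpoint can replace its
edge (`MinSystem.exists_not_informs`), so all items are edges. The persons are divided into classes
closed under calls, each with at most one more person than calls. Counting gives at least four
classes in which the items occur more often than twice the number of calls. Since information stays
in its class, every sender, seen as an edge between classes, meets every receiver; by
`cross_structure` they form stars with a common centre or contain the two matchings of a four-cycle.

Stars yield three vertices without calls, which an invariant of the calls excludes
(`not_three_tight`). In the other case `k = 4` and all counts are sharp, and one finds a four-cycle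
of the graph or a smaller counterexample (`FourClasses.false`).

The algorithm tries all quadruples of vertices as a core and computes a layered tree by repeated
relaxation. It is written with bounded loops, so its running time is a polynomial read off from the
program (`FProg.exec`). -/

/-! ## Spreading of information by a sequence of calls -/

namespace MAL

section Spread

variable {V : Type*} [DecidableEq V]

/-- The set of informed persons after the call `e`, if `S` is the set of informed persons before. -/
def learn (e : V × V) (S : Finset V) : Finset V :=
  if e.1 ∈ S ∨ e.2 ∈ S then insert e.1 (insert e.2 S) else S

/-- The set of informed persons after the calls `N`, if `S` is the set of informed persons before. -/
def spread (N : List (V × V)) (S : Finset V) : Finset V :=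
  N.foldl (fun S e => learn e S) S

/-- Information that `a` has before the calls `N` has reached `x` after them. -/
def Informs (N : List (V × V)) (a x : V) : Prop := x ∈ spread N {a}

instance (N : List (V × V)) (a x : V) : Decidable (Informs N a x) :=
  inferInstanceAs (Decidable (x ∈ spread N {a}))

theorem mem_learn {e : V × V} {S : Finset V} {x : V} :
    x ∈ learn e S ↔ x ∈ S ∨ (e.1 ∈ S ∨ e.2 ∈ S) ∧ (x = e.1 ∨ x = e.2) := by
  unfold learn; split_ifs with h <;> simp [h]; tauto

theorem mem_learn_iff_exists {e : V × V} {S : Finset V} {x : V} :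
    x ∈ learn e S ↔ ∃ s ∈ S, x ∈ learn e {s} := by
  simp only [mem_learn, Finset.mem_singleton]
  constructor
  · rintro (h | ⟨h | h, h'⟩)
    · exact ⟨x, h, Or.inl rfl⟩
    · exact ⟨_, h, Or.inr ⟨Or.inl rfl, h'⟩⟩
    · exact ⟨_, h, Or.inr ⟨Or.inr rfl, h'⟩⟩
  · rintro ⟨s, hs, rfl | ⟨rfl | rfl, h'⟩⟩
    · exact Or.inl hs
    · exact Or.inr ⟨Or.inl hs, h'⟩
    · exact Or.inr ⟨Or.inr hs, h'⟩

theorem mem_learn_singleton_comm {e : V × V} {x y : V} : x ∈ learn e {y} ↔ y ∈ learn e {x} := by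
  simp only [mem_learn, Finset.mem_singleton]
  constructor <;> rintro (h | ⟨h | h, h' | h'⟩) <;> simp_all

theorem subset_learn (e : V × V) (S : Finset V) : S ⊆ learn e S := fun _ h =>
  mem_learn.2 (Or.inl h)

theorem learn_card_le (e : V × V) (S : Finset V) : (learn e S).card ≤ S.card + 1 := by
  unfold learn
  split_ifs with h
  · rcases h with h | h
    · rw [Finset.insert_eq_of_mem (Finset.mem_insert_of_mem h)]
      exact Finset.card_insert_le _ _
    · rw [Finset.insert_eq_of_mem h]
      exact Finset.card_insert_le _ _
  · omega

theorem learn_eq_self {e : V × V} {S : Finset V} (h : e.1 ∈ S ↔ e.2 ∈ S) : learn e S = S := by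
  unfold learn
  split_ifs with h'
  · have h1 : e.1 ∈ S := by tauto
    have h2 : e.2 ∈ S := by tauto
    rw [Finset.insert_eq_of_mem h2, Finset.insert_eq_of_mem h1]
  · rfl

theorem learn_card_of_not_iff {e : V × V} {S : Finset V} (h : ¬ (e.1 ∈ S ↔ e.2 ∈ S)) :
    (learn e S).card = S.card + 1 := by
  unfold learn
  by_cases h1 : e.1 ∈ S <;> by_cases h2 : e.2 ∈ S
  · tauto
  · rw [if_pos (Or.inl h1), Finset.insert_eq_of_mem (Finset.mem_insert_of_mem h1),
      Finset.card_insert_of_notMem h2]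
  · rw [if_pos (Or.inr h2), Finset.insert_eq_of_mem h2, Finset.card_insert_of_notMem h1]
  · tauto

@[simp] theorem spread_nil (S : Finset V) : spread [] S = S := rfl

theorem spread_cons (e : V × V) (N : List (V × V)) (S : Finset V) :
    spread (e :: N) S = spread N (learn e S) := rfl

theorem spread_append (M N : List (V × V)) (S : Finset V) :
    spread (M ++ N) S = spread N (spread M S) := by
  simp [spread, List.foldl_append]

theorem subset_spread (N : List (V × V)) (S : Finset V) : S ⊆ spread N S := by
  induction N generalizing S with
  | nil => exact subset_rfl
  | cons e N ih => exact (subset_learn e S).trans (ih _)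

theorem mem_spread {N : List (V × V)} {S : Finset V} {x : V} :
    x ∈ spread N S ↔ ∃ s ∈ S, Informs N s x := by
  unfold Informs
  induction N generalizing S with
  | nil => simp
  | cons e N ih =>
    rw [spread_cons, ih]
    constructor
    · rintro ⟨z, hz, hx⟩
      obtain ⟨s, hs, hz⟩ := mem_learn_iff_exists.1 hz
      exact ⟨s, hs, by rw [spread_cons, ih]; exact ⟨z, hz, hx⟩⟩
    · rintro ⟨s, hs, hx⟩
      rw [spread_cons, ih] at hx
      obtain ⟨z, hz, hx⟩ := hx
      exact ⟨z, mem_learn_iff_exists.2 ⟨s, hs, hz⟩, hx⟩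

theorem Informs.refl (N : List (V × V)) (a : V) : Informs N a a :=
  subset_spread N _ (Finset.mem_singleton_self a)

theorem informs_append {M N : List (V × V)} {a x : V} :
    Informs (M ++ N) a x ↔ ∃ z, Informs M a z ∧ Informs N z x := by
  unfold Informs
  rw [spread_append, mem_spread]
  rfl

theorem informs_cons {e : V × V} {N : List (V × V)} {a x : V} :
    Informs (e :: N) a x ↔ ∃ z ∈ learn e {a}, Informs N z x := by
  unfold Informs
  rw [spread_cons, mem_spread]
  rfl

/-- A chain of calls read backwards leads from `x` to `a`. This duality exchanges senders and
receivers and halves most arguments below. -/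
theorem informs_reverse {N : List (V × V)} {a x : V} : Informs N.reverse a x ↔ Informs N x a := by
  induction N generalizing a x with
  | nil => simp [Informs, eq_comm]
  | cons e N ih =>
    rw [List.reverse_cons, informs_append, informs_cons]
    constructor
    · rintro ⟨z, h1, h2⟩
      exact ⟨z, mem_learn_singleton_comm.1 h2, ih.1 h1⟩
    · rintro ⟨z, h1, h2⟩
      exact ⟨z, ih.2 h2, mem_learn_singleton_comm.1 h1⟩

theorem Informs.class_eq {κ : Type*} {c : V → κ} {N : List (V × V)}
    (hc : ∀ e ∈ N, c e.1 = c e.2) {a x : V} (h : Informs N a x) : c a = c x := by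
  induction N generalizing a with
  | nil => simp only [Informs, spread_nil, Finset.mem_singleton] at h; rw [h]
  | cons e N ih =>
    obtain ⟨z, hz, hx⟩ := informs_cons.1 h
    rw [← ih (fun e he => hc e (List.mem_cons_of_mem _ he)) hx]
    have := hc e List.mem_cons_self
    simp only [mem_learn, Finset.mem_singleton] at hz
    grind

theorem learn_singleton_of_notMem {e : V × V} {a : V} (h1 : e.1 ≠ a) (h2 : e.2 ≠ a) :
    learn e {a} = {a} := by
  simp [learn, h1, h2]

theorem spread_singleton_of_notMem {N : List (V × V)} {a : V}
    (h : ∀ e ∈ N, e.1 ≠ a ∧ e.2 ≠ a) : spread N {a} = {a} := by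
  induction N with
  | nil => rfl
  | cons e N ih =>
    rw [spread_cons, learn_singleton_of_notMem (h e List.mem_cons_self).1
      (h e List.mem_cons_self).2]
    exact ih fun e he => h e (List.mem_cons_of_mem _ he)

theorem informs_of_notMem {N : List (V × V)} {a x : V}
    (h : ∀ e ∈ N, e.1 ≠ a ∧ e.2 ≠ a) : Informs N a x ↔ x = a := by
  unfold Informs
  rw [spread_singleton_of_notMem h, Finset.mem_singleton]

theorem informs_to_of_notMem {N : List (V × V)} {a x : V}
    (h : ∀ e ∈ N, e.1 ≠ x ∧ e.2 ≠ x) : Informs N a x ↔ x = a := by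
  rw [← informs_reverse, informs_of_notMem (fun e he => h e (List.mem_reverse.1 he)), eq_comm]

/-- The number of persons who learn something by the `j`-th call. -/
def newsAt (N : List (V × V)) (S : Finset V) (j : ℕ) : ℕ :=
  (spread (N.take (j + 1)) S).card - (spread (N.take j) S).card

/-- The number of persons who learn something by the `j`-th call, backwards in time. -/
def newsBackAt (N : List (V × V)) (S : Finset V) (j : ℕ) : ℕ :=
  (spread (N.drop j).reverse S).card - (spread (N.drop (j + 1)).reverse S).card

theorem spread_take_succ (N : List (V × V)) (S : Finset V) {j : ℕ} (hj : j < N.length) :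
    spread (N.take (j + 1)) S = learn N[j] (spread (N.take j) S) := by
  rw [List.take_succ_eq_append_getElem hj, spread_append]
  rfl

theorem spread_drop_reverse (N : List (V × V)) (S : Finset V) {j : ℕ} (hj : j < N.length) :
    spread (N.drop j).reverse S = learn N[j] (spread (N.drop (j + 1)).reverse S) := by
  rw [List.drop_eq_getElem_cons hj, List.reverse_cons, spread_append]
  rfl

theorem card_spread (N : List (V × V)) (S : Finset V) :
    (spread N S).card = S.card + ∑ j : Fin N.length, newsAt N S j := by
  rw [← Finset.sum_range]
  have key : ∀ j ≤ N.length, (spread (N.take j) S).card =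
      S.card + ∑ i ∈ Finset.range j, newsAt N S i := by
    intro j
    induction j with
    | zero => simp
    | succ j ih =>
      intro hj
      rw [Finset.sum_range_succ, ← add_assoc, ← ih (by omega), newsAt]
      have : (spread (N.take j) S).card ≤ (spread (N.take (j + 1)) S).card := by
        rw [spread_take_succ N S hj]
        exact Finset.card_le_card (subset_learn _ _)
      omega
  simpa using key N.length le_rfl

theorem card_spread_reverse (N : List (V × V)) (S : Finset V) :
    (spread N.reverse S).card = S.card + ∑ j : Fin N.length, newsBackAt N S j := by
  rw [← Finset.sum_range]
  have key : ∀ j ≤ N.length, (spread N.reverse S).card =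
      (spread (N.drop j).reverse S).card + ∑ i ∈ Finset.range j, newsBackAt N S i := by
    intro j
    induction j with
    | zero => simp
    | succ j ih =>
      intro hj
      rw [Finset.sum_range_succ, ih (by omega), newsBackAt]
      have : (spread (N.drop (j + 1)).reverse S).card ≤ (spread (N.drop j).reverse S).card := by
        rw [spread_drop_reverse N S hj]
        exact Finset.card_le_card (subset_learn _ _)
      omega
  simpa using key N.length le_rfl

theorem newsAt_le_one (N : List (V × V)) (S : Finset V) {j : ℕ} (hj : j < N.length) :
    newsAt N S j ≤ 1 := by
  rw [newsAt, spread_take_succ N S hj]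
  have := learn_card_le N[j] (spread (N.take j) S)
  omega

theorem newsBackAt_le_one (N : List (V × V)) (S : Finset V) {j : ℕ} (hj : j < N.length) :
    newsBackAt N S j ≤ 1 := by
  rw [newsBackAt, spread_drop_reverse N S hj]
  have := learn_card_le N[j] (spread (N.drop (j + 1)).reverse S)
  omega

theorem newsAt_eq_one_iff (N : List (V × V)) (S : Finset V) {j : ℕ} (hj : j < N.length) :
    newsAt N S j = 1 ↔
      ¬ (N[j].1 ∈ spread (N.take j) S ↔ N[j].2 ∈ spread (N.take j) S) := by
  rw [newsAt, spread_take_succ N S hj]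
  by_cases h : N[j].1 ∈ spread (N.take j) S ↔ N[j].2 ∈ spread (N.take j) S
  · rw [learn_eq_self h]; simp [h]
  · rw [learn_card_of_not_iff h]; simp [h]

theorem newsBackAt_eq_one_iff (N : List (V × V)) (S : Finset V) {j : ℕ} (hj : j < N.length) :
    newsBackAt N S j = 1 ↔ ¬ (N[j].1 ∈ spread (N.drop (j + 1)).reverse S ↔
      N[j].2 ∈ spread (N.drop (j + 1)).reverse S) := by
  rw [newsBackAt, spread_drop_reverse N S hj]
  by_cases h : N[j].1 ∈ spread (N.drop (j + 1)).reverse S ↔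
      N[j].2 ∈ spread (N.drop (j + 1)).reverse S
  · rw [learn_eq_self h]; simp [h]
  · rw [learn_card_of_not_iff h]; simp [h]

theorem card_spread_le (N : List (V × V)) (S : Finset V) :
    (spread N S).card ≤ S.card + N.length := by
  rw [card_spread]
  have : ∑ j : Fin N.length, newsAt N S j ≤ ∑ j : Fin N.length, 1 :=
    Finset.sum_le_sum fun j _ => newsAt_le_one N S j.2
  simp at this
  omega

/-- The number of calls in the class `k`. -/
def load {κ : Type*} [DecidableEq κ] (c : V → κ) (N : List (V × V)) (k : κ) : ℕ :=
  ∑ j : Fin N.length, if c N[j].1 = k then 1 else 0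

omit [DecidableEq V] in
theorem load_cons {κ : Type*} [DecidableEq κ] (c : V → κ) (e : V × V) (N : List (V × V)) (k : κ) :
    load c (e :: N) k = (if c e.1 = k then 1 else 0) + load c N k := by
  exact Fin.sum_univ_succ (n := N.length)
    fun j : Fin (N.length + 1) => if c (e :: N)[j].1 = k then 1 else 0

omit [DecidableEq V] in
theorem sum_load_le {κ : Type*} [DecidableEq κ] (c : V → κ) (N : List (V × V)) (K : Finset κ) :
    ∑ k ∈ K, load c N k ≤ N.length := by
  unfold load
  rw [Finset.sum_comm]
  calc _ ≤ ∑ j : Fin N.length, 1 := Finset.sum_le_sum fun j _ => by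
        rw [Finset.sum_ite_eq]; split_ifs <;> simp
    _ = N.length := by simp

omit [DecidableEq V] in
theorem load_eq_zero_iff {κ : Type*} [DecidableEq κ] {c : V → κ} {N : List (V × V)} {k : κ} :
    load c N k = 0 ↔ ∀ e ∈ N, c e.1 ≠ k := by
  induction N with
  | nil => simp [load]
  | cons e N ih => rw [load_cons]; simp [ih]

/-- The persons can be divided into classes such that calls stay within classes and every class
of `m` persons has at least `m - 1` calls. -/
theorem exists_classes [Fintype V] (N : List (V × V)) :
    ∃ c : V → V, (∀ e ∈ N, c e.1 = c e.2) ∧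
      ∀ k, (Finset.univ.filter fun v => c v = k).card ≤ load c N k + 1 := by
  induction N with
  | nil =>
    refine ⟨id, by simp, fun k => ?_⟩
    simp [Finset.filter_eq']
  | cons e N ih =>
    obtain ⟨c, hc, hk⟩ := ih
    by_cases h : c e.1 = c e.2
    · refine ⟨c, ?_, fun k => (hk k).trans ?_⟩
      · intro e' he'
        rcases List.mem_cons.1 he' with rfl | he'
        · exact h
        · exact hc _ he'
      · rw [load_cons]; omega
    -- The call joins two different classes. Each of them has at most one person more than calls;
    -- for the union the surplus is two, and the new call pays for one of them.
    · let c' : V → V := fun v => if c v = c e.2 then c e.1 else c v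
      have hload : ∀ k, load c' N k =
          if k = c e.1 then load c N (c e.1) + load c N (c e.2) else
          if k = c e.2 then 0 else load c N k := by
        intro k
        simp only [load]
        split_ifs with h1 h2
        · rw [← Finset.sum_add_distrib]
          refine Finset.sum_congr rfl fun j _ => ?_
          simp only [c']
          grind
        · refine Finset.sum_eq_zero fun j _ => ?_
          simp only [c']
          grind
        · refine Finset.sum_congr rfl fun j _ => ?_
          simp only [c']
          grind
      refine ⟨c', ?_, fun k => ?_⟩
      · intro e' he'
        rcases List.mem_cons.1 he' with rfl | he'
        · simp [c']
        · simp [c', hc _ he']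
      · rw [load_cons, hload]
        by_cases h1 : k = c e.1
        · have hsub : (Finset.univ.filter fun v => c' v = k) ⊆
              (Finset.univ.filter fun v => c v = c e.1) ∪
              (Finset.univ.filter fun v => c v = c e.2) := by
            intro v
            simp only [c', Finset.mem_filter, Finset.mem_univ, true_and, Finset.mem_union]
            grind
          have := (Finset.card_le_card hsub).trans (Finset.card_union_le _ _)
          have h3 := hk (c e.1)
          have h4 := hk (c e.2)
          have h5 : c' e.1 = k := by simp [c', h1]
          rw [if_pos h5, if_pos h1]
          omega
        · by_cases h2 : k = c e.2
          · have : (Finset.univ.filter fun v => c' v = k) = ∅ := by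
              ext v
              simp only [c', Finset.mem_filter, Finset.mem_univ, true_and, Finset.notMem_empty]
              grind
            rw [this]; simp
          · have hsub : (Finset.univ.filter fun v => c' v = k) ⊆
                (Finset.univ.filter fun v => c v = k) := by
              intro v
              simp only [c', Finset.mem_filter, Finset.mem_univ, true_and]
              grind
            have := (Finset.card_le_card hsub).trans (hk k)
            rw [if_neg h1, if_neg h2]
            omega

/-- Calls of a person who takes part in a single call are of no use for the others. -/
theorem Informs.remove_leaf {N₁ N₂ : List (V × V)} {e : V × V} {v a x : V}
    (h1 : ∀ e' ∈ N₁, e'.1 ≠ v ∧ e'.2 ≠ v) (h2 : ∀ e' ∈ N₂, e'.1 ≠ v ∧ e'.2 ≠ v)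
    (he : e.1 = v ∨ e.2 = v) (ha : a ≠ v) (hx : x ≠ v) (h : Informs (N₁ ++ e :: N₂) a x) :
    Informs (N₁ ++ N₂) a x := by
  obtain ⟨y, hy, h⟩ := informs_append.1 h
  obtain ⟨z, hz, h'⟩ := informs_cons.1 h
  have hyv : y ≠ v := by
    rintro rfl
    exact ha ((informs_to_of_notMem h1).1 hy).symm
  have hzv : z ≠ v := by
    rintro rfl
    exact hx ((informs_of_notMem h2).1 h')
  have : z = y := by
    simp only [mem_learn, Finset.mem_singleton] at hz
    grind
  subst this
  exact informs_append.2 ⟨z, hy, h'⟩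

theorem exists_first {α : Type*} {P : α → Prop} {N : List α} (h : ∃ e ∈ N, P e) :
    ∃ N₁ e N₂, N = N₁ ++ e :: N₂ ∧ P e ∧ ∀ e' ∈ N₁, ¬ P e' := by
  induction N with
  | nil => simp at h
  | cons a N ih =>
    by_cases ha : P a
    · exact ⟨[], a, N, rfl, ha, by simp⟩
    · have : ∃ e ∈ N, P e := by
        obtain ⟨e, he, hP⟩ := h
        rcases List.mem_cons.1 he with rfl | he
        · exact absurd hP ha
        · exact ⟨e, he, hP⟩
      obtain ⟨N₁, e, N₂, rfl, h1, h2⟩ := ih this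
      refine ⟨a :: N₁, e, N₂, rfl, h1, ?_⟩
      simp only [List.mem_cons, forall_eq_or_imp]
      exact ⟨ha, h2⟩

/-- The calls through which information can reach `Z` are at least as many as the persons whose
information reaches `Z`, minus `#Z`; they are of no use for the other persons. -/
theorem exists_prune (N : List (V × V)) (Z : Finset V) :
    ∃ N' : List (V × V), N'.Sublist N ∧
      N'.length + (spread N.reverse Z).card ≤ N.length + Z.card ∧
      ∀ b, b ∉ spread N.reverse Z → ∀ x, Informs N b x → Informs N' b x := by
  induction N with
  | nil => exact ⟨[], List.Sublist.refl _, by simp, fun _ _ _ h => h⟩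
  | cons e N ih =>
    obtain ⟨N', hsub, hcard, hN'⟩ := ih
    have hsp : spread (e :: N).reverse Z = learn e (spread N.reverse Z) := by
      rw [List.reverse_cons, spread_append]; rfl
    -- A call touching the set of persons who reach `Z` is dropped; it enlarges the set by at most
    -- one person. Persons outside the enlarged set do not take part in it, so they do not miss it.
    by_cases he : e.1 ∈ spread N.reverse Z ∨ e.2 ∈ spread N.reverse Z
    · refine ⟨N', hsub.trans (List.sublist_cons_self _ _), ?_, ?_⟩
      · rw [hsp]
        have := learn_card_le e (spread N.reverse Z)
        simp only [List.length_cons]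
        omega
      · intro b hb x hx
        rw [hsp, mem_learn] at hb
        push Not at hb
        obtain ⟨hb1, hb2⟩ := hb
        obtain ⟨hb2, hb3⟩ := hb2 he
        rw [Informs, spread_cons, learn_singleton_of_notMem hb2.symm hb3.symm] at hx
        exact hN' b hb1 x hx
    · refine ⟨e :: N', hsub.cons_cons e, ?_, ?_⟩
      · rw [hsp, learn, if_neg he]
        simp only [List.length_cons]
        omega
      · intro b hb x hx
        rw [hsp, learn, if_neg he] at hb
        obtain ⟨z, hz, hx⟩ := informs_cons.1 hx
        refine informs_cons.2 ⟨z, hz, hN' z ?_ x hx⟩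
        simp only [mem_learn, Finset.mem_singleton] at hz
        push Not at he
        rcases hz with rfl | ⟨_, rfl | rfl⟩
        exacts [hb, he.1, he.2]

end Spread

end MAL

/-! ## Systems of calls between items -/

namespace MAL

section Systems

variable {V : Type*} [DecidableEq V]

/-- `G` has no cycle of length four. -/
def NoFourCycle (G : SimpleGraph V) : Prop :=
  ∀ a b c d, G.Adj a b → G.Adj b c → G.Adj c d → G.Adj d a → a = c ∨ b = d

/-- An item is a vertex or an edge. -/
def IsItem (G : SimpleGraph V) (A : Finset V) : Prop :=
  ∃ a b, A = {a, b} ∧ (a = b ∨ G.Adj a b)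

/-- The sets in `F` are pairwise disjoint. -/
def Disj (F : Finset (Finset V)) : Prop :=
  ∀ A ∈ F, ∀ B ∈ F, ∀ v ∈ A, v ∈ B → A = B

/-- Calls along edges of `G` such that information from every item in `As` reaches every item
in `Xs`. -/
structure System (G : SimpleGraph V) (N : List (V × V)) (As Xs : Finset (Finset V)) : Prop where
  adj : ∀ e ∈ N, G.Adj e.1 e.2
  itemA : ∀ A ∈ As, IsItem G A
  itemX : ∀ X ∈ Xs, IsItem G X
  disjA : Disj As
  disjX : Disj Xs
  reach : ∀ A ∈ As, ∀ X ∈ Xs, ∃ a ∈ A, ∃ x ∈ X, Informs N a x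

variable {G : SimpleGraph V} {N : List (V × V)} {As Xs : Finset (Finset V)}

theorem System.reverse (h : System G N As Xs) : System G N.reverse Xs As where
  adj e he := h.adj e (List.mem_reverse.1 he)
  itemA := h.itemX
  itemX := h.itemA
  disjA := h.disjX
  disjX := h.disjA
  reach X hX A hA := by
    obtain ⟨a, ha, x, hx, hax⟩ := h.reach A hA X hX
    exact ⟨x, hx, a, ha, informs_reverse.2 hax⟩

omit [DecidableEq V] in
theorem Disj.subset {F F' : Finset (Finset V)} (h : Disj F) (hF : F' ⊆ F) : Disj F' :=
  fun A hA B hB => h A (hF hA) B (hF hB)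

omit [DecidableEq V] in
theorem Disj.card_le {F : Finset (Finset V)} (hF : Disj F) {S : Finset V}
    (hS : ∀ X ∈ F, ∃ x ∈ X, x ∈ S) : F.card ≤ S.card := by
  rcases F.eq_empty_or_nonempty with rfl | ⟨Y, hY⟩
  · simp
  have : Nonempty V := ⟨(hS Y hY).choose⟩
  choose! f hf hfS using hS
  exact Finset.card_le_card_of_injOn f hfS fun X hX Y hY hXY =>
    hF X hX Y hY (f X) (hf X hX) (hXY ▸ hf Y hY)

/-- If `S` meets the sets of a disjoint family and has no more elements than the family, then
every set contains at most one element of `S`. -/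
theorem Disj.eq_of_mem {F : Finset (Finset V)} (hF : Disj F) {S : Finset V}
    (hS : ∀ X ∈ F, ∃ x ∈ X, x ∈ S) (hc : S.card ≤ F.card) {X : Finset V} (hX : X ∈ F) {x y : V}
    (hx : x ∈ X) (hy : y ∈ X) (hxS : x ∈ S) (hyS : y ∈ S) : x = y := by
  by_contra hxy
  have := hF.card_le (S := S.erase x) fun Y hY => by
    by_cases hYX : Y = X
    · subst hYX
      exact ⟨y, hy, Finset.mem_erase.2 ⟨Ne.symm hxy, hyS⟩⟩
    · obtain ⟨z, hz, hzS⟩ := hS Y hY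
      refine ⟨z, hz, Finset.mem_erase.2 ⟨?_, hzS⟩⟩
      rintro rfl
      exact hYX (hF Y hY X hX z hz hx)
  rw [Finset.card_erase_of_mem hxS] at this
  have := Finset.card_pos.2 ⟨x, hxS⟩
  omega

theorem Disj.exists_mem {F : Finset (Finset V)} (hF : Disj F) {S : Finset V}
    (hS : ∀ X ∈ F, ∃ x ∈ X, x ∈ S) (hc : S.card ≤ F.card) {x : V}
    (hxS : x ∈ S) : ∃ X ∈ F, x ∈ X := by
  by_contra! hxF
  have := hF.card_le (S := S.erase x) fun Y hY => by
    obtain ⟨z, hz, hzS⟩ := hS Y hY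
    refine ⟨z, hz, Finset.mem_erase.2 ⟨?_, hzS⟩⟩
    rintro rfl
    exact hxF Y hY hz
  rw [Finset.card_erase_of_mem hxS] at this
  have := Finset.card_pos.2 ⟨x, hxS⟩
  omega

theorem IsItem.card_le {A : Finset V} (h : IsItem G A) : A.card ≤ 2 := by
  obtain ⟨a, b, rfl, _⟩ := h
  exact Finset.card_le_two

theorem IsItem.nonempty {A : Finset V} (h : IsItem G A) : A.Nonempty := by
  obtain ⟨a, b, rfl, _⟩ := h
  exact ⟨a, by simp⟩

/-- If every call informs one more person on `A` and one more on `B`, starting from a situation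
where all informed persons but `a'` and `b'` are informed on both, then the situation persists. -/
theorem spread_pair_invariant {a' b' : V} (hab : ¬ G.Adj a' b') (N : List (V × V)) :
    ∀ M : Finset V, (∀ e ∈ N, G.Adj e.1 e.2) → a' ∉ M → b' ∉ M → a' ≠ b' →
      (spread N (insert a' M)).card = M.card + 1 + N.length →
      (spread N (insert b' M)).card = M.card + 1 + N.length →
      ∃ M', a' ∉ M' ∧ b' ∉ M' ∧ spread N (insert a' M) = insert a' M' ∧
        spread N (insert b' M) = insert b' M' := by
  induction N with
  | nil => intro M _ ha hb _ _ _; exact ⟨M, ha, hb, rfl, rfl⟩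
  | cons e N ih =>
    intro M hadj ha hb hne hA hB
    have hadj' := fun e he => hadj e (List.mem_cons_of_mem _ he)
    have he := hadj e List.mem_cons_self
    have hlen : (e :: N).length = N.length + 1 := rfl
    rw [spread_cons] at hA hB ⊢
    rw [spread_cons]
    have hkey : ∀ z, z ∉ M → (spread N (learn e (insert z M))).card = M.card + 1 + (e :: N).length →
        ¬ (e.1 ∈ insert z M ↔ e.2 ∈ insert z M) := by
      intro z hz hcard h
      rw [learn_eq_self h] at hcard
      have := card_spread_le N (insert z M)
      have := Finset.card_insert_of_notMem hz
      omega
    have h1 := hkey a' ha hA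
    have h2 := hkey b' hb hB
    simp only [Finset.mem_insert] at h1 h2
    -- The call brings news about both sets, and it is not between `a'` and `b'`, which are not
    -- adjacent. So it leads from the common part `M` to a person `v` who is new for both.
    have h3 : ∃ v, v ≠ a' ∧ v ≠ b' ∧ v ∉ M ∧
        (∀ z, z ≠ v → (learn e (insert z M) = insert z (insert v M) ∨ (z ≠ a' ∧ z ≠ b'))) := by
      have hab' : ¬ G.Adj b' a' := fun h => hab h.symm
      by_cases hM1 : e.1 ∈ M
      · refine ⟨e.2, by tauto, by tauto, by tauto, fun z hz => Or.inl ?_⟩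
        ext x
        simp only [mem_learn, Finset.mem_insert]
        grind
      · by_cases hM2 : e.2 ∈ M
        · refine ⟨e.1, by tauto, by tauto, by tauto, fun z hz => Or.inl ?_⟩
          ext x
          simp only [mem_learn, Finset.mem_insert]
          grind
        · exfalso
          have : (e.1 = a' ∧ e.2 = b') ∨ (e.1 = b' ∧ e.2 = a') := by
            grind
          rcases this with ⟨h, h'⟩ | ⟨h, h'⟩ <;> rw [h, h'] at he <;> tauto
    obtain ⟨v, hva, hvb, hvM, hv⟩ := h3
    have e1 : learn e (insert a' M) = insert a' (insert v M) := by
      rcases hv a' hva.symm with h | h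
      · exact h
      · exact absurd rfl h.1
    have e2 : learn e (insert b' M) = insert b' (insert v M) := by
      rcases hv b' hvb.symm with h | h
      · exact h
      · exact absurd rfl h.2
    rw [e1] at hA ⊢
    rw [e2] at hB ⊢
    have hc := Finset.card_insert_of_notMem hvM
    refine ih (insert v M) hadj' ?_ ?_ hne (by omega) (by omega)
    · simp [hva.symm, ha]
    · simp [hvb.symm, hb]

/-- A set of at most two persons informs at most `N.length + 2` persons, so a counterexample forces
equality everywhere: `k = 4`, both senders are edges, and every call brings news about both. The
first call then joins them, at `a` and `b`; the other endpoints `a'` and `b'` are not adjacent, as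
there is no four-cycle, and they remain the only difference between the two sets of informed
persons. -/
theorem System.two_items (h : System G N As Xs) {k : ℕ} (hk : 4 ≤ k)
    (hG : k = 4 → NoFourCycle G) (hA : As.card = 2) (hX : 2 ≤ Xs.card) :
    As.card + Xs.card < N.length + k := by
  by_contra! hcon
  obtain ⟨A, B, hAB, rfl⟩ := Finset.card_eq_two.1 hA
  have hreach : ∀ A' ∈ ({A, B} : Finset (Finset V)), ∀ X ∈ Xs, ∃ x ∈ X, x ∈ spread N A' := by
    intro A' hA' X hX
    obtain ⟨a, ha, x, hx, hax⟩ := h.reach A' hA' X hX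
    exact ⟨x, hx, mem_spread.2 ⟨a, ha, hax⟩⟩
  have hcard : ∀ A' ∈ ({A, B} : Finset (Finset V)), k = 4 ∧ A'.card = 2 ∧
      (spread N A').card = Xs.card ∧ Xs.card = N.length + 2 := by
    intro A' hA'
    have h1 := h.disjX.card_le (hreach A' hA')
    have h2 := card_spread_le N A'
    have h3 := (h.itemA A' hA').card_le
    omega
  obtain ⟨hk4, hA2, hsA, hXN⟩ := hcard A (by simp)
  obtain ⟨-, hB2, hsB, -⟩ := hcard B (by simp)
  have hG := hG hk4
  have hdisj : ∀ v, v ∈ A → v ∈ B → False := fun v hv hv' =>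
    hAB (h.disjA A (by simp) B (by simp) v hv hv')
  have honeA := fun {X} (hX : X ∈ Xs) => fun {x y} =>
    h.disjX.eq_of_mem (hreach A (by simp)) hsA.le hX (x := x) (y := y)
  have honeB := fun {X} (hX : X ∈ Xs) => fun {x y} =>
    h.disjX.eq_of_mem (hreach B (by simp)) hsB.le hX (x := x) (y := y)
  have hadjA : ∀ a a', a ∈ A → a' ∈ A → a ≠ a' → G.Adj a a' := by
    intro a a' ha ha' hne
    obtain ⟨p, q, rfl, hpq⟩ := h.itemA A (by simp)
    have := G.adj_symm (u := p) (v := q)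
    grind
  have hadjB : ∀ a a', a ∈ B → a' ∈ B → a ≠ a' → G.Adj a a' := by
    intro a a' ha ha' hne
    obtain ⟨p, q, rfl, hpq⟩ := h.itemA B (by simp)
    have := G.adj_symm (u := p) (v := q)
    grind
  have hadjX : ∀ X ∈ Xs, ∀ a a', a ∈ X → a' ∈ X → a ≠ a' → G.Adj a a' := by
    intro X hX a a' ha ha' hne
    obtain ⟨p, q, rfl, hpq⟩ := h.itemX X hX
    have := G.adj_symm (u := p) (v := q)
    grind
  cases N with
  | nil =>
    simp only [spread_nil] at *
    obtain ⟨X, Y, hXY, rfl⟩ := Finset.card_eq_two.1 (by simpa using hXN)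
    obtain ⟨a, haX, haA⟩ := hreach A (by simp) X (by simp)
    obtain ⟨a', haY, haA'⟩ := hreach A (by simp) Y (by simp)
    obtain ⟨b, hbX, hbB⟩ := hreach B (by simp) X (by simp)
    obtain ⟨b', hbY, hbB'⟩ := hreach B (by simp) Y (by simp)
    have hXY' : ∀ v, v ∈ X → v ∈ Y → False := fun v hv hv' =>
      hXY (h.disjX X (by simp) Y (by simp) v hv hv')
    have h1 : a ≠ a' := by rintro rfl; exact hXY' _ haX haY
    have h2 : b ≠ b' := by rintro rfl; exact hXY' _ hbX hbY
    have h3 : a ≠ b := by rintro rfl; exact hdisj _ haA hbB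
    have h4 : a' ≠ b' := by rintro rfl; exact hdisj _ haA' hbB'
    rcases hG a a' b' b (hadjA _ _ haA haA' h1) (hadjX Y (by simp) _ _ haY hbY h4)
      (hadjB _ _ hbB' hbB h2.symm) (hadjX X (by simp) _ _ hbX haX h3.symm) with rfl | rfl
    · exact hdisj _ haA hbB'
    · exact hdisj _ haA' hbB
  | cons e N =>
    have hlen : (e :: N).length = N.length + 1 := rfl
    have he := h.adj e List.mem_cons_self
    have hkey : ∀ A' : Finset V, A'.card = 2 → (spread (e :: N) A').card = Xs.card →
        ¬ (e.1 ∈ A' ↔ e.2 ∈ A') := by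
      intro A' hA' hs hiff
      rw [spread_cons, learn_eq_self hiff] at hs
      have := card_spread_le N A'
      omega
    have h1 := hkey A hA2 hsA
    have h2 := hkey B hB2 hsB
    obtain ⟨a, b, haA, hbB, hab, he'⟩ : ∃ a b, a ∈ A ∧ b ∈ B ∧ G.Adj a b ∧
        (e = (a, b) ∨ e = (b, a)) := by
      by_cases hA1 : e.1 ∈ A
      · refine ⟨e.1, e.2, hA1, ?_, he, Or.inl rfl⟩
        have := hdisj e.1 hA1
        tauto
      · refine ⟨e.2, e.1, by tauto, ?_, he.symm, Or.inr rfl⟩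
        have := hdisj e.2
        tauto
    have haB : a ∉ B := fun h => hdisj _ haA h
    have hbA : b ∉ A := fun h => hdisj _ h hbB
    obtain ⟨a', ha', hA'⟩ : ∃ a', a' ≠ a ∧ A = {a, a'} := by
      obtain ⟨p, q, hpq, rfl⟩ := Finset.card_eq_two.1 hA2
      rcases (by simpa using haA : a = p ∨ a = q) with rfl | rfl
      · exact ⟨q, hpq.symm, rfl⟩
      · exact ⟨p, hpq, Finset.pair_comm _ _⟩
    obtain ⟨b', hb', hB'⟩ : ∃ b', b' ≠ b ∧ B = {b, b'} := by
      obtain ⟨p, q, hpq, rfl⟩ := Finset.card_eq_two.1 hB2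
      rcases (by simpa using hbB : b = p ∨ b = q) with rfl | rfl
      · exact ⟨q, hpq.symm, rfl⟩
      · exact ⟨p, hpq, Finset.pair_comm _ _⟩
    have haA' : a' ∈ A := by simp [hA']
    have hbB' : b' ∈ B := by simp [hB']
    have hab' : a' ≠ b' := by rintro rfl; exact hdisj _ haA' hbB'
    have hab1 : a' ≠ b := by rintro rfl; exact hdisj _ haA' hbB
    have hab2 : b' ≠ a := by rintro rfl; exact hdisj _ haA hbB'
    have hnadj : ¬ G.Adj a' b' := by
      intro hadj
      rcases hG a a' b' b (hadjA _ _ haA haA' ha'.symm) hadj (hadjB _ _ hbB' hbB hb')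
        hab.symm with rfl | rfl
      · exact hdisj _ haA hbB'
      · exact hdisj _ haA' hbB
    have hLA : learn e A = insert a' {a, b} := by
      ext x
      rcases he' with rfl | rfl <;> simp only [mem_learn, hA', Finset.mem_insert,
        Finset.mem_singleton] <;> grind
    have hLB : learn e B = insert b' {a, b} := by
      ext x
      rcases he' with rfl | rfl <;> simp only [mem_learn, hB', Finset.mem_insert,
        Finset.mem_singleton] <;> grind
    have hc2 : ({a, b} : Finset V).card = 2 := Finset.card_pair hab.ne
    obtain ⟨M, haM, hbM, hMA, hMB⟩ := spread_pair_invariant hnadj N {a, b}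
      (fun e he => h.adj e (List.mem_cons_of_mem _ he)) (by simp [ha', hab1])
      (by simp [hb', hab2]) hab' (by rw [← hLA, ← spread_cons]; omega)
      (by rw [← hLB, ← spread_cons]; omega)
    have hSA : spread (e :: N) A = insert a' M := by rw [spread_cons, hLA, hMA]
    have hSB : spread (e :: N) B = insert b' M := by rw [spread_cons, hLB, hMB]
    -- The receiver containing `a'` must also be reached by `B`, either in `b'`, which would make
    -- `a'` and `b'` adjacent, or in `M`, which would give it two persons informed by `A`.
    obtain ⟨X, hX, haX⟩ := h.disjX.exists_mem (hreach A (by simp)) hsA.le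
      (x := a') (by simp [hSA])
    obtain ⟨y, hyX, hy⟩ := hreach B (by simp) X hX
    rw [hSB, Finset.mem_insert] at hy
    rcases hy with rfl | hy
    · exact hnadj (hadjX X hX _ _ haX hyX hab')
    · have : y = a' := honeA hX hyX haX (by simp [hSA, hy]) (by simp [hSA])
      exact haM (this ▸ hy)

/-- A minimal counterexample to the lower bound for systems. -/
structure MinSystem (G : SimpleGraph V) (k : ℕ) (N : List (V × V)) (As Xs : Finset (Finset V)) :
    Prop extends System G N As Xs where
  four_le : 4 ≤ k
  noFourCycle : k = 4 → NoFourCycle G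
  twoA : 2 ≤ As.card
  twoX : 2 ≤ Xs.card
  small : N.length + k ≤ As.card + Xs.card
  minimal : ∀ N' As' Xs', N'.length + As'.card + Xs'.card < N.length + As.card + Xs.card →
    System G N' As' Xs' → 2 ≤ As'.card → 2 ≤ Xs'.card → As'.card + Xs'.card < N'.length + k

theorem MinSystem.reverse {k : ℕ} (h : MinSystem G k N As Xs) : MinSystem G k N.reverse Xs As where
  toSystem := h.toSystem.reverse
  four_le := h.four_le
  noFourCycle := h.noFourCycle
  twoA := h.twoX
  twoX := h.twoA
  small := by have := h.small; simp; omega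
  minimal N' As' Xs' hlt hS hA hX := by
    have := h.minimal N'.reverse Xs' As' (by simp at *; omega) hS.reverse hX hA
    simp at this
    omega

theorem MinSystem.threeA {k : ℕ} (h : MinSystem G k N As Xs) : 3 ≤ As.card := by
  by_contra hlt
  have h2 : As.card = 2 := by have := h.twoA; omega
  have := h.toSystem.two_items h.four_le h.noFourCycle h2 h.twoX
  have := h.small
  omega

theorem MinSystem.threeX {k : ℕ} (h : MinSystem G k N As Xs) : 3 ≤ Xs.card := h.reverse.threeA

/-- In a minimal counterexample, no vertex of an item can replace the item. -/
theorem MinSystem.exists_not_informs {k : ℕ} (h : MinSystem G k N As Xs) {A : Finset V}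
    (hA : A ∈ As) {a : V} (ha : a ∈ A) : ∃ X ∈ Xs, ∀ x ∈ X, ¬ Informs N a x := by
  by_contra! hcon
  have hex : ∃ e ∈ N, e.1 = a ∨ e.2 = a := by
    by_contra! hno
    obtain ⟨X, hX, Y, hY, hXY⟩ := Finset.one_lt_card.1 (show 1 < Xs.card from h.twoX)
    obtain ⟨x, hx, hx'⟩ := hcon X hX
    obtain ⟨y, hy, hy'⟩ := hcon Y hY
    rw [informs_of_notMem hno] at hx' hy'
    subst hx' hy'
    exact hXY (h.disjX X hX Y hY _ hx hy)
  obtain ⟨N₁, e, N₂, hN, he, hN₁⟩ := exists_first hex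
  push Not at hN₁
  obtain ⟨z, hza, hez⟩ : ∃ z, z ≠ a ∧ (e = (a, z) ∨ e = (z, a)) := by
    have hadj := h.adj e (by simp [hN])
    rcases he with rfl | rfl
    · exact ⟨e.2, hadj.ne.symm, Or.inl rfl⟩
    · exact ⟨e.1, hadj.ne, Or.inr rfl⟩
  have hadj : G.Adj a z := by
    have := h.adj e (by simp [hN])
    rcases hez with rfl | rfl
    exacts [this, this.symm]
  obtain ⟨N', hsub, hlen, hN'⟩ := exists_prune N₁ {z}
  set C := spread N₁.reverse {z} with hC
  have hlN : N.length = N₁.length + 1 + N₂.length := by simp [hN]; omega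
  have hsa : spread N₁ {a} = {a} := spread_singleton_of_notMem hN₁
  have haz : learn e {a} = {a, z} := by
    ext x
    rcases hez with rfl | rfl <;>
      (simp only [mem_learn, Finset.mem_singleton, Finset.mem_insert]; tauto)
  have hspa : spread N {a} = spread N₂ {a, z} := by
    rw [hN, spread_append, spread_cons, hsa, haz]
  have haC : a ∉ C := by
    intro haC
    have : Informs N₁ a z := informs_reverse.1 haC
    exact hza ((informs_of_notMem hN₁).1 this)
  have hzC : z ∈ C := Informs.refl _ _
  -- Let `e` be the first call of `a`, with partner `z`, and `C` the set of persons who reach `z`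
  -- before it. In the smaller system `A` is replaced by the edge `{a, z}`, the senders meeting `C`
  -- are dropped, and so are `e` and the calls before it through which information reaches `z`. At
  -- least `C.card` calls and at most `C.card` senders disappear, so the system remains a
  -- counterexample.
  let Bs := As.filter fun B => B ≠ A ∧ ∃ b ∈ B, b ∈ C
  let Cs := As.filter fun B => B ≠ A ∧ ∀ b ∈ B, b ∉ C
  have hpart : As.card = 1 + Bs.card + Cs.card := by
    have h1 : As = insert A (Bs ∪ Cs) := by
      ext B
      simp only [Bs, Cs, Finset.mem_insert, Finset.mem_union, Finset.mem_filter]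
      constructor
      · intro hB
        by_cases hBA : B = A
        · exact Or.inl hBA
        · by_cases hb : ∃ b ∈ B, b ∈ C
          · exact Or.inr (Or.inl ⟨hB, hBA, hb⟩)
          · push Not at hb
            exact Or.inr (Or.inr ⟨hB, hBA, hb⟩)
      · rintro (rfl | h | h)
        exacts [hA, h.1, h.1]
    have h2 : Disjoint Bs Cs := by
      rw [Finset.disjoint_left]
      intro B hB hB'
      simp only [Bs, Cs, Finset.mem_filter] at hB hB'
      obtain ⟨b, hb, hbC⟩ := hB.2.2
      exact hB'.2.2 b hb hbC
    have h3 : A ∉ Bs ∪ Cs := by simp [Bs, Cs]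
    conv_lhs => rw [h1]
    rw [Finset.card_insert_of_notMem h3, Finset.card_union_of_disjoint h2]
    omega
  have hBs : Bs.card ≤ C.card := by
    refine Disj.card_le (h.disjA.subset (Finset.filter_subset _ _)) fun B hB => ?_
    exact (Finset.mem_filter.1 hB).2.2
  have hsm := h.small
  have hk := h.four_le
  have hCpos : 0 < C.card := Finset.card_pos.2 ⟨z, hzC⟩
  simp only [Finset.card_singleton] at hlen
  -- The smaller system needs two senders. If none is left besides `{a, z}`, then the senders are at
  -- most `C.card + 1`, the receivers at most `N₂.length + 2`, and `C.card ≤ N₁.length + 1`; this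
  -- contradicts the assumed size directly.
  by_cases hCs : Cs.card = 0
  · have h1 : Xs.card ≤ (spread N {a}).card := h.disjX.card_le fun X hX => by
      obtain ⟨x, hx, hax⟩ := hcon X hX
      exact ⟨x, hx, hax⟩
    rw [hspa] at h1
    have h2 := card_spread_le N₂ {a, z}
    rw [Finset.card_pair hza.symm] at h2
    omega
  · have hnew : ({a, z} : Finset V) ∉ Cs := by
      intro hmem
      exact (Finset.mem_filter.1 hmem).2.2 z (by simp) hzC
    have hcard : (insert {a, z} Cs).card = Cs.card + 1 := Finset.card_insert_of_notMem hnew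
    have hlt := h.minimal (N' ++ N₂) (insert {a, z} Cs) Xs
    rw [hcard, List.length_append] at hlt
    have := hlt (by omega) ?_ (by omega) h.twoX
    · omega
    · refine ⟨?_, ?_, h.itemX, ?_, h.disjX, ?_⟩
      · intro e he
        refine h.adj e ?_
        rw [hN]
        rcases List.mem_append.1 he with he | he
        · exact List.mem_append_left _ (hsub.subset he)
        · exact List.mem_append_right _ (List.mem_cons_of_mem _ he)
      · intro B hB
        rcases Finset.mem_insert.1 hB with rfl | hB
        · exact ⟨a, z, rfl, Or.inr hadj⟩
        · exact h.itemA B (Finset.mem_filter.1 hB).1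
      · have hnot : ∀ B ∈ Cs, ∀ v ∈ ({a, z} : Finset V), v ∉ B := by
          intro B hB v hv hvB
          obtain ⟨hBA, hne, hBC⟩ := Finset.mem_filter.1 hB
          rcases (by simpa using hv : v = a ∨ v = z) with rfl | rfl
          · exact hne (h.disjA B hBA A hA _ hvB ha)
          · exact hBC _ hvB hzC
        intro B hB B' hB' v hv hv'
        rcases Finset.mem_insert.1 hB with rfl | hB <;>
          rcases Finset.mem_insert.1 hB' with rfl | hB'
        · rfl
        · exact absurd hv' (hnot _ hB' v hv)
        · exact absurd hv (hnot _ hB v hv')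
        · exact h.disjA B (Finset.mem_filter.1 hB).1 B' (Finset.mem_filter.1 hB').1 v hv hv'
      · intro B hB X hX
        rcases Finset.mem_insert.1 hB with rfl | hB
        · obtain ⟨x, hx, hax⟩ := hcon X hX
          have hx' : x ∈ spread N {a} := hax
          rw [hspa] at hx'
          obtain ⟨y, hy, hyx⟩ := mem_spread.1 hx'
          exact ⟨y, hy, x, hx, informs_append.2 ⟨y, Informs.refl _ _, hyx⟩⟩
        · obtain ⟨hBA, hne, hBC⟩ := Finset.mem_filter.1 hB
          obtain ⟨b, hb, x, hx, hbx⟩ := h.reach B hBA X hX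
          refine ⟨b, hb, x, hx, ?_⟩
          rw [hN] at hbx
          obtain ⟨y, hy, hyx⟩ := informs_append.1 hbx
          obtain ⟨y', hy', hyx'⟩ := informs_cons.1 hyx
          have hya : y ≠ a := by
            rintro rfl
            have := (informs_to_of_notMem hN₁).1 hy
            subst this
            exact hne (h.disjA B hBA A hA _ hb ha)
          have hyz : y ≠ z := by
            rintro rfl
            exact hBC b hb (informs_reverse.2 hy)
          have hyy : y' = y := by
            rw [learn_singleton_of_notMem] at hy'
            · simpa using hy'
            · rcases hez with rfl | rfl
              exacts [hya.symm, hyz.symm]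
            · rcases hez with rfl | rfl
              exacts [hyz.symm, hya.symm]
          subst hyy
          exact informs_append.2 ⟨y', hN' b (hBC b hb) _ hy, hyx'⟩

end Systems

end MAL

/-! ## Isolated vertices of minimal counterexamples -/

namespace MAL

section Isolated

variable {V : Type*} [DecidableEq V]
variable {G : SimpleGraph V} {N : List (V × V)} {As Xs : Finset (Finset V)} {k : ℕ}

/-- The only vertex of a singleton sender would inform every receiver, which
`MinSystem.exists_not_informs` forbids. So all items of a minimal counterexample are edges. -/
theorem MinSystem.exists_eq_pair (h : MinSystem G k N As Xs) {A : Finset V} (hA : A ∈ As) {v : V}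
    (hv : v ∈ A) : ∃ a, a ≠ v ∧ G.Adj v a ∧ A = {v, a} := by
  obtain ⟨p, q, rfl, hpq⟩ := h.itemA A hA
  have hne : p ≠ q := by
    rintro rfl
    obtain ⟨X, hX, hno⟩ := h.exists_not_informs hA hv
    obtain ⟨a, ha, x, hx, hax⟩ := h.reach _ hA X hX
    simp only [Finset.pair_eq_singleton, Finset.mem_singleton] at hv ha
    subst hv ha
    exact hno x hx hax
  have hadj : G.Adj p q := hpq.resolve_left hne
  rcases (by simpa using hv : v = p ∨ v = q) with rfl | rfl
  · exact ⟨q, hne.symm, hadj, rfl⟩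
  · exact ⟨p, hne, hadj.symm, Finset.pair_comm _ _⟩

/-- If a call brings news about `S` forwards and about `T` backwards, then some `s ∈ S` informs
some `t ∈ T`, using this call. -/
theorem exists_informs_of_news {S T : Finset V} {j : ℕ} (hj : j < N.length)
    (hS : newsAt N S j = 1) (hT : newsBackAt N T j = 1) :
    ∃ s ∈ S, ∃ t ∈ T, Informs N s t ∧ Informs (N.take (j + 1)) s N[j].1 ∧
      (Informs (N.drop (j + 1)) N[j].1 t ∨ Informs (N.drop (j + 1)) N[j].2 t) := by
  rw [newsAt_eq_one_iff N S hj] at hS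
  rw [newsBackAt_eq_one_iff N T hj] at hT
  have h1 : N[j].1 ∈ spread (N.take j) S ∨ N[j].2 ∈ spread (N.take j) S := by tauto
  have h2 : N[j].1 ∈ spread (N.drop (j + 1)).reverse T ∨
      N[j].2 ∈ spread (N.drop (j + 1)).reverse T := by tauto
  obtain ⟨s, hs, h1⟩ : ∃ s ∈ S, Informs (N.take j) s N[j].1 ∨ Informs (N.take j) s N[j].2 := by
    rcases h1 with h1 | h1 <;> obtain ⟨s, hs, h⟩ := mem_spread.1 h1
    exacts [⟨s, hs, Or.inl h⟩, ⟨s, hs, Or.inr h⟩]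
  obtain ⟨t, ht, h2⟩ : ∃ t ∈ T, Informs (N.drop (j + 1)) N[j].1 t ∨
      Informs (N.drop (j + 1)) N[j].2 t := by
    rcases h2 with h2 | h2 <;> obtain ⟨s, hs, h⟩ := mem_spread.1 h2
    exacts [⟨s, hs, Or.inl (informs_reverse.1 h)⟩, ⟨s, hs, Or.inr (informs_reverse.1 h)⟩]
  have h3 : ∀ z, z = N[j].1 ∨ z = N[j].2 → Informs (N.take (j + 1)) s z := by
    intro z hz
    rw [Informs, spread_take_succ N _ hj, mem_learn]
    exact Or.inr ⟨h1, hz⟩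
  refine ⟨s, hs, t, ht, ?_, h3 _ (Or.inl rfl), h2⟩
  rw [← List.take_append_drop (j + 1) N, informs_append]
  rcases h2 with h2 | h2
  · exact ⟨_, h3 _ (Or.inl rfl), h2⟩
  · exact ⟨_, h3 _ (Or.inr rfl), h2⟩

theorem news_add_le_one {a x : V} (hax : ¬ Informs N a x) {j : ℕ} (hj : j < N.length) :
    newsAt N {a} j + newsBackAt N {x} j ≤ 1 := by
  have h1 := newsAt_le_one N {a} hj
  have h2 := newsBackAt_le_one N {x} hj
  by_contra h
  obtain ⟨s, hs, t, ht, hst, -⟩ := exists_informs_of_news (S := {a}) (T := {x}) hj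
    (by omega) (by omega)
  rw [Finset.mem_singleton] at hs ht
  subst hs ht
  exact hax hst

/-- `y` takes part in no call and belongs to the items `{y, a}` and `{y, x}`; information of `a`
does not reach `x`, and the numbers of persons informed by `a` and of persons informing `x` are
as small as possible. -/
structure Tight (N : List (V × V)) (As Xs : Finset (Finset V)) (y a x : V) : Prop where
  isolated : ∀ e ∈ N, e.1 ≠ y ∧ e.2 ≠ y
  memA : {y, a} ∈ As
  memX : {y, x} ∈ Xs
  neA : a ≠ y
  neX : x ≠ y
  not_informs : ¬ Informs N a x
  reachX : ∀ X ∈ Xs, X ≠ {y, x} → ∃ x' ∈ X, Informs N a x'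
  reachA : ∀ A ∈ As, A ≠ {y, a} → ∃ a' ∈ A, Informs N a' x
  cardX : (spread N {a}).card + 1 = Xs.card
  cardA : (spread N.reverse {x}).card + 1 = As.card

theorem Tight.reverse {y a x : V} (h : Tight N As Xs y a x) : Tight N.reverse Xs As y x a where
  isolated e he := h.isolated e (List.mem_reverse.1 he)
  memA := h.memX
  memX := h.memA
  neA := h.neX
  neX := h.neA
  not_informs h' := h.not_informs (informs_reverse.1 h')
  reachX A hA hne := by simpa only [informs_reverse] using h.reachA A hA hne
  reachA X hX hne := by simpa only [informs_reverse] using h.reachX X hX hne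
  cardX := h.cardA
  cardA := by simpa using h.cardX

/-- As `y` makes no calls, `a` must inform all receivers except `{y, x}`, and hence not `x`, since
`a` cannot replace its item. So no call brings both news about `a` and backward news about `x`, and
`N.length` bounds the sum of the two counts of news. The size of a counterexample turns all these
bounds into equalities. -/
theorem MinSystem.exists_tight (h : MinSystem G k N As Xs) {y : V}
    (hy : ∀ e ∈ N, e.1 ≠ y ∧ e.2 ≠ y) {A X : Finset V} (hA : A ∈ As) (hX : X ∈ Xs) (hyA : y ∈ A)
    (hyX : y ∈ X) : ∃ a x, A = {y, a} ∧ X = {y, x} ∧ Tight N As Xs y a x := by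
  obtain ⟨a, hay, -, rfl⟩ := h.exists_eq_pair hA hyA
  obtain ⟨x, hxy, -, rfl⟩ := h.reverse.exists_eq_pair hX hyX
  have hreachX : ∀ X ∈ Xs, X ≠ {y, x} → ∃ x' ∈ X, Informs N a x' := by
    intro X' hX' hne
    obtain ⟨b, hb, x', hx', hbx⟩ := h.reach _ hA X' hX'
    rcases (by simpa using hb : b = y ∨ b = a) with rfl | rfl
    · rw [informs_of_notMem hy] at hbx
      subst hbx
      exact absurd (h.disjX _ hX' _ hX _ hx' (by simp)) hne
    · exact ⟨x', hx', hbx⟩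
  have hreachA : ∀ A ∈ As, A ≠ {y, a} → ∃ a' ∈ A, Informs N a' x := by
    intro A' hA' hne
    obtain ⟨b, hb, x', hx', hbx⟩ := h.reach A' hA' _ hX
    rcases (by simpa using hx' : x' = y ∨ x' = x) with rfl | rfl
    · rw [informs_to_of_notMem hy] at hbx
      subst hbx
      exact absurd (h.disjA _ hA' _ hA _ hb (by simp)) hne
    · exact ⟨b, hb, hbx⟩
  have hnot : ¬ Informs N a x := by
    obtain ⟨X', hX', hno⟩ := h.exists_not_informs hA (a := a) (by simp)
    by_cases hX'X : X' = {y, x}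
    · subst hX'X
      exact hno x (by simp)
    · obtain ⟨x', hx', hax⟩ := hreachX X' hX' hX'X
      exact absurd hax (hno x' hx')
  have hcX : Xs.card ≤ (spread N {a}).card + 1 := by
    have := (h.disjX.subset (Finset.erase_subset {y, x} Xs)).card_le (S := spread N {a})
      fun X' hX' => hreachX X' (Finset.mem_of_mem_erase hX') (Finset.ne_of_mem_erase hX')
    rw [Finset.card_erase_of_mem hX] at this
    omega
  have hcA : As.card ≤ (spread N.reverse {x}).card + 1 := by
    have := (h.disjA.subset (Finset.erase_subset {y, a} As)).card_le (S := spread N.reverse {x})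
      fun A' hA' => by
        obtain ⟨a', ha', hax⟩ := hreachA A' (Finset.mem_of_mem_erase hA')
          (Finset.ne_of_mem_erase hA')
        exact ⟨a', ha', informs_reverse.2 hax⟩
    rw [Finset.card_erase_of_mem hA] at this
    omega
  have h1 := card_spread N {a}
  have h2 := card_spread_reverse N {x}
  have h3 : ∑ j : Fin N.length, newsAt N {a} j + ∑ j : Fin N.length, newsBackAt N {x} j ≤
      N.length := by
    rw [← Finset.sum_add_distrib]
    calc _ ≤ ∑ j : Fin N.length, 1 := Finset.sum_le_sum fun j _ => news_add_le_one hnot j.2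
      _ = N.length := by simp
  rw [Finset.card_singleton] at h1 h2
  have h4 := h.small
  have h5 := h.four_le
  exact ⟨a, x, rfl, rfl, hy, hA, hX, hay, hxy, hnot, hreachX, hreachA, by omega, by omega⟩

/-- The bound of `news_add_le_one`, summed over all calls, is attained by `Tight.cardX` and
`Tight.cardA`; so it is attained for every single call. -/
theorem Tight.news {y a x : V} (h : Tight N As Xs y a x) (hN : N.length + 4 ≤ As.card + Xs.card)
    {j : ℕ} (hj : j < N.length) : newsAt N {a} j + newsBackAt N {x} j = 1 := by
  by_contra hne
  have hlt : newsAt N {a} j + newsBackAt N {x} j < 1 :=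
    lt_of_le_of_ne (news_add_le_one h.not_informs hj) hne
  have h1 := card_spread N {a}
  have h2 := card_spread_reverse N {x}
  have h3 : ∑ j : Fin N.length, newsAt N {a} j + ∑ j : Fin N.length, newsBackAt N {x} j <
      N.length := by
    rw [← Finset.sum_add_distrib]
    calc _ < ∑ j : Fin N.length, 1 := Finset.sum_lt_sum
          (fun j _ => news_add_le_one h.not_informs j.2) ⟨⟨j, hj⟩, Finset.mem_univ _, hlt⟩
      _ = N.length := by simp
  rw [Finset.card_singleton] at h1 h2
  have h4 := h.cardA
  have h5 := h.cardX
  omega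

/-- The state of a person: `2` if it belongs to `K`, `1` if it belongs to `R`, `0` otherwise. -/
def stateOf (K R : Finset V) (p : V) : Fin 3 := if p ∈ K then 2 else if p ∈ R then 1 else 0

/-- The state of `p` before the `j`-th call, if `K` is the set of persons informed by `a` and `R`
the set of persons who can still inform `x`. -/
def stateAt (N : List (V × V)) (a x : V) (j : ℕ) (p : V) : Fin 3 :=
  stateOf (spread (N.take j) {a}) (spread (N.drop j).reverse {x}) p

/-- The possible changes of the states of the participants of a call. -/
def moves : Finset (Fin 3 × Fin 3 × Fin 3 × Fin 3) :=
  {(2, 0, 2, 2), (0, 2, 2, 2), (1, 1, 1, 0), (1, 1, 0, 1)}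

/-- The informed persons and those who can still inform `x` are disjoint, because `a` does not
inform `x`. As exactly one kind of news occurs, either an informed person informs somebody in state
0, or two persons in state 1 talk and one of them falls to state 0. -/
theorem stateAt_move {a x : V} (hax : ¬ Informs N a x) {j : ℕ} (hj : j < N.length)
    (hnews : newsAt N {a} j + newsBackAt N {x} j = 1) :
    (stateAt N a x j N[j].1, stateAt N a x j N[j].2, stateAt N a x (j + 1) N[j].1,
      stateAt N a x (j + 1) N[j].2) ∈ moves ∧
    ∀ p, p ≠ N[j].1 → p ≠ N[j].2 → stateAt N a x (j + 1) p = stateAt N a x j p := by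
  have hdisj : ∀ i p, p ∈ spread (N.take i) {a} → p ∈ spread (N.drop i).reverse {x} → False := by
    intro i p h1 h2
    refine hax ?_
    rw [← List.take_append_drop i N, informs_append]
    exact ⟨p, h1, informs_reverse.1 h2⟩
  have hd0 := hdisj j
  have hd1 := hdisj (j + 1)
  have h1 := newsAt_eq_one_iff N {a} hj
  have h2 := newsBackAt_eq_one_iff N {x} hj
  unfold stateAt
  rw [spread_take_succ N _ hj, spread_drop_reverse N _ hj] at *
  generalize spread (N.take j) {a} = K at *
  generalize spread (N.drop (j + 1)).reverse {x} = R at *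
  generalize N[j] = e at *
  have hle1 := newsAt_le_one N {a} hj
  have hle2 := newsBackAt_le_one N {x} hj
  have hor : newsAt N {a} j = 1 ∧ ¬ newsBackAt N {x} j = 1 ∨
      ¬ newsAt N {a} j = 1 ∧ newsBackAt N {x} j = 1 := by omega
  rw [h1, h2, not_not, not_not] at hor
  simp only [mem_learn] at hd0 hd1
  have hd01 := hd0 e.1
  have hd02 := hd0 e.2
  have hd11 := hd1 e.1
  have hd12 := hd1 e.2
  constructor
  · simp only [stateOf, mem_learn]
    by_cases k1 : e.1 ∈ K <;> by_cases k2 : e.2 ∈ K <;> by_cases r1 : e.1 ∈ R <;>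
      by_cases r2 : e.2 ∈ R <;> simp [k1, k2, r1, r2] at hor hd01 hd02 hd11 hd12 ⊢ <;> decide
  · intro p hp1 hp2
    simp [stateOf, mem_learn, hp1, hp2]

/-- The cyclic orientation of `(c₁, c₂)`, if `c₂ = c₃`. -/
def orientation (c₁ c₂ c₃ : Fin 3) : ℤ :=
  if c₂ = c₃ then (if c₂ = c₁ + 1 then 1 else if c₂ = c₁ + 2 then -1 else 0) else 0

set_option maxRecDepth 10000 in
-- A finite check over the 64 triples of moves. It makes the sum of the orientations of the state
-- triples of all persons invariant under calls.
theorem orientation_moves : ∀ m₁ ∈ moves, ∀ m₂ ∈ moves, ∀ m₃ ∈ moves,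
    orientation m₁.1 m₂.1 m₃.1 + orientation m₁.2.1 m₂.2.1 m₃.2.1 =
    orientation m₁.2.2.1 m₂.2.2.1 m₃.2.2.1 + orientation m₁.2.2.2 m₂.2.2.2 m₃.2.2.2 := by
  decide

theorem sum_orientation_eq [Fintype V] {a x : Fin 3 → V} (hadj : ∀ e ∈ N, G.Adj e.1 e.2)
    (hax : ∀ i, ¬ Informs N (a i) (x i))
    (hnews : ∀ i, ∀ j < N.length, newsAt N {a i} j + newsBackAt N {x i} j = 1) :
    ∀ j ≤ N.length, ∑ p, orientation (stateAt N (a 0) (x 0) j p) (stateAt N (a 1) (x 1) j p)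
        (stateAt N (a 2) (x 2) j p) =
      ∑ p, orientation (stateAt N (a 0) (x 0) 0 p) (stateAt N (a 1) (x 1) 0 p)
        (stateAt N (a 2) (x 2) 0 p) := by
  intro j
  induction j with
  | zero => intro _; rfl
  | succ j ih =>
    intro hj
    rw [← ih (by omega)]
    have hm := fun i => stateAt_move (hax i) (show j < N.length by omega) (hnews i j (by omega))
    have hne : N[j].1 ≠ N[j].2 := (hadj _ (List.getElem_mem _)).ne
    rw [← Finset.sum_add_sum_compl {N[j].1, N[j].2}, ← Finset.sum_add_sum_compl {N[j].1, N[j].2},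
      Finset.sum_pair hne, Finset.sum_pair hne]
    congr 1
    · exact (orientation_moves _ (hm 0).1 _ (hm 1).1 _ (hm 2).1).symm
    · refine Finset.sum_congr rfl fun p hp => ?_
      simp only [Finset.mem_compl, Finset.mem_insert, Finset.mem_singleton, not_or] at hp
      rw [(hm 0).2 p hp.1 hp.2, (hm 1).2 p hp.1 hp.2, (hm 2).2 p hp.1 hp.2]

/-- The sum is taken item by item. All states of `y i` are 0, and `a i` has state 2 in coordinate
`i` and 1 in the others, which has orientation `-1` for `i = 0` and 0 otherwise. In any other sender
exactly one endpoint can inform `x i`, for each `i`; the endpoints have complementary triples of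
zeros and ones, and their orientations cancel. Persons outside the items have only zeros. -/
theorem orientation_start [Fintype V] {y a x : Fin 3 → V} (hdA : Disj As) (hdX : Disj Xs)
    (ht : ∀ i, Tight N As Xs (y i) (a i) (x i)) (hcard : ∀ A ∈ As, A.card = 2)
    (hA : ∀ i j, i ≠ j → ({y i, a i} : Finset V) ≠ {y j, a j})
    (hX : ∀ i j, i ≠ j → ({y i, x i} : Finset V) ≠ {y j, x j}) :
    ∑ p, orientation (stateAt N (a 0) (x 0) 0 p) (stateAt N (a 1) (x 1) 0 p)
        (stateAt N (a 2) (x 2) 0 p) = -1 := by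
  set st : Fin 3 → V → Fin 3 := fun i p => stateAt N (a i) (x i) 0 p with hst
  have hK : ∀ i p, st i p = if p = a i then 2 else if Informs N p (x i) then 1 else 0 := by
    intro i p
    simp only [hst, stateAt, stateOf, List.take_zero, spread_nil, Finset.mem_singleton,
      List.drop_zero]
    congr 1
    simp only [← informs_reverse (x := p)]
    rfl
  have hreach : ∀ i, ∀ A ∈ As.erase {y i, a i}, ∃ b ∈ A, b ∈ spread N.reverse {x i} := by
    intro i A hA
    obtain ⟨b, hb, hbx⟩ := (ht i).reachA A (Finset.mem_of_mem_erase hA) (Finset.ne_of_mem_erase hA)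
    exact ⟨b, hb, informs_reverse.2 hbx⟩
  have hc : ∀ i, (spread N.reverse {x i}).card ≤ (As.erase {y i, a i}).card := by
    intro i
    rw [Finset.card_erase_of_mem (ht i).memA]
    have := (ht i).cardA
    omega
  have hd : ∀ i, Disj (As.erase {y i, a i}) := fun i => hdA.subset (Finset.erase_subset _ _)
  have hone : ∀ i, ∀ A ∈ As, A ≠ {y i, a i} → ∀ b ∈ A, ∀ b' ∈ A, Informs N b (x i) →
      Informs N b' (x i) → b = b' := by
    intro i A hA hne b hb b' hb' h1 h2
    exact (hd i).eq_of_mem (hreach i) (hc i) (Finset.mem_erase.2 ⟨hne, hA⟩) hb hb'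
      (informs_reverse.2 h1) (informs_reverse.2 h2)
  have hin : ∀ i p, Informs N p (x i) → ∃ A ∈ As, A ≠ {y i, a i} ∧ p ∈ A := by
    intro i p hp
    obtain ⟨A, hA, hpA⟩ := (hd i).exists_mem (hreach i) (hc i) (informs_reverse.2 hp)
    exact ⟨A, Finset.mem_of_mem_erase hA, Finset.ne_of_mem_erase hA, hpA⟩
  have hyst : ∀ i j, st j (y i) = 0 := by
    intro i j
    have h1 : y i ≠ a j := by
      intro h
      by_cases hij : i = j
      · subst hij; exact (ht i).neA h.symm
      · exact hA i j hij (hdA _ (ht i).memA _ (ht j).memA (y i) (by simp) (by simp [h]))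
    have h2 : ¬ Informs N (y i) (x j) := by
      rw [informs_of_notMem (ht i).isolated]
      intro h
      by_cases hij : i = j
      · subst hij; exact (ht i).neX h
      · exact hX i j hij (hdX _ (ht i).memX _ (ht j).memX (y i) (by simp) (by simp [h]))
    rw [hK, if_neg h1, if_neg h2]
  have hast : ∀ i j, st j (a i) = if i = j then 2 else 1 := by
    intro i j
    by_cases hij : i = j
    · subst hij; simp [hK]
    · have h1 : a i ≠ a j := by
        intro h
        exact hA i j hij (hdA _ (ht i).memA _ (ht j).memA (a i) (by simp) (by simp [h]))
      obtain ⟨b, hb, hbx⟩ := (ht j).reachA _ (ht i).memA (hA i j hij)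
      have h2 : Informs N (a i) (x j) := by
        rcases (by simpa using hb : b = y i ∨ b = a i) with rfl | rfl
        · rw [informs_of_notMem (ht i).isolated] at hbx
          exact absurd (hdX _ (ht i).memX _ (ht j).memX (y i) (by simp) (by simp [← hbx]))
            (hX i j hij)
        · exact hbx
      rw [hK, if_neg h1, if_pos h2, if_neg hij]
  let F : V → ℤ := fun p => orientation (st 0 p) (st 1 p) (st 2 p)
  change ∑ p, F p = -1
  have hsum : ∑ p, F p = ∑ A ∈ As, ∑ p ∈ A, F p := by
    rw [← Finset.sum_biUnion (t := fun A => A) (s := As)]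
    · refine (Finset.sum_subset (Finset.subset_univ _) fun p _ hp => ?_).symm
      simp only [Finset.mem_biUnion, not_exists, not_and] at hp
      have h0 : ∀ i, st i p = 0 := by
        intro i
        rw [hK, if_neg, if_neg]
        · intro h
          obtain ⟨A, hA, -, hpA⟩ := hin i p h
          exact hp A hA hpA
        · rintro rfl
          exact hp _ (ht i).memA (by simp)
      simp only [F, h0]
      decide
    · intro A hA B hB hAB
      rw [Function.onFun, Finset.disjoint_left]
      exact fun v hv hv' => hAB (hdA A hA B hB v hv hv')
  have hAi : ∀ i, ∑ p ∈ ({y i, a i} : Finset V), F p = if i = 0 then -1 else 0 := by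
    intro i
    rw [Finset.sum_pair (ht i).neA.symm]
    simp only [F, hyst, hast]
    fin_cases i <;> decide
  rw [hsum, Finset.sum_eq_single_of_mem {y 0, a 0} (ht 0).memA, hAi, if_pos rfl]
  intro A hA' hne
  by_cases hi : ∃ i, A = {y i, a i}
  · obtain ⟨i, rfl⟩ := hi
    rw [hAi, if_neg]
    rintro rfl
    exact hne rfl
  · push Not at hi
    obtain ⟨b, b', hbb, rfl⟩ := Finset.card_eq_two.1 (hcard A hA')
    rw [Finset.sum_pair hbb]
    have hne : ∀ i, ∀ p ∈ ({b, b'} : Finset V), p ≠ a i := by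
      rintro i p hp rfl
      exact hi i (hdA _ hA' _ (ht i).memA _ hp (by simp))
    have key : ∀ i, (st i b = 0 ∧ st i b' = 1) ∨ (st i b = 1 ∧ st i b' = 0) := by
      intro i
      obtain ⟨p, hp, hpx⟩ := (ht i).reachA _ hA' (hi i)
      have h1 := hone i _ hA' (hi i)
      rw [hK, hK, if_neg (hne i b (by simp)), if_neg (hne i b' (by simp))]
      by_cases hb : Informs N b (x i) <;> by_cases hb' : Informs N b' (x i)
      · exact absurd (h1 b (by simp) b' (by simp) hb hb') hbb
      · simp [hb, hb']
      · simp [hb, hb']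
      · rcases (by simpa using hp : p = b ∨ p = b') with rfl | rfl
        · exact absurd hpx hb
        · exact absurd hpx hb'
    simp only [F]
    rcases key 0 with ⟨h1, h1'⟩ | ⟨h1, h1'⟩ <;> rcases key 1 with ⟨h2, h2'⟩ | ⟨h2, h2'⟩ <;>
      rcases key 2 with ⟨h3, h3'⟩ | ⟨h3, h3'⟩ <;> rw [h1, h1', h2, h2', h3, h3'] <;> decide

/-- There are no three tight isolated vertices. -/
theorem not_three_tight [Fintype V] {y a x : Fin 3 → V} (hS : System G N As Xs)
    (hN : N.length + 4 ≤ As.card + Xs.card)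
    (ht : ∀ i, Tight N As Xs (y i) (a i) (x i)) (hcA : ∀ A ∈ As, A.card = 2)
    (hcX : ∀ X ∈ Xs, X.card = 2)
    (hA : ∀ i j, i ≠ j → ({y i, a i} : Finset V) ≠ {y j, a j})
    (hX : ∀ i j, i ≠ j → ({y i, x i} : Finset V) ≠ {y j, x j}) : False := by
  have h1 := orientation_start hS.disjA hS.disjX ht hcA hA hX
  have h2 := orientation_start hS.disjX hS.disjA (fun i => (ht i).reverse) hcX hX hA
  have h3 := sum_orientation_eq hS.adj (fun i => (ht i).not_informs)
    (fun i j hj => (ht i).news hN hj) N.length le_rfl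
  rw [h1] at h3
  -- Reversing time exchanges the states 1 and 2, which is negation modulo 3 and changes the sign of
  -- the orientation. So the invariant sum is `-1` at the beginning and `1` at the end.
  have h4 : ∀ i p, stateAt N.reverse (x i) (a i) 0 p = - stateAt N (a i) (x i) N.length p := by
    intro i p
    have : ¬ (p ∈ spread N {a i} ∧ p = x i) := by
      rintro ⟨h, rfl⟩
      exact (ht i).not_informs h
    simp only [stateAt, stateOf, List.take_zero, spread_nil, Finset.mem_singleton, List.drop_zero,
      List.reverse_reverse, List.take_length, List.drop_length, List.reverse_nil]
    split_ifs <;> first | rfl | tauto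
  have h5 : ∀ c₁ c₂ c₃ : Fin 3, orientation (-c₁) (-c₂) (-c₃) = - orientation c₁ c₂ c₃ := by
    decide
  simp only [h4, h5, Finset.sum_neg_distrib] at h2
  omega

end Isolated

end MAL

/-! ## Four classes -/

namespace MAL

section Quad

variable {V : Type*} [DecidableEq V]
variable {G : SimpleGraph V} {N : List (V × V)} {As Xs : Finset (Finset V)} {k : ℕ}

theorem load_eq_countP {c : V → V} {N : List (V × V)} {κ : V} :
    load c N κ = N.countP fun e => c e.1 = κ := by
  induction N with
  | nil => rfl
  | cons e N ih => rw [load_cons, ih, List.countP_cons]; simp; omega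

theorem load_reverse (c : V → V) (N : List (V × V)) (κ : V) :
    load c N.reverse κ = load c N κ := by
  simp [load_eq_countP]

/-- If `p` informs more persons than there are calls in its class, then every such call brings
news about `p`. -/
theorem news_of_load_le {c : V → V} (hc : ∀ e ∈ N, c e.1 = c e.2) {p : V}
    (hp : load c N (c p) + 1 ≤ (spread N {p}).card) {N₁ N₂ : List (V × V)} {e : V × V}
    (hN : N = N₁ ++ e :: N₂) (he : c e.1 = c p) :
    ¬ (e.1 ∈ spread N₁ {p} ↔ e.2 ∈ spread N₁ {p}) := by
  -- Calls outside the class of `p` bring no news about `p`. So the news about `p` is at most the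
  -- load of the class, and the hypothesis leaves no room for a call of the class without news.
  have hcls : ∀ j : Fin N.length, newsAt N {p} j ≤ if c N[j].1 = c p then 1 else 0 := by
    intro j
    split_ifs with h
    · exact newsAt_le_one N _ j.2
    · have h1 := newsAt_le_one N {p} j.2
      by_contra hcon
      have h2 := (newsAt_eq_one_iff N {p} j.2).1 (by omega)
      have h3 : N[j].1 ∈ spread (N.take j) {p} ∨ N[j].2 ∈ spread (N.take j) {p} := by
        by_contra! h4
        exact h2 ⟨fun h => absurd h h4.1, fun h => absurd h h4.2⟩
      have hc' : ∀ e ∈ N.take j, c e.1 = c e.2 := fun e he => hc e (List.mem_of_mem_take he)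
      rcases h3 with h3 | h3
      · exact h (Informs.class_eq hc' h3).symm
      · exact h ((hc _ (List.getElem_mem _)).trans (Informs.class_eq hc' h3).symm)
  have hj : N₁.length < N.length := by simp [hN]
  have hNj : N[N₁.length] = e := by simp [hN]
  have htake : N.take N₁.length = N₁ := by simp [hN]
  have h1 : newsAt N {p} N₁.length = 1 := by
    by_contra hne
    have hlt := Finset.sum_lt_sum (fun j _ => hcls j) ⟨⟨N₁.length, hj⟩, Finset.mem_univ _, by
      have := newsAt_le_one N {p} hj
      rw [if_pos (by simpa [hNj] using he)]
      exact lt_of_le_of_ne this hne⟩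
    have h2 := card_spread N {p}
    rw [Finset.card_singleton] at h2
    unfold load at hp
    omega
  have h2 := (newsAt_eq_one_iff N {p} hj).1 h1
  rwa [hNj, htake] at h2

omit [DecidableEq V] in
theorem eq_of_first_call {c : V → V} (hc : ∀ e ∈ N, c e.1 = c e.2) {p : V}
    {N₁ : List (V × V)} (hN : N₁ ⊆ N) (h : ∀ e ∈ N₁, c e.1 ≠ c p) {v : V} (hv : c v = c p) :
    ∀ e ∈ N₁, e.1 ≠ v ∧ e.2 ≠ v := by
  intro e he
  have h1 := h e he
  have h2 := hc e (hN he)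
  constructor
  · rintro rfl; exact h1 hv
  · rintro rfl; exact h1 (h2.trans hv)

/-- Two persons of the same class who both inform more persons than there are calls in the class
are the participants of the first call of the class. -/
theorem adj_of_load_le {c : V → V} (hadj : ∀ e ∈ N, G.Adj e.1 e.2) (hc : ∀ e ∈ N, c e.1 = c e.2)
    {p q : V} (hpq : p ≠ q) (hcq : c q = c p) (hpos : 0 < load c N (c p))
    (hp : load c N (c p) + 1 ≤ (spread N {p}).card)
    (hq : load c N (c p) + 1 ≤ (spread N {q}).card) : G.Adj p q := by
  have hex : ∃ e ∈ N, c e.1 = c p := by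
    by_contra! hno
    exact hpos.ne' (load_eq_zero_iff.2 hno)
  obtain ⟨N₁, e, N₂, hN, he, hN₁⟩ := exists_first hex
  have h1 := news_of_load_le hc hp hN he
  have h2 := news_of_load_le hc (hcq ▸ hq) hN (he.trans hcq.symm)
  have hsub : N₁ ⊆ N := by rw [hN]; exact List.subset_append_left _ _
  rw [spread_singleton_of_notMem (eq_of_first_call hc hsub hN₁ rfl), Finset.mem_singleton,
    Finset.mem_singleton] at h1
  rw [spread_singleton_of_notMem (eq_of_first_call hc hsub hN₁ hcq), Finset.mem_singleton,
    Finset.mem_singleton] at h2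
  have h3 := hadj e (by simp [hN])
  by_cases h4 : e.1 = p
  · have h5 : e.2 = q := by
      by_contra h6
      have : e.1 = q := by tauto
      exact hpq (h4.symm.trans this)
    rwa [h4, h5] at h3
  · have h5 : e.2 = p := by tauto
    have h6 : e.1 = q := by
      by_contra h6
      have : e.2 = q := by tauto
      exact hpq (h5.symm.trans this)
    rw [h5, h6] at h3
    exact h3.symm

/-- `v` takes part in exactly one call. -/
def IsLeaf (N : List (V × V)) (v : V) : Prop :=
  ∃ N₁ e N₂, N = N₁ ++ e :: N₂ ∧ (e.1 = v ∨ e.2 = v) ∧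
    (∀ e' ∈ N₁, e'.1 ≠ v ∧ e'.2 ≠ v) ∧ ∀ e' ∈ N₂, e'.1 ≠ v ∧ e'.2 ≠ v

/-- The calls in which `v` does not take part. -/
def avoid (v : V) (N : List (V × V)) : List (V × V) := N.filter fun e => e.1 ≠ v ∧ e.2 ≠ v

theorem mem_avoid {v : V} {e : V × V} : e ∈ avoid v N ↔ e ∈ N ∧ e.1 ≠ v ∧ e.2 ≠ v := by
  simp [avoid]

theorem IsLeaf.avoid_eq {v : V} (h : IsLeaf N v) : ∃ N₁ e N₂, N = N₁ ++ e :: N₂ ∧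
    (e.1 = v ∨ e.2 = v) ∧ avoid v N = N₁ ++ N₂ := by
  obtain ⟨N₁, e, N₂, rfl, he, h1, h2⟩ := h
  refine ⟨N₁, e, N₂, rfl, he, ?_⟩
  unfold avoid
  rw [List.filter_append, List.filter_cons_of_neg (by simp; tauto),
    List.filter_eq_self.2 (by simpa using h1), List.filter_eq_self.2 (by simpa using h2)]

theorem IsLeaf.length {v : V} (h : IsLeaf N v) : (avoid v N).length + 1 = N.length := by
  obtain ⟨N₁, e, N₂, hN, he, ha⟩ := h.avoid_eq
  rw [ha, hN]; simp; omega

theorem IsLeaf.informs {v a x : V} (h : IsLeaf N v) (ha : a ≠ v) (hx : x ≠ v)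
    (hax : Informs N a x) : Informs (avoid v N) a x := by
  obtain ⟨N₁, e, N₂, hN, he, hav⟩ := h.avoid_eq
  obtain ⟨M₁, e', M₂, hM, he', h1, h2⟩ := h
  have hav' : avoid v N = M₁ ++ M₂ := by
    rw [hM]
    unfold avoid
    rw [List.filter_append, List.filter_cons_of_neg (by simp; tauto),
      List.filter_eq_self.2 (by simpa using h1), List.filter_eq_self.2 (by simpa using h2)]
  rw [hav']
  rw [hM] at hax
  exact hax.remove_leaf h1 h2 he' ha hx

omit [DecidableEq V] in
theorem IsLeaf.reverse {v : V} (h : IsLeaf N v) : IsLeaf N.reverse v := by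
  obtain ⟨N₁, e, N₂, rfl, he, h1, h2⟩ := h
  exact ⟨N₂.reverse, e, N₁.reverse, by simp, he, by simpa using h2, by simpa using h1⟩

theorem IsLeaf.avoid {c : V → V} (hc : ∀ e ∈ N, c e.1 = c e.2) {v w : V} (h : IsLeaf N w)
    (hvw : c v ≠ c w) : IsLeaf (avoid v N) w := by
  obtain ⟨N₁, e, N₂, rfl, he, h1, h2⟩ := h
  refine ⟨MAL.avoid v N₁, e, MAL.avoid v N₂, ?_, he, fun e' he' => h1 e' (mem_avoid.1 he').1,
    fun e' he' => h2 e' (mem_avoid.1 he').1⟩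
  have hce := hc e (by simp)
  unfold MAL.avoid
  rw [List.filter_append, List.filter_cons_of_pos]
  simp only [decide_eq_true_eq]
  constructor
  · rintro rfl
    rcases he with h | h
    · exact hvw (by rw [h])
    · exact hvw (by rw [hce, h])
  · rintro rfl
    rcases he with h | h
    · exact hvw (by rw [← hce, h])
    · exact hvw (by rw [h])

theorem IsLeaf.load {c : V → V} (hc : ∀ e ∈ N, c e.1 = c e.2) {v : V} (h : IsLeaf N v) :
    load c (MAL.avoid v N) (c v) + 1 = load c N (c v) := by
  obtain ⟨N₁, e, N₂, hN, he, ha⟩ := h.avoid_eq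
  have hce := hc e (by simp [hN])
  have : c e.1 = c v := by
    rcases he with h | h
    · rw [h]
    · rw [hce, h]
  rw [ha, hN]
  simp [load_eq_countP, this]
  omega

/-- The first call of the class of `p` is `{p, z}`, and its participant `w` takes part in no other
call and is different from `q`. -/
structure FirstCall (G : SimpleGraph V) (N : List (V × V)) (c : V → V) (p q z w : V) : Prop where
  ne : z ≠ p
  ne' : w ≠ q
  cls : c z = c p
  adj : G.Adj p z
  eq : w = p ∨ w = z
  leaf : IsLeaf N w
  to_leaf : ∀ v, Informs N v w → v = p ∨ v = z

/-- By the two hypotheses on `p` and `q`, every call of the class brings news about `p` forwards and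
about `q` backwards. Hence `p` takes part in the first call of the class, and after it exactly one
of its participants can no longer reach `q`; this one is the leaf. -/
theorem exists_firstCall {c : V → V} (hadj : ∀ e ∈ N, G.Adj e.1 e.2)
    (hc : ∀ e ∈ N, c e.1 = c e.2) {p q : V} (hcq : c q = c p) (hpos : 0 < load c N (c p))
    (hp : load c N (c p) + 1 ≤ (spread N {p}).card)
    (hq : load c N (c p) + 1 ≤ (spread N.reverse {q}).card) :
    ∃ z w, FirstCall G N c p q z w := by
  have hex : ∃ e ∈ N, c e.1 = c p := by
    by_contra! hno
    exact hpos.ne' (load_eq_zero_iff.2 hno)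
  obtain ⟨N₁, e, N₂, hN, he, hN₁⟩ := exists_first hex
  have h1 := news_of_load_le hc hp hN he
  have hsub : N₁ ⊆ N := by rw [hN]; exact List.subset_append_left _ _
  have hN₁' := fun v (hv : c v = c p) => eq_of_first_call hc hsub hN₁ hv
  rw [spread_singleton_of_notMem (hN₁' p rfl), Finset.mem_singleton, Finset.mem_singleton] at h1
  have hcr : ∀ e ∈ N.reverse, c e.1 = c e.2 := fun e he => hc e (List.mem_reverse.1 he)
  have hq' : load c N.reverse (c q) + 1 ≤ (spread N.reverse {q}).card := by
    rw [load_reverse, hcq]; exact hq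
  have h2 := news_of_load_le hcr hq' (N₁ := N₂.reverse) (N₂ := N₁.reverse) (e := e)
    (by simp [hN]) (he.trans hcq.symm)
  have hce := hc e (by simp [hN])
  have hadje := hadj e (by simp [hN])
  obtain ⟨z, hz, hpz, hcz, hpzadj⟩ : ∃ z, z ≠ p ∧ (∀ x, (x = e.1 ∨ x = e.2) ↔ x = p ∨ x = z) ∧
      c z = c p ∧ G.Adj p z := by
    by_cases h3 : e.1 = p
    · exact ⟨e.2, by tauto, by simp [h3], by rw [← h3, hce], by rwa [← h3]⟩
    · have h4 : e.2 = p := by tauto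
      exact ⟨e.1, h3, fun x => by rw [h4, or_comm], by rw [← h4, hce], by rw [← h4]; exact hadje.symm⟩
  obtain ⟨w, hwe, hw⟩ : ∃ w, (w = e.1 ∨ w = e.2) ∧ w ∉ spread N₂.reverse {q} := by
    by_cases h3 : e.1 ∈ spread N₂.reverse {q}
    · exact ⟨e.2, Or.inr rfl, by tauto⟩
    · exact ⟨e.1, Or.inl rfl, h3⟩
  have hwpz : w = p ∨ w = z := (hpz w).1 hwe
  have hcw : c w = c p := by rcases hwpz with rfl | rfl; exacts [rfl, hcz]
  -- A later call of `w` would bring backward news about `q`, so one of its participants could reach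
  -- `q` afterwards, and then `w` could reach `q` through this call.
  have hN₂ : ∀ e' ∈ N₂, e'.1 ≠ w ∧ e'.2 ≠ w := by
    intro e' he'
    by_contra hcon
    have hcon : e'.1 = w ∨ e'.2 = w := by tauto
    have hce' := hc e' (by simp [hN, he'])
    have hce'' : c e'.1 = c q := by
      rw [hcq, ← hcw]
      rcases hcon with h | h
      · rw [h]
      · rw [hce', h]
    obtain ⟨M₁, M₂, rfl⟩ := List.append_of_mem he'
    have h3 := news_of_load_le hcr hq' (N₁ := M₂.reverse) (e := e')
      (N₂ := M₁.reverse ++ e :: N₁.reverse) (by simp [hN]) hce''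
    refine hw ?_
    have h4 : w ∈ learn e' (spread M₂.reverse {q}) := by
      rw [mem_learn]
      right
      refine ⟨?_, hcon.imp Eq.symm Eq.symm⟩
      by_contra! h4
      exact h3 ⟨fun h => absurd h h4.1, fun h => absurd h h4.2⟩
    have h5 : (M₁ ++ e' :: M₂).reverse = M₂.reverse ++ ([e'] ++ M₁.reverse) := by simp
    rw [h5, spread_append, spread_append]
    exact subset_spread _ _ h4
  refine ⟨z, w, hz, ?_, hcz, hpzadj, hwpz,
    ⟨N₁, e, N₂, hN, hwe.imp Eq.symm Eq.symm, hN₁' w hcw, hN₂⟩, ?_⟩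
  · intro hwq
    rw [hwq] at hw
    exact hw (Informs.refl _ _)
  · intro v hv
    rw [hN] at hv
    obtain ⟨y, hy, hv⟩ := informs_append.1 hv
    obtain ⟨y', hy', hv⟩ := informs_cons.1 hv
    rw [informs_to_of_notMem hN₂] at hv
    subst hv
    have hy2 : y = p ∨ y = z := by
      rw [mem_learn_singleton_comm, mem_learn] at hy'
      rcases hy' with hy' | ⟨-, hy'⟩
      · rw [Finset.mem_singleton.1 hy']; exact hwpz
      · exact (hpz y).1 hy'
    have hcy : c y = c p := by rcases hy2 with rfl | rfl; exacts [rfl, hcz]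
    rw [informs_to_of_notMem (hN₁' y hcy)] at hy
    rwa [← hy]

theorem MinSystem.adj_of_mem (h : MinSystem G k N As Xs) {a b : V} (hab : {a, b} ∈ As)
    (hne : a ≠ b) : G.Adj a b := by
  obtain ⟨p, q, hpq, hpq'⟩ := h.itemA _ hab
  have ha : a ∈ ({p, q} : Finset V) := hpq ▸ (by simp)
  have hb : b ∈ ({p, q} : Finset V) := hpq ▸ (by simp)
  simp only [Finset.mem_insert, Finset.mem_singleton] at ha hb
  have := G.adj_symm (u := p) (v := q)
  grind

/-- The configuration of four classes, two of which (those of `u₂` and `u₃`) are trivial. -/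
structure Quad (N : List (V × V)) (As Xs : Finset (Finset V)) (c : V → V) (P S p₁ q₁ p₄ q₄ u₂ u₃ : V) :
    Prop where
  hc : ∀ e ∈ N, c e.1 = c e.2
  hPS : P ≠ S
  hp₁ : c p₁ = P
  hq₁ : c q₁ = P
  hp₄ : c p₄ = S
  hq₄ : c q₄ = S
  h2P : c u₂ ≠ P
  h2S : c u₂ ≠ S
  h3P : c u₃ ≠ P
  h3S : c u₃ ≠ S
  h23 : c u₂ ≠ c u₃
  A12 : {p₁, u₂} ∈ As
  A34 : {q₄, u₃} ∈ As
  X24 : {p₄, u₂} ∈ Xs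
  X13 : {q₁, u₃} ∈ Xs
  formA : ∀ A ∈ As, A = {p₁, u₂} ∨ A = {q₄, u₃} ∨ ∃ a b, A = {a, b} ∧ c a = P ∧ c b = S
  formX : ∀ X ∈ Xs, X = {p₄, u₂} ∨ X = {q₁, u₃} ∨ ∃ a b, X = {a, b} ∧ c a = P ∧ c b = S
  fullA : ∀ v, c v = P ∨ c v = S → ∃ A ∈ As, v ∈ A
  fullX : ∀ v, c v = P ∨ c v = S → ∃ X ∈ Xs, v ∈ X

variable {c : V → V} {P S p₁ q₁ p₄ q₄ u₂ u₃ : V}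

theorem Quad.reverse (h : Quad N As Xs c P S p₁ q₁ p₄ q₄ u₂ u₃) :
    Quad N.reverse Xs As c S P p₄ q₄ p₁ q₁ u₂ u₃ where
  hc e he := h.hc e (List.mem_reverse.1 he)
  hPS := h.hPS.symm
  hp₁ := h.hp₄
  hq₁ := h.hq₄
  hp₄ := h.hp₁
  hq₄ := h.hq₁
  h2P := h.h2S
  h2S := h.h2P
  h3P := h.h3S
  h3S := h.h3P
  h23 := h.h23
  A12 := h.X24
  A34 := h.X13
  X24 := h.A12
  X13 := h.A34
  formA X hX := by
    rcases h.formX X hX with h | h | ⟨a, b, rfl, ha, hb⟩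
    exacts [Or.inl h, Or.inr (Or.inl h), Or.inr (Or.inr ⟨b, a, Finset.pair_comm _ _, hb, ha⟩)]
  formX A hA := by
    rcases h.formA A hA with h | h | ⟨a, b, rfl, ha, hb⟩
    exacts [Or.inl h, Or.inr (Or.inl h), Or.inr (Or.inr ⟨b, a, Finset.pair_comm _ _, hb, ha⟩)]
  fullA v hv := h.fullX v hv.symm
  fullX v hv := h.fullA v hv.symm

theorem Quad.exists_item (h : Quad N As Xs c P S p₁ q₁ p₄ q₄ u₂ u₃) {v : V} (hv : c v = P)
    (hne : v ≠ p₁) : ∃ b, {v, b} ∈ As ∧ c b = S := by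
  obtain ⟨A, hA, hvA⟩ := h.fullA v (Or.inl hv)
  have h1 := h.h2P; have h2 := h.h3P; have h3 := h.hPS; have h4 := h.hq₄
  rcases h.formA A hA with rfl | rfl | ⟨a, b, rfl, ha, hb⟩
  · grind
  · grind
  · refine ⟨b, ?_, hb⟩
    have : v = a := by grind
    rwa [this]

/-- Information does not leave its class, so only the stated pair of endpoints can realize the
connection between the two items. -/
theorem System.informs_of_class (hS : System G N As Xs) (hc : ∀ e ∈ N, c e.1 = c e.2) {a b x y : V}
    (hA : {a, b} ∈ As) (hX : {x, y} ∈ Xs) (h1 : c a ≠ c y) (h2 : c b ≠ c x) (h3 : c b ≠ c y) :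
    Informs N a x := by
  obtain ⟨v, hv, w, hw, hvw⟩ := hS.reach _ hA _ hX
  have := hvw.class_eq hc
  simp only [Finset.mem_insert, Finset.mem_singleton] at hv hw
  grind

/-- The receiver of `v` has no endpoint in the class of `u₂`, and its endpoint other than `v` lies
outside `P`; so the sender `{p₁, u₂}` can reach it only from `p₁` to `v`. Dually, `Quad.to_q₁` uses
the receiver `{q₁, u₃}`. -/
theorem Quad.from_p₁ (h : Quad N As Xs c P S p₁ q₁ p₄ q₄ u₂ u₃) (hS : System G N As Xs) {v : V}
    (hv : c v = P) : Informs N p₁ v := by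
  have h1 := h.h2P; have h2 := h.h3P; have h3 := h.hPS; have h4 := h.hp₄; have h5 := h.hp₁
  have h6 := h.h23; have h7 := h.h2S; have h8 := h.hq₁
  obtain ⟨X, hX, hvX⟩ := h.fullX v (Or.inl hv)
  rcases h.formX X hX with rfl | rfl | ⟨a, b, rfl, ha, hb⟩
  · grind
  · have hvq : v = q₁ := by grind
    subst hvq
    exact hS.informs_of_class h.hc h.A12 hX (by grind) (by grind) (by grind)
  · have hva : v = a := by grind
    subst hva
    exact hS.informs_of_class h.hc h.A12 hX (by grind) (by grind) (by grind)

theorem Quad.to_q₁ (h : Quad N As Xs c P S p₁ q₁ p₄ q₄ u₂ u₃) (hS : System G N As Xs) {v : V}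
    (hv : c v = P) : Informs N v q₁ := by
  have h2 := h.h3P; have h3 := h.hPS; have h8 := h.hq₁; have h9 := h.h3S
  by_cases hvp : v = p₁
  · subst hvp
    exact h.from_p₁ hS h.hq₁
  · obtain ⟨b, hb, hcb⟩ := h.exists_item hv hvp
    exact hS.informs_of_class h.hc hb h.X13 (by grind) (by grind) (by grind)

/-- Here `w` is a leaf in the first call of `P` and `z'` a leaf in the last call of `S`. If `z' =
p₄`, then `z`, `z'`, `u₂`, `p₁` is a four-cycle; so `z'` is the partner of `p₄` in that last call.
The rest depends on the receiver `{w, η}` of `w`. -/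
theorem Quad.case_edge [Fintype V] (h : Quad N As Xs c P S p₁ q₁ p₄ q₄ u₂ u₃)
    (hM : MinSystem G k N As Xs) (hG : NoFourCycle G)
    (hload : load c N S + 1 = (Finset.univ.filter fun v => c v = S).card)
    {z w z' w' : V} (hF : FirstCall G N c p₁ q₁ z w) (hF' : FirstCall G N.reverse c p₄ q₄ w' z')
    (hzz : {z, z'} ∈ As) : False := by
  have hS := hM.toSystem
  have hpu := hM.adj_of_mem h.A12 (by have := h.h2P; have := h.hp₁; grind)
  have hup := hM.reverse.adj_of_mem h.X24 (by have := h.h2S; have := h.hp₄; grind)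
  have hPS := h.hPS
  have hcz : c z = P := hF.cls.trans h.hp₁
  have hcw : c w = P := by rcases hF.eq with h' | h' <;> rw [h']; exacts [h.hp₁, hcz]
  have hcw' : c w' = S := hF'.cls.trans h.hp₄
  have hcz' : c z' = S := by rcases hF'.eq with h' | h' <;> rw [h']; exacts [h.hp₄, hcw']
  have hzz' := hM.adj_of_mem hzz (by grind)
  have h2P := h.h2P; have h2S := h.h2S; have hp₁ := h.hp₁; have hp₄ := h.hp₄
  have h3P := h.h3P; have h3S := h.h3S; have hq₁ := h.hq₁; have hq₄ := h.hq₄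
  obtain ⟨η, hη, hcη⟩ : ∃ η, {w, η} ∈ Xs ∧ c η = S := by
    obtain ⟨Y, hY, hwY⟩ := h.fullX w (Or.inl hcw)
    have := hF.ne'
    rcases h.formX Y hY with rfl | rfl | ⟨a, b, rfl, ha, hb⟩
    · grind
    · grind
    · refine ⟨b, ?_, hb⟩
      have : w = a := by grind
      rwa [this]
  have hwη := hM.reverse.adj_of_mem hη (by grind)
  have hηp : η ≠ p₄ := by
    rintro rfl
    have h1 := hS.disjX _ hη _ h.X24 η (by simp) (by simp)
    have h2 : w ∈ ({η, u₂} : Finset V) := h1 ▸ (by simp)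
    grind
  have hzp : z' ≠ p₄ := by
    rintro rfl
    rcases hG z z' u₂ p₁ hzz' hup hpu.symm hF.adj with h1 | h1 <;> grind
  have hzw : z' = w' := by
    rcases hF'.eq with h' | h'
    exacts [absurd h' hzp, h']
  subst hzw
  have hfrom : ∀ x, Informs N z' x → x = p₄ ∨ x = z' := fun x hx =>
    hF'.to_leaf x (informs_reverse.2 hx)
  have hleaf' : IsLeaf N z' := by simpa using hF'.leaf.reverse
  by_cases hηz : η = z'
  -- If `w = p₁`, there is a four-cycle through `η`, `p₄` and `u₂`. Otherwise the same edge joining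
  -- two leaves is a sender and a receiver; removing it on both sides, together with the two calls
  -- of the leaves, gives a smaller counterexample.
  · subst hηz
    have hwp : w ≠ p₁ := by
      rintro rfl
      rcases hG w η p₄ u₂ hwη hF'.adj.symm hup hpu.symm with h1 | h1 <;> grind
    have hwz : w = z := by
      rcases hF.eq with h' | h'
      exacts [absurd h' hwp, h']
    subst hwz
    have hleaf2 : IsLeaf (avoid w N) η := hleaf'.avoid h.hc (by grind)
    have hlen1 := hF.leaf.length
    have hlen2 := hleaf2.length
    have hA3 := hM.threeA
    have hX3 := hM.threeX
    have hsm := hM.small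
    have := hM.minimal (avoid η (avoid w N)) (As.erase {w, η}) (Xs.erase {w, η})
    rw [Finset.card_erase_of_mem hzz, Finset.card_erase_of_mem hη] at this
    have := this (by omega) ?_ (by omega) (by omega)
    · omega
    · refine ⟨fun e he => hS.adj e (mem_avoid.1 (mem_avoid.1 he).1).1,
        fun A hA => hS.itemA A (Finset.mem_of_mem_erase hA),
        fun A hA => hS.itemX A (Finset.mem_of_mem_erase hA),
        hS.disjA.subset (Finset.erase_subset _ _), hS.disjX.subset (Finset.erase_subset _ _), ?_⟩
      intro A hA X hX
      obtain ⟨hneA, hA⟩ := Finset.mem_erase.1 hA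
      obtain ⟨hneX, hX⟩ := Finset.mem_erase.1 hX
      obtain ⟨a, ha, x, hx, hax⟩ := hS.reach A hA X hX
      have h1 : ∀ v ∈ ({w, η} : Finset V), a ≠ v := by
        rintro v hv rfl
        exact hneA (hS.disjA A hA _ hzz _ ha hv)
      have h2 : ∀ v ∈ ({w, η} : Finset V), x ≠ v := by
        rintro v hv rfl
        exact hneX (hS.disjX X hX _ hη _ hx hv)
      exact ⟨a, ha, x, hx, hleaf2.informs (h1 η (by simp)) (h2 η (by simp))
        (hF.leaf.informs (h1 w (by simp)) (h2 w (by simp)) hax)⟩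
  -- All persons of `S` except `z'` inform both `η` and `p₄`, even without the call of the leaf
  -- `z'`. Without `z'` the class has one person more than calls, so the last remaining call of the
  -- class is between `η` and `p₄`. Their adjacency closes a four-cycle with `w`, both for `w = p₁`
  -- and for `w = z`.
  · have hto : ∀ v, c v = S → v ≠ z' → Informs N v η := by
      intro v hv hvz
      by_cases hvq : v = q₄
      · subst hvq
        exact informs_reverse.1 (h.reverse.to_q₁ hS.reverse hcη)
      · obtain ⟨A, hA, hvA⟩ := h.fullA v (Or.inr hv)
        obtain ⟨a, hav, hca⟩ : ∃ a, A = {a, v} ∧ c a = P := by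
          rcases h.formA A hA with rfl | rfl | ⟨a, b, rfl, ha, hb⟩
          · grind
          · grind
          · refine ⟨a, ?_, ha⟩
            have : v = b := by grind
            rw [this]
        subst hav
        obtain ⟨x, hx, y, hy, hxy⟩ := hS.reach _ hA _ hη
        have hcl := hxy.class_eq h.hc
        simp only [Finset.mem_insert, Finset.mem_singleton] at hx hy
        rcases hx with rfl | rfl <;> rcases hy with rfl | rfl
        · rcases hF.to_leaf _ hxy with rfl | rfl
          · have h1 := hS.disjA _ hA _ h.A12 x (by simp) (by simp)
            have h2 : v ∈ ({x, u₂} : Finset V) := h1 ▸ (by simp)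
            grind
          · have h1 := hS.disjA _ hA _ hzz x (by simp) (by simp)
            have h2 : v ∈ ({x, z'} : Finset V) := h1 ▸ (by simp)
            grind
        · grind
        · grind
        · exact hxy
    have hto' : ∀ v, c v = S → v ≠ z' → Informs (avoid z' N) v η := fun v hv hvz =>
      hleaf'.informs hvz hηz (hto v hv hvz)
    have hto₄ : ∀ v, c v = S → v ≠ z' → Informs (avoid z' N) v p₄ := fun v hv hvz =>
      hleaf'.informs hvz hzp.symm (informs_reverse.1 (h.reverse.from_p₁ hS.reverse hv))
    have hcard : ∀ x, (∀ v, c v = S → v ≠ z' → Informs (avoid z' N) v x) →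
        load c N S ≤ (spread (avoid z' N).reverse {x}).card := by
      intro x hx
      have h1 : (Finset.univ.filter fun v => c v = S).erase z' ⊆
          spread (avoid z' N).reverse {x} := by
        intro v hv
        simp only [Finset.mem_erase, Finset.mem_filter, Finset.mem_univ, true_and] at hv
        exact informs_reverse.2 (hx v hv.2 hv.1)
      have h2 := Finset.card_le_card h1
      rw [Finset.card_erase_of_mem (by simp [hcz'])] at h2
      omega
    have hl := hleaf'.load h.hc
    rw [hcz'] at hl
    have hthree : 3 ≤ (Finset.univ.filter fun v => c v = S).card := by
      rw [show 3 = ({η, p₄, z'} : Finset V).card by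
        rw [Finset.card_eq_three.2 ⟨η, p₄, z', hηp, hηz, hzp.symm, rfl⟩]]
      refine Finset.card_le_card fun v hv => ?_
      simp only [Finset.mem_insert, Finset.mem_singleton] at hv
      rcases hv with rfl | rfl | rfl <;> simp [*]
    have hadj : G.Adj η p₄ := by
      refine adj_of_load_le (N := (avoid z' N).reverse) (c := c) ?_ ?_ hηp (hp₄.trans hcη.symm) ?_ ?_ ?_
      · exact fun e he => hS.adj e (mem_avoid.1 (List.mem_reverse.1 he)).1
      · exact fun e he => h.hc e (mem_avoid.1 (List.mem_reverse.1 he)).1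
      · rw [load_reverse, hcη]; omega
      · rw [load_reverse, hcη, hl]; exact hcard η hto'
      · rw [load_reverse, hcη, hl]; exact hcard p₄ hto₄
    rcases hF.eq with h' | h' <;> rw [h'] at hwη
    · rcases hG p₁ η p₄ u₂ hwη hadj hup hpu.symm with h1 | h1 <;> grind
    · rcases hG z η p₄ z' hwη hadj hF'.adj hzz'.symm with h1 | h1 <;> grind

theorem Quad.card_le_from [Fintype V] (h : Quad N As Xs c P S p₁ q₁ p₄ q₄ u₂ u₃)
    (hS : System G N As Xs) :
    (Finset.univ.filter fun v => c v = P).card ≤ (spread N {p₁}).card := by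
  refine Finset.card_le_card fun v hv => ?_
  exact h.from_p₁ hS (by simpa using hv)

theorem Quad.card_le_to [Fintype V] (h : Quad N As Xs c P S p₁ q₁ p₄ q₄ u₂ u₃)
    (hS : System G N As Xs) :
    (Finset.univ.filter fun v => c v = P).card ≤ (spread N.reverse {q₁}).card := by
  refine Finset.card_le_card fun v hv => ?_
  exact informs_reverse.2 (h.to_q₁ hS (by simpa using hv))

/-- If `P` had no calls, it would be a single vertex; its only sender is `{p₁, u₂}`, so `S` would be
a single vertex too, and these two with `u₂` and `u₃` would form a four-cycle. -/
theorem Quad.not_trivial [Fintype V] (h : Quad N As Xs c P S p₁ q₁ p₄ q₄ u₂ u₃)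
    (hM : MinSystem G k N As Xs) (hG : NoFourCycle G)
    (hload : load c N P + 1 = (Finset.univ.filter fun v => c v = P).card) :
    0 < load c N P := by
  by_contra hcon
  have hone : ∀ v, c v = P → v = p₁ := by
    intro v hv
    have h1 : (Finset.univ.filter fun v => c v = P).card ≤ 1 := by omega
    exact Finset.card_le_one.1 h1 v (by simpa using hv) p₁ (by simpa using h.hp₁)
  have hqp := hone q₁ h.hq₁
  have hone' : ∀ v, c v = S → v = q₄ := by
    intro v hv
    obtain ⟨A, hA, hvA⟩ := h.fullA v (Or.inr hv)
    have h1 := h.hPS; have h2 := h.h2S; have h3 := h.h3S; have h4 := h.hp₁; have h5 := h.h2S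
    rcases h.formA A hA with rfl | rfl | ⟨a, b, rfl, ha, hb⟩
    · grind
    · grind
    · have hap := hone a ha
      subst hap
      have h6 := hM.disjA _ hA _ h.A12 a (by simp) (by simp)
      have h7 : v ∈ ({a, u₂} : Finset V) := h6 ▸ hvA
      grind
  have hpq := hone' p₄ h.hp₄
  subst hqp hpq
  have h1 := h.hPS; have h2 := h.h2S; have h3 := h.h3S; have h4 := h.hp₁; have h5 := h.hp₄
  have h6 := h.h2P; have h7 := h.h3P; have h8 := h.h23
  rcases hG q₁ u₂ p₄ u₃ (hM.adj_of_mem h.A12 (by grind))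
    (hM.reverse.adj_of_mem h.X24 (by grind)).symm (hM.adj_of_mem h.A34 (by grind))
    (hM.reverse.adj_of_mem h.X13 (by grind)).symm with h' | h' <;> grind

/-- Compare the receiver `{w, η}` of the leaf `w` of the first call of `P` with the sender `{β, z'}`
of the leaf `z'` of the last call of `S`. Either `β` informs `w`, which forces `β = z`, or `z'`
informs `η`, which forces the mirror situation. Both are excluded by `Quad.case_edge`. -/
theorem Quad.false [Fintype V] (h : Quad N As Xs c P S p₁ q₁ p₄ q₄ u₂ u₃)
    (hM : MinSystem G k N As Xs) (hG : NoFourCycle G)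
    (hP : load c N P + 1 = (Finset.univ.filter fun v => c v = P).card)
    (hS : load c N S + 1 = (Finset.univ.filter fun v => c v = S).card) : False := by
  have hsys := hM.toSystem
  have hS' : load c N.reverse S + 1 = (Finset.univ.filter fun v => c v = S).card := by
    rw [load_reverse]; exact hS
  have hP' : load c N.reverse P + 1 = (Finset.univ.filter fun v => c v = P).card := by
    rw [load_reverse]; exact hP
  have hc := h.hc
  have hp₁ := h.hp₁; have hp₄ := h.hp₄; have hPS := h.hPS
  obtain ⟨z, w, hF⟩ := exists_firstCall hsys.adj hc (h.hq₁.trans hp₁.symm)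
    (by rw [hp₁]; exact h.not_trivial hM hG hP)
    (by rw [hp₁, hP]; exact h.card_le_from hsys) (by rw [hp₁, hP]; exact h.card_le_to hsys)
  obtain ⟨w', z', hF'⟩ := exists_firstCall hsys.reverse.adj h.reverse.hc (h.hq₄.trans hp₄.symm)
    (by rw [hp₄]; exact h.reverse.not_trivial hM.reverse hG hS')
    (by rw [hp₄, hS']; exact h.reverse.card_le_from hsys.reverse)
    (by rw [hp₄, hS']; exact h.reverse.card_le_to hsys.reverse)
  have hcw : c w = P := by
    rcases hF.eq with h' | h' <;> rw [h']; exacts [hp₁, hF.cls.trans hp₁]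
  have hcz' : c z' = S := by
    rcases hF'.eq with h' | h' <;> rw [h']; exacts [hp₄, hF'.cls.trans hp₄]
  have h2P := h.h2P; have h2S := h.h2S; have h3P := h.h3P; have h3S := h.h3S
  have hne := hF.ne'
  have hne' := hF'.ne'
  obtain ⟨η, hη, hcη⟩ : ∃ η, {w, η} ∈ Xs ∧ c η = S := by
    obtain ⟨Y, hY, hwY⟩ := h.fullX w (Or.inl hcw)
    rcases h.formX Y hY with rfl | rfl | ⟨a, b, rfl, ha, hb⟩
    · grind
    · grind
    · refine ⟨b, ?_, hb⟩
      have : w = a := by grind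
      rwa [this]
  obtain ⟨β, hβ, hcβ⟩ : ∃ β, {β, z'} ∈ As ∧ c β = P := by
    obtain ⟨B, hB, hzB⟩ := h.fullA z' (Or.inr hcz')
    rcases h.formA B hB with rfl | rfl | ⟨a, b, rfl, ha, hb⟩
    · grind
    · grind
    · refine ⟨a, ?_, ha⟩
      have : z' = b := by grind
      rwa [this]
  obtain ⟨x, hx, y, hy, hxy⟩ := hsys.reach _ hβ _ hη
  have hcl := hxy.class_eq hc
  simp only [Finset.mem_insert, Finset.mem_singleton] at hx hy
  rcases hx with rfl | rfl <;> rcases hy with rfl | rfl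
  · rcases hF.to_leaf _ hxy with rfl | rfl
    · have h1 := hsys.disjA _ hβ _ h.A12 x (by simp) (by simp)
      have h2 : z' ∈ ({x, u₂} : Finset V) := h1 ▸ (by simp)
      grind
    · exact h.case_edge hM hG hS hF hF' hβ
  · grind
  · grind
  · rcases hF'.to_leaf _ (informs_reverse.2 hxy) with rfl | rfl
    · have h1 := hsys.disjX _ hη _ h.X24 y (by simp) (by simp)
      have h2 : w ∈ ({y, u₂} : Finset V) := h1 ▸ (by simp)
      grind
    · exact h.reverse.case_edge hM.reverse hG hP' hF' (by rwa [List.reverse_reverse])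
        (by rwa [Finset.pair_comm])

end Quad

end MAL

/-! ## The lower bound for systems -/

namespace MAL

/-! ### Cross-intersecting graphs, possibly with loops -/

section Cross

variable {V : Type*} {R B : V → V → Prop}

/-- An edge of `B` missing the centre `k` of `R` must contain the other end of every edge of `R`. At
least three of the four given vertices differ from `k` and are such ends, but an edge has only two
places. -/
theorem cross_star
    (hx : ∀ x y u v, R x y → B u v → x = u ∨ x = v ∨ y = u ∨ y = v)
    {g₁ g₂ g₃ g₄ : V} (h12 : g₁ ≠ g₂) (h13 : g₁ ≠ g₃) (h14 : g₁ ≠ g₄) (h23 : g₂ ≠ g₃)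
    (h24 : g₂ ≠ g₄) (h34 : g₃ ≠ g₄)
    (hg : ∀ g, g = g₁ ∨ g = g₂ ∨ g = g₃ ∨ g = g₄ → ∃ y, R g y) {k : V}
    (hk : ∀ x y, R x y → k = x ∨ k = y) : ∀ x y, B x y → k = x ∨ k = y := by
  intro x y hxy
  by_contra! hcon
  have h : ∀ g, g = g₁ ∨ g = g₂ ∨ g = g₃ ∨ g = g₄ → g = k ∨ g = x ∨ g = y := by
    intro g hgg
    obtain ⟨z, hz⟩ := hg g hgg
    have h1 := hk _ _ hz
    have h2 := hx _ _ _ _ hz hxy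
    grind
  have h1 := h g₁ (by simp)
  have h2 := h g₂ (by simp)
  have h3 := h g₃ (by simp)
  have h4 := h g₄ (by simp)
  grind

/-- If `R g g'` holds, then `pq`, `gg'` and `pg`, `qg'` are the two matchings. Otherwise an edge of
`R` avoiding `p` must meet `gp` in `g` and `g'q` in `q`, so `R g q`; likewise `R g' p`, and these
two give the matching of `R`. -/
theorem cross_quad (hR : ∀ x y, R x y → R y x)
    (hx : ∀ x y u v, R x y → B u v → x = u ∨ x = v ∨ y = u ∨ y = v)
    (hB : ∀ x y, B x y → B y x)
    (hnR : ∀ k, ∃ x y, R x y ∧ k ≠ x ∧ k ≠ y) {p q g g' : V} (hpq : p ≠ q) (hgg : g ≠ g')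
    (h1 : g ≠ p) (h2 : g ≠ q) (h3 : g' ≠ p) (h4 : g' ≠ q) (hr : R p q) (hb : B g p)
    (hb' : B g' q) :
    ∃ p q r s, p ≠ q ∧ p ≠ r ∧ p ≠ s ∧ q ≠ r ∧ q ≠ s ∧ r ≠ s ∧ R p q ∧ R r s ∧ B p r ∧ B q s := by
  obtain ⟨x, y, hxy, hx1, hx2⟩ := hnR p
  obtain ⟨u, v, huv, hu1, hu2⟩ := hnR q
  have e1 := hx _ _ _ _ hxy hb
  have e2 := hx _ _ _ _ hxy hb'
  have e3 := hx _ _ _ _ huv hb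
  have e4 := hx _ _ _ _ huv hb'
  by_cases hc : R g g'
  · exact ⟨p, q, g, g', hpq, h1.symm, h3.symm, h2.symm, h4.symm, hgg, hr, hc, hB _ _ hb,
      hB _ _ hb'⟩
  · have hc' : ¬ R g' g := fun h => hc (hR _ _ h)
    have r1 : R g q := by
      have := hR _ _ hxy
      grind
    have r2 : R g' p := by
      have := hR _ _ huv
      grind
    exact ⟨g, q, p, g', h2, h1, hgg, hpq.symm, h4.symm, h3.symm, r1, hR _ _ r2, hb, hB _ _ hb'⟩

/-- Two cross-intersecting graphs, which both have no isolated vertices among four given ones, are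
stars with a common centre or both have a perfect matching of the same four vertices. -/
theorem cross_structure (hR : ∀ x y, R x y → R y x) (hB : ∀ x y, B x y → B y x)
    (hx : ∀ x y u v, R x y → B u v → x = u ∨ x = v ∨ y = u ∨ y = v)
    {g₁ g₂ g₃ g₄ : V} (h12 : g₁ ≠ g₂) (h13 : g₁ ≠ g₃) (h14 : g₁ ≠ g₄) (h23 : g₂ ≠ g₃)
    (h24 : g₂ ≠ g₄) (h34 : g₃ ≠ g₄)
    (hgR : ∀ g, g = g₁ ∨ g = g₂ ∨ g = g₃ ∨ g = g₄ → ∃ y, R g y)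
    (hgB : ∀ g, g = g₁ ∨ g = g₂ ∨ g = g₃ ∨ g = g₄ → ∃ y, B g y) :
    (∃ k, (∀ x y, R x y → k = x ∨ k = y) ∧ ∀ x y, B x y → k = x ∨ k = y) ∨
    ∃ p q r s, p ≠ q ∧ p ≠ r ∧ p ≠ s ∧ q ≠ r ∧ q ≠ s ∧ r ≠ s ∧ R p q ∧ R r s ∧ B p r ∧ B q s := by
  by_cases hsR : ∃ k, ∀ x y, R x y → k = x ∨ k = y
  · obtain ⟨k, hk⟩ := hsR
    exact Or.inl ⟨k, hk, cross_star hx h12 h13 h14 h23 h24 h34 hgR hk⟩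
  by_cases hsB : ∃ k, ∀ x y, B x y → k = x ∨ k = y
  · obtain ⟨k, hk⟩ := hsB
    refine Or.inl ⟨k, cross_star ?_ h12 h13 h14 h23 h24 h34 hgB hk, hk⟩
    intro x y u v h1 h2
    have := hx _ _ _ _ h2 h1
    grind
  push Not at hsR hsB
  right
  obtain ⟨p, hp⟩ := hgR g₁ (by simp)
  generalize hq : g₁ = q at hp
  replace hq : q = g₁ := hq.symm
  have hpq : p ≠ q := by
    rintro rfl
    obtain ⟨x, y, hxy, h1, h2⟩ := hsB p
    have := hx _ _ _ _ hp hxy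
    grind
  obtain ⟨g, g', hgg, hg1, hg2, hg3, hg4, ⟨u, hu⟩, ⟨u', hu'⟩⟩ : ∃ g g', g ≠ g' ∧ g ≠ p ∧ g ≠ q ∧
      g' ≠ p ∧ g' ≠ q ∧ (∃ y, B g y) ∧ ∃ y, B g' y := by
    have b2 := hgB g₂ (by simp)
    have b3 := hgB g₃ (by simp)
    have b4 := hgB g₄ (by simp)
    by_cases hp2 : p = g₂
    · exact ⟨g₃, g₄, h34, by grind, by grind, by grind, by grind, b3, b4⟩
    · by_cases hp3 : p = g₃
      · exact ⟨g₂, g₄, h24, by grind, by grind, by grind, by grind, b2, b4⟩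
      · exact ⟨g₂, g₃, h23, by grind, by grind, by grind, by grind, b2, b3⟩
  have hu1 := hx _ _ _ _ hp hu
  have hu2 := hx _ _ _ _ hp hu'
  have key := fun {p q g g' : V} => cross_quad (p := p) (q := q) (g := g) (g' := g') hR hx hB hsR
  have hp' := hR _ _ hp
  have both : ∀ p q, p ≠ q → R p q → g ≠ p → g ≠ q → g' ≠ p → g' ≠ q → B g p → B g' p →
      ∃ p q r s, p ≠ q ∧ p ≠ r ∧ p ≠ s ∧ q ≠ r ∧ q ≠ s ∧ r ≠ s ∧
        R p q ∧ R r s ∧ B p r ∧ B q s := by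
    intro p q hpq hp hg1 hg2 hg3 hg4 h1 h2
    obtain ⟨x, y, hxy, hx1, hx2⟩ := hsB p
    have e1 := hx _ _ _ _ hp hxy
    obtain ⟨x, hxq, hxp⟩ : ∃ x, B x q ∧ p ≠ x := by
      have : q = x ∨ q = y := by grind
      rcases this with rfl | rfl
      exacts [⟨y, hB _ _ hxy, hx2⟩, ⟨x, hxy, hx1⟩]
    by_cases hxg : x = g
    · subst hxg
      exact key hpq hgg.symm hg3 hg4 hg1 hg2 hp h2 hxq
    · by_cases hxg' : x = g'
      · subst hxg'
        exact key hpq hgg hg1 hg2 hg3 hg4 hp h1 hxq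
      -- Now `gp`, `g'p` and `xq` are edges of `B`. An edge of `R` avoiding `p` would need both `g`
      -- and `g'`, and then it misses `xq`.
      · exfalso
        obtain ⟨a, b, hab, ha, hb⟩ := hsR p
        have f1 := hx _ _ _ _ hab h1
        have f2 := hx _ _ _ _ hab h2
        have f3 := hx _ _ _ _ hab hxq
        grind
  have c1 : u = p ∨ u = q := by grind
  have c2 : u' = p ∨ u' = q := by grind
  rcases c1 with rfl | rfl <;> rcases c2 with rfl | rfl
  · exact both _ _ hpq hp' hg1 hg2 hg3 hg4 hu hu'
  · exact key hpq hgg hg1 hg2 hg3 hg4 hp' hu hu'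
  · exact key hpq hgg.symm hg3 hg4 hg1 hg2 hp' hu' hu
  · exact both _ _ hpq.symm hp hg2 hg1 hg4 hg3 hu hu'

end Cross

/-! ### Four classes connected in the pattern of a four-cycle -/

section Main

variable {V : Type*} [DecidableEq V]
variable {G : SimpleGraph V} {N : List (V × V)} {As Xs : Finset (Finset V)} {k : ℕ}

/-- All items connect four classes, in the pattern of a four-cycle. -/
structure FourClasses [Fintype V] (N : List (V × V)) (As Xs : Finset (Finset V)) (c : V → V)
    (p q r s : V) : Prop where
  hc : ∀ e ∈ N, c e.1 = c e.2
  pq : p ≠ q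
  pr : p ≠ r
  ps : p ≠ s
  qr : q ≠ r
  qs : q ≠ s
  rs : r ≠ s
  Apq : ∃ a b, {a, b} ∈ As ∧ c a = p ∧ c b = q
  Ars : ∃ a b, {a, b} ∈ As ∧ c a = r ∧ c b = s
  Xpr : ∃ a b, {a, b} ∈ Xs ∧ c a = p ∧ c b = r
  Xqs : ∃ a b, {a, b} ∈ Xs ∧ c a = q ∧ c b = s
  formA : ∀ A ∈ As, ∃ a b, A = {a, b} ∧ (c a = p ∨ c a = r) ∧ (c b = q ∨ c b = s)
  formX : ∀ A ∈ Xs, ∃ a b, A = {a, b} ∧ (c a = p ∨ c a = q) ∧ (c b = r ∨ c b = s)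
  fullA : ∀ v, (c v = p ∨ c v = q ∨ c v = r ∨ c v = s) → ∃ A ∈ As, v ∈ A
  fullX : ∀ v, (c v = p ∨ c v = q ∨ c v = r ∨ c v = s) → ∃ X ∈ Xs, v ∈ X
  load_add_one : ∀ v, (v = p ∨ v = q ∨ v = r ∨ v = s) →
    load c N v + 1 = (Finset.univ.filter fun w => c w = v).card

variable [Fintype V] {c : V → V} {p q r s : V}

theorem FourClasses.swap (h : FourClasses N As Xs c p q r s) : FourClasses N As Xs c r s p q where
  hc := h.hc
  pq := h.rs
  pr := h.pr.symm
  ps := h.qr.symm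
  qr := h.ps.symm
  qs := h.qs.symm
  rs := h.pq
  Apq := h.Ars
  Ars := h.Apq
  Xpr := by
    obtain ⟨a, b, h, ha, hb⟩ := h.Xpr
    exact ⟨b, a, by rwa [Finset.pair_comm], hb, ha⟩
  Xqs := by
    obtain ⟨a, b, h, ha, hb⟩ := h.Xqs
    exact ⟨b, a, by rwa [Finset.pair_comm], hb, ha⟩
  formA A hA := by
    obtain ⟨a, b, h, ha, hb⟩ := h.formA A hA
    exact ⟨a, b, h, ha.symm, hb.symm⟩
  formX A hA := by
    obtain ⟨a, b, h, ha, hb⟩ := h.formX A hA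
    exact ⟨b, a, by rwa [Finset.pair_comm], hb, ha⟩
  fullA v hv := h.fullA v (by tauto)
  fullX v hv := h.fullX v (by tauto)
  load_add_one v hv := h.load_add_one v (by tauto)

theorem FourClasses.mirror (h : FourClasses N As Xs c p q r s) :
    FourClasses N As Xs c q p s r where
  hc := h.hc
  pq := h.pq.symm
  pr := h.qs
  ps := h.qr
  qr := h.ps
  qs := h.pr
  rs := h.rs.symm
  Apq := by
    obtain ⟨a, b, h, ha, hb⟩ := h.Apq
    exact ⟨b, a, by rwa [Finset.pair_comm], hb, ha⟩
  Ars := by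
    obtain ⟨a, b, h, ha, hb⟩ := h.Ars
    exact ⟨b, a, by rwa [Finset.pair_comm], hb, ha⟩
  Xpr := h.Xqs
  Xqs := h.Xpr
  formA A hA := by
    obtain ⟨a, b, h, ha, hb⟩ := h.formA A hA
    exact ⟨b, a, by rwa [Finset.pair_comm], hb, ha⟩
  formX A hA := by
    obtain ⟨a, b, h, ha, hb⟩ := h.formX A hA
    exact ⟨a, b, h, ha.symm, hb.symm⟩
  fullA v hv := h.fullA v (by tauto)
  fullX v hv := h.fullX v (by tauto)
  load_add_one v hv := h.load_add_one v (by tauto)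

theorem FourClasses.reverse (h : FourClasses N As Xs c p q r s) :
    FourClasses N.reverse Xs As c p r q s where
  hc e he := h.hc e (List.mem_reverse.1 he)
  pq := h.pr
  pr := h.pq
  ps := h.ps
  qr := h.qr.symm
  qs := h.rs
  rs := h.qs
  Apq := h.Xpr
  Ars := h.Xqs
  Xpr := h.Apq
  Xqs := h.Ars
  formA := h.formX
  formX := h.formA
  fullA v hv := h.fullX v (by tauto)
  fullX v hv := h.fullA v (by tauto)
  load_add_one v hv := by rw [load_reverse]; exact h.load_add_one v (by tauto)

theorem FourClasses.informs (h : FourClasses N As Xs c p q r s) (hS : System G N As Xs) {a b v : V}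
    (hab : {a, b} ∈ As) (ha : c a = p) (hb : c b = q) (hv : c v = p) : Informs N a v := by
  obtain ⟨X, hX, hvX⟩ := h.fullX v (Or.inl hv)
  obtain ⟨x, y, rfl, hx, hy⟩ := h.formX X hX
  have h1 := h.pq; have h2 := h.pr; have h3 := h.ps; have h4 := h.qr; have h5 := h.qs
  have hvx : v = x := by grind
  subst hvx
  exact hS.informs_of_class h.hc hab hX (by grind) (by grind) (by grind)

/-- Both `a` and `a'` inform their whole class, which has one person more than calls. So both take
part in its first call. -/
theorem FourClasses.adj (h : FourClasses N As Xs c p q r s) (hS : System G N As Xs) {a a' b b' : V}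
    (hab : {a, b} ∈ As) (ha : c a = p) (hb : c b = q) (hab' : {a', b'} ∈ As) (ha' : c a' = p)
    (hb' : c b' = q) (hne : a ≠ a') : G.Adj a a' := by
  have hl := h.load_add_one p (Or.inl rfl)
  have h1 : (Finset.univ.filter fun w => c w = p).card ≤ (spread N {a}).card :=
    Finset.card_le_card fun v hv => h.informs hS hab ha hb (by simpa using hv)
  have h2 : (Finset.univ.filter fun w => c w = p).card ≤ (spread N {a'}).card :=
    Finset.card_le_card fun v hv => h.informs hS hab' ha' hb' (by simpa using hv)
  have h3 : 1 < (Finset.univ.filter fun w => c w = p).card :=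
    Finset.one_lt_card.2 ⟨a, by simpa using ha, a', by simpa using ha', hne⟩
  exact adj_of_load_le hS.adj h.hc hne (ha'.trans ha.symm) (by rw [ha]; omega)
    (by rw [ha]; omega) (by rw [ha]; omega)

/-- Two different senders between the same two classes would have adjacent endpoints in each of
these classes, and so form a four-cycle of `G`. -/
theorem FourClasses.unique (h : FourClasses N As Xs c p q r s) (hM : MinSystem G k N As Xs)
    (hG : NoFourCycle G) {a a' b b' : V}
    (hab : {a, b} ∈ As) (ha : c a = p) (hb : c b = q) (hab' : {a', b'} ∈ As) (ha' : c a' = p)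
    (hb' : c b' = q) : a = a' ∧ b = b' := by
  have hS := hM.toSystem
  have h1 := h.pq
  have hone : a = a' → ({a, b} : Finset V) = {a', b'} := by
    rintro rfl
    exact hS.disjA _ hab _ hab' a (by simp) (by simp)
  have htwo : b = b' → ({a, b} : Finset V) = {a', b'} := by
    rintro rfl
    exact hS.disjA _ hab _ hab' b (by simp) (by simp)
  have hpair : ({a, b} : Finset V) = {a', b'} → a = a' ∧ b = b' := by
    intro he
    have e1 : a ∈ ({a', b'} : Finset V) := he ▸ (by simp)
    have e2 : b ∈ ({a', b'} : Finset V) := he ▸ (by simp)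
    simp only [Finset.mem_insert, Finset.mem_singleton] at e1 e2
    grind
  by_cases hne : a = a'
  · exact hpair (hone hne)
  by_cases hne' : b = b'
  · exact hpair (htwo hne')
  exfalso
  have adj1 := h.adj hS hab ha hb hab' ha' hb' hne
  have adj2 := h.mirror.adj hS (by rwa [Finset.pair_comm]) hb ha (by rwa [Finset.pair_comm])
    hb' ha' hne'
  rcases hG a a' b' b adj1 (hM.adj_of_mem hab' (by grind)) adj2.symm
    (hM.adj_of_mem hab (by grind)).symm with h' | h' <;> grind

/-- The classes of `q` and `r` cannot both be trivial. -/
theorem FourClasses.false_of_trivial (h : FourClasses N As Xs c p q r s)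
    (hM : MinSystem G k N As Xs) (hG : NoFourCycle G) (hq : ∀ v w, c v = q → c w = q → v = w)
    (hr : ∀ v w, c v = r → c w = r → v = w) : False := by
  obtain ⟨p₁, u₂, h12, hp₁, hu₂⟩ := h.Apq
  obtain ⟨u₃, q₄, h34, hu₃, hq₄⟩ := h.Ars
  obtain ⟨q₁, u₃', h13, hq₁, hu₃'⟩ := h.Xpr
  obtain ⟨u₂', p₄, h24, hu₂', hp₄⟩ := h.Xqs
  obtain rfl := hq _ _ hu₂ hu₂'
  obtain rfl := hr _ _ hu₃ hu₃'
  have h1 := h.pq; have h2 := h.pr; have h3 := h.ps; have h4 := h.qr; have h5 := h.qs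
  have h6 := h.rs
  have hquad : Quad N As Xs c p s p₁ q₁ p₄ q₄ u₂ u₃ := by
    refine ⟨h.hc, h.ps, hp₁, hq₁, hp₄, hq₄, by grind, by grind, by grind, by grind, by grind, h12,
      by rwa [Finset.pair_comm], by rwa [Finset.pair_comm], h13, ?_, ?_,
      fun v hv => h.fullA v (by tauto), fun v hv => h.fullX v (by tauto)⟩
    · intro A hA
      obtain ⟨a, b, rfl, ha, hb⟩ := h.formA A hA
      by_cases hbq : c b = q
      · left
        obtain rfl := hq _ _ hbq hu₂
        exact hM.disjA _ hA _ h12 b (by simp) (by simp)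
      · by_cases har : c a = r
        · right; left
          obtain rfl := hr _ _ har hu₃
          rw [Finset.pair_comm q₄]
          exact hM.disjA _ hA _ h34 a (by simp) (by simp)
        · exact Or.inr (Or.inr ⟨a, b, rfl, by tauto, by tauto⟩)
    · intro A hA
      obtain ⟨a, b, rfl, ha, hb⟩ := h.formX A hA
      by_cases haq : c a = q
      · left
        obtain rfl := hq _ _ haq hu₂
        rw [Finset.pair_comm p₄]
        exact hM.disjX _ hA _ h24 a (by simp) (by simp)
      · by_cases hbr : c b = r
        · right; left
          obtain rfl := hr _ _ hbr hu₃
          exact hM.disjX _ hA _ h13 b (by simp) (by simp)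
        · exact Or.inr (Or.inr ⟨a, b, rfl, by tauto, by tauto⟩)
  exact hquad.false hM hG (h.load_add_one p (by simp)) (h.load_add_one s (by simp))

/-- A sender between `p` and `s` excludes receivers between `q` and `r`. Then all receivers at `q`
lead to `s` and all receivers at `r` lead to `p`, and by uniqueness `q` and `r` are trivial. Without
such a sender, all senders at `p` lead to `q` and all senders at `s` lead to `r`, and `p` and `s`
are trivial. -/
theorem FourClasses.false (h : FourClasses N As Xs c p q r s)
    (hM : MinSystem G k N As Xs) (hG : NoFourCycle G) : False := by
  have h1 := h.pq; have h2 := h.pr; have h3 := h.ps; have h4 := h.qr; have h5 := h.qs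
  have h6 := h.rs
  by_cases hps : ∃ a b, {a, b} ∈ As ∧ c a = p ∧ c b = s
  · obtain ⟨a, b, hab, ha, hb⟩ := hps
    have hno : ∀ x y, {x, y} ∈ Xs → c x = q → c y = r → False := by
      intro x y hxy hx hy
      obtain ⟨v, hv, w, hw, hvw⟩ := hM.reach _ hab _ hxy
      have := hvw.class_eq h.hc
      simp only [Finset.mem_insert, Finset.mem_singleton] at hv hw
      grind
    have hq : ∀ v, c v = q → ∃ y, {v, y} ∈ Xs ∧ c y = s := by
      intro v hv
      obtain ⟨X, hX, hvX⟩ := h.fullX v (by tauto)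
      obtain ⟨x, y, rfl, hx, hy⟩ := h.formX X hX
      have hvx : v = x := by grind
      subst hvx
      refine ⟨y, hX, hy.resolve_left fun hy => hno _ _ hX hv hy⟩
    have hr : ∀ v, c v = r → ∃ y, {y, v} ∈ Xs ∧ c y = p := by
      intro v hv
      obtain ⟨X, hX, hvX⟩ := h.fullX v (by tauto)
      obtain ⟨x, y, rfl, hx, hy⟩ := h.formX X hX
      have hvy : v = y := by grind
      subst hvy
      refine ⟨x, hX, hx.resolve_right fun hx => hno _ _ hX hx hv⟩
    refine h.false_of_trivial hM hG ?_ ?_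
    · intro v w hv hw
      obtain ⟨y, hy, hcy⟩ := hq v hv
      obtain ⟨y', hy', hcy'⟩ := hq w hw
      exact (h.reverse.swap.unique hM.reverse hG hy hv hcy hy' hw hcy').1
    · intro v w hv hw
      obtain ⟨y, hy, hcy⟩ := hr v hv
      obtain ⟨y', hy', hcy'⟩ := hr w hw
      exact (h.reverse.unique hM.reverse hG hy hcy hv hy' hcy' hw).2
  · have hp : ∀ v, c v = p → ∃ y, {v, y} ∈ As ∧ c y = q := by
      intro v hv
      obtain ⟨X, hX, hvX⟩ := h.fullA v (by tauto)
      obtain ⟨x, y, rfl, hx, hy⟩ := h.formA X hX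
      have hvx : v = x := by grind
      subst hvx
      exact ⟨y, hX, hy.resolve_right fun hy => hps ⟨_, _, hX, hv, hy⟩⟩
    have hs : ∀ v, c v = s → ∃ y, {y, v} ∈ As ∧ c y = r := by
      intro v hv
      obtain ⟨X, hX, hvX⟩ := h.fullA v (by tauto)
      obtain ⟨x, y, rfl, hx, hy⟩ := h.formA X hX
      have hvy : v = y := by grind
      subst hvy
      exact ⟨x, hX, hx.resolve_left fun hx => hps ⟨_, _, hX, hx, hv⟩⟩
    refine h.mirror.false_of_trivial hM hG ?_ ?_
    · intro v w hv hw
      obtain ⟨y, hy, hcy⟩ := hp v hv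
      obtain ⟨y', hy', hcy'⟩ := hp w hw
      exact (h.unique hM hG hy hv hcy hy' hw hcy').1
    · intro v w hv hw
      obtain ⟨y, hy, hcy⟩ := hs v hv
      obtain ⟨y', hy', hcy'⟩ := hs w hw
      exact (h.swap.unique hM hG hy hcy hv hy' hcy' hw).2

end Main

end MAL

/-! ### Counting the items in the classes, and the end of the lower bound -/

namespace MAL

section Assembly

variable {V : Type*} [DecidableEq V]
variable {G : SimpleGraph V} {N : List (V × V)} {As Xs : Finset (Finset V)} {k : ℕ}

/-- The number of vertices in the class `κ` that belong to an item. -/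
def occ (c : V → V) (As : Finset (Finset V)) (κ : V) : ℕ :=
  ((As.biUnion id).filter fun v => c v = κ).card

theorem MinSystem.card_eq_two (h : MinSystem G k N As Xs) {A : Finset V} (hA : A ∈ As) :
    A.card = 2 := by
  obtain ⟨v, hv⟩ := (h.itemA A hA).nonempty
  obtain ⟨a, hne, -, rfl⟩ := h.exists_eq_pair hA hv
  exact Finset.card_pair hne.symm

variable [Fintype V] {c : V → V}

theorem sum_occ (h : MinSystem G k N As Xs) (c : V → V) : ∑ κ, occ c As κ = 2 * As.card := by
  unfold occ
  rw [← Finset.card_eq_sum_card_fiberwise fun _ _ => Finset.mem_coe.2 (Finset.mem_univ _),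
    Finset.card_biUnion]
  · rw [Finset.sum_congr rfl fun A hA => show (id A).card = 2 from h.card_eq_two hA]
    simp [mul_comm]
  · intro A hA B hB hAB
    exact Finset.disjoint_left.2 fun v hv hv' => hAB (h.disjA A hA B hB v hv hv')

theorem occ_le (As : Finset (Finset V)) (κ : V) :
    occ c As κ ≤ (Finset.univ.filter fun v => c v = κ).card :=
  Finset.card_le_card (Finset.filter_subset_filter _ (Finset.subset_univ _))

theorem exists_mem_of_occ_eq {κ : V}
    (h : occ c As κ = (Finset.univ.filter fun v => c v = κ).card) {v : V} (hv : c v = κ) :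
    ∃ A ∈ As, v ∈ A := by
  have := Finset.eq_of_subset_of_card_le
    (Finset.filter_subset_filter (fun v => c v = κ) (Finset.subset_univ (As.biUnion id))) h.ge
  have hv' : v ∈ Finset.univ.filter fun v => c v = κ := by simpa using hv
  rw [← this] at hv'
  simpa using (Finset.mem_filter.1 hv').1

omit [Fintype V] in
theorem exists_mem_of_occ_pos {κ : V} (h : 0 < occ c As κ) : ∃ A ∈ As, ∃ v ∈ A, c v = κ := by
  obtain ⟨v, hv⟩ := Finset.card_pos.1 h
  simp only [Finset.mem_filter, Finset.mem_biUnion, id] at hv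
  obtain ⟨⟨A, hA, hvA⟩, hc⟩ := hv
  exact ⟨A, hA, v, hvA, hc⟩

omit [Fintype V] in
theorem isolated_of_load_eq_zero (hc : ∀ e ∈ N, c e.1 = c e.2) {y : V} (h : load c N (c y) = 0) :
    ∀ e ∈ N, e.1 ≠ y ∧ e.2 ≠ y := by
  intro e he
  have h1 := load_eq_zero_iff.1 h e he
  refine ⟨fun h => h1 (by rw [h]), fun h => h1 (by rw [hc e he, h])⟩

/-- Without receivers in the class, its surplus forces load 0. A vertex of a sender there makes no
calls and lies in no receiver, so the other endpoint alone would have to inform all receivers. -/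
theorem MinSystem.occ_pos (h : MinSystem G k N As Xs) (hc : ∀ e ∈ N, c e.1 = c e.2)
    (hcard : ∀ κ, (Finset.univ.filter fun v => c v = κ).card ≤ load c N κ + 1) {κ : V}
    (hκ : 2 * load c N κ < occ c As κ + occ c Xs κ) : 0 < occ c Xs κ := by
  by_contra! hzero
  have h1 := occ_le (c := c) As κ
  have h2 := hcard κ
  have hl : load c N κ = 0 := by omega
  obtain ⟨A, hA, v, hvA, rfl⟩ := exists_mem_of_occ_pos (c := c) (As := As) (κ := κ) (by omega)
  obtain ⟨a, hne, -, rfl⟩ := h.exists_eq_pair hA hvA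
  obtain ⟨X, hX, hXa⟩ := h.exists_not_informs hA (a := a) (by simp)
  obtain ⟨b, hb, x, hx, hbx⟩ := h.reach _ hA X hX
  simp only [Finset.mem_insert, Finset.mem_singleton] at hb
  rcases hb with rfl | rfl
  · obtain rfl := (informs_of_notMem (isolated_of_load_eq_zero hc hl)).1 hbx
    have : x ∈ (Xs.biUnion id).filter fun v => c v = c x := by
      simp only [Finset.mem_filter, Finset.mem_biUnion, id]
      exact ⟨⟨X, hX, hx⟩, trivial⟩
    have := Finset.card_pos.2 ⟨x, this⟩
    unfold occ at hzero
    omega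
  · exact hXa x hx hbx

/-- Two classes are related if an item connects them. -/
def Linked (c : V → V) (As : Finset (Finset V)) (x y : V) : Prop :=
  ∃ a b, {a, b} ∈ As ∧ c a = x ∧ c b = y

omit [Fintype V] in
theorem Linked.symm {x y : V} (h : Linked c As x y) : Linked c As y x := by
  obtain ⟨a, b, hab, ha, hb⟩ := h
  exact ⟨b, a, by rwa [Finset.pair_comm], hb, ha⟩

omit [Fintype V] in
theorem System.linked (h : System G N As Xs) (hc : ∀ e ∈ N, c e.1 = c e.2) {x y u v : V}
    (hxy : Linked c As x y) (huv : Linked c Xs u v) : x = u ∨ x = v ∨ y = u ∨ y = v := by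
  obtain ⟨a, b, hab, rfl, rfl⟩ := hxy
  obtain ⟨a', b', hab', rfl, rfl⟩ := huv
  obtain ⟨s, hs, t, ht, hst⟩ := h.reach _ hab _ hab'
  have := hst.class_eq hc
  simp only [Finset.mem_insert, Finset.mem_singleton] at hs ht
  rcases hs with rfl | rfl <;> rcases ht with rfl | rfl <;> tauto

omit [Fintype V] in
theorem MinSystem.exists_linked (h : MinSystem G k N As Xs) {κ : V} (hκ : 0 < occ c As κ) :
    ∃ y, Linked c As κ y := by
  obtain ⟨A, hA, v, hv, rfl⟩ := exists_mem_of_occ_pos hκ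
  obtain ⟨a, -, -, rfl⟩ := h.exists_eq_pair hA hv
  exact ⟨c a, v, a, hA, rfl, rfl⟩

omit [Fintype V] in
/-- If all items meet the class `z`, then every other class of an item is trivial, provided that it
has few calls. -/
theorem MinSystem.load_le_of_star (h : MinSystem G k N As Xs) (hc : ∀ e ∈ N, c e.1 = c e.2) {z : V}
    (hz : ∀ x y, Linked c As x y → z = x ∨ z = y) (hz' : ∀ x y, Linked c Xs x y → z = x ∨ z = y)
    {κ : V} (hκ : 0 < occ c As κ) (hne : κ ≠ z) : N.length ≤ 2 * load c N κ + load c N z := by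
  obtain ⟨A, hA, v, hv, rfl⟩ := exists_mem_of_occ_pos hκ
  obtain ⟨a, hav, -, rfl⟩ := h.exists_eq_pair hA hv
  have hca : z = c a := (hz _ _ ⟨v, a, hA, rfl, rfl⟩).resolve_left hne.symm
  obtain ⟨X, hX, hXa⟩ := h.exists_not_informs hA (a := a) (by simp)
  obtain ⟨b, hb, w, hw, hbw⟩ := h.reach _ hA X hX
  obtain rfl : b = v := by
    simp only [Finset.mem_insert, Finset.mem_singleton] at hb
    exact hb.resolve_right fun hb => hXa w hw (hb ▸ hbw)
  have hcw := hbw.class_eq hc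
  obtain ⟨x, hxw, -, rfl⟩ := h.reverse.exists_eq_pair hX hw
  have hcx : z = c x := (hz' _ _ ⟨w, x, hX, rfl, rfl⟩).resolve_left (hcw ▸ hne.symm)
  have hax : ¬ Informs N a x := hXa x (by simp)
  -- A call in the class of `b` can bring both kinds of news. In the class `z` it brings at most
  -- one, because `a` does not inform `x`; in other classes there is none. In total there must be at
  -- least `As.card + Xs.card - 4` news, which is at least `N.length`.
  have hpoint : ∀ j : Fin N.length, newsAt N {b, a} j + newsBackAt N {w, x} j ≤
      2 * (if c N[j].1 = c b then 1 else 0) + if c N[j].1 = z then 1 else 0 := by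
    rintro ⟨j, hj⟩
    have l1 := newsAt_le_one N {b, a} hj
    have l2 := newsBackAt_le_one N {w, x} hj
    simp only [Fin.getElem_fin]
    by_cases h1 : c N[j].1 = c b
    · rw [if_pos h1]; omega
    rw [if_neg h1]
    by_cases h2 : c N[j].1 = z
    · rw [if_pos h2]
      by_contra! hlt
      obtain ⟨s, hs, t, ht, hst, hs1, ht1⟩ :=
        exists_informs_of_news (S := {b, a}) (T := {w, x}) hj (by omega) (by omega)
      have e1 := hs1.class_eq fun e he => hc e (List.mem_of_mem_take he)
      have e2 := hst.class_eq hc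
      simp only [Finset.mem_insert, Finset.mem_singleton] at hs ht
      have hsa : s = a := hs.resolve_left (by rintro rfl; exact h1 e1.symm)
      have htx : t = x := ht.resolve_left (by
        rintro rfl; exact h1 (e1.symm.trans (e2.trans hcw.symm)))
      subst hsa htx
      exact hax hst
    · rw [if_neg h2]
      have hj1 := hc N[j] (List.getElem_mem hj)
      have z1 : newsAt N {b, a} j ≠ 1 := by
        intro h1'
        rw [newsAt_eq_one_iff N _ hj] at h1'
        have : ∃ s ∈ ({b, a} : Finset V), c s = c N[j].1 := by
          have : N[j].1 ∈ spread (N.take j) {b, a} ∨ N[j].2 ∈ spread (N.take j) {b, a} := by tauto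
          rcases this with h' | h' <;> obtain ⟨s, hs, hs'⟩ := mem_spread.1 h'
          · exact ⟨s, hs, hs'.class_eq fun e he => hc e (List.mem_of_mem_take he)⟩
          · exact ⟨s, hs, (hs'.class_eq fun e he => hc e (List.mem_of_mem_take he)).trans hj1.symm⟩
        obtain ⟨s, hs, hs'⟩ := this
        simp only [Finset.mem_insert, Finset.mem_singleton] at hs
        rcases hs with rfl | rfl
        · exact h1 hs'.symm
        · exact h2 (hs'.symm.trans hca.symm)
      have z2 : newsBackAt N {w, x} j ≠ 1 := by
        intro h1'
        rw [newsBackAt_eq_one_iff N _ hj] at h1'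
        have hc' : ∀ e ∈ (N.drop (j + 1)).reverse, c e.1 = c e.2 := fun e he =>
          hc e (List.mem_of_mem_drop (List.mem_reverse.1 he))
        have : ∃ s ∈ ({w, x} : Finset V), c s = c N[j].1 := by
          have : N[j].1 ∈ spread (N.drop (j + 1)).reverse {w, x} ∨
            N[j].2 ∈ spread (N.drop (j + 1)).reverse {w, x} := by tauto
          rcases this with h' | h' <;> obtain ⟨s, hs, hs'⟩ := mem_spread.1 h'
          · exact ⟨s, hs, hs'.class_eq hc'⟩
          · exact ⟨s, hs, (hs'.class_eq hc').trans hj1.symm⟩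
        obtain ⟨s, hs, hs'⟩ := this
        simp only [Finset.mem_insert, Finset.mem_singleton] at hs
        rcases hs with rfl | rfl
        · exact h1 (hs'.symm.trans hcw.symm)
        · exact h2 (hs'.symm.trans hcx.symm)
      omega
  have hsum := Finset.sum_le_sum fun j (_ : j ∈ Finset.univ) => hpoint j
  rw [Finset.sum_add_distrib, Finset.sum_add_distrib, ← Finset.mul_sum] at hsum
  change _ ≤ 2 * load c N (c b) + load c N z at hsum
  have hs1 := card_spread N {b, a}
  have hs2 := card_spread_reverse N {w, x}
  have hd := h.disjX.card_le (S := spread N {b, a}) fun X' hX' => by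
    obtain ⟨s, hs, t, ht, hst⟩ := h.reach _ hA X' hX'
    exact ⟨t, ht, mem_spread.2 ⟨s, hs, hst⟩⟩
  have hd' := h.disjA.card_le (S := spread N.reverse {w, x}) fun A' hA' => by
    obtain ⟨s, hs, t, ht, hst⟩ := h.reach A' hA' _ hX
    exact ⟨s, hs, mem_spread.2 ⟨t, ht, informs_reverse.2 hst⟩⟩
  have := h.small
  have := h.four_le
  rw [Finset.card_pair hav.symm] at hs1
  rw [Finset.card_pair hxw.symm] at hs2
  omega

/-- By `MinSystem.load_le_of_star`, `N.length` is at most twice the load of each class `g i` plus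
the load of `z`, while the four loads add up to at most `N.length`. So each load of the three
classes is at least the sum of the other two, and all are 0. This leaves three vertices without
calls, contrary to `not_three_tight`. -/
theorem MinSystem.not_star (h : MinSystem G k N As Xs) (hc : ∀ e ∈ N, c e.1 = c e.2)
    (hcard : ∀ κ, (Finset.univ.filter fun v => c v = κ).card ≤ load c N κ + 1) {z : V}
    (hz : ∀ x y, Linked c As x y → z = x ∨ z = y) (hz' : ∀ x y, Linked c Xs x y → z = x ∨ z = y)
    {g : Fin 3 → V} (hg : Function.Injective g) (hgz : ∀ i, g i ≠ z)
    (hgA : ∀ i, 0 < occ c As (g i)) (hgX : ∀ i, 0 < occ c Xs (g i)) : False := by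
  have hload : ∀ i, load c N (g i) = 0 := by
    have hsum := sum_load_le c N (insert z (Finset.univ.image g))
    rw [Finset.sum_insert (by simpa using hgz), Finset.sum_image fun _ _ _ _ h => hg h,
      Fin.sum_univ_three] at hsum
    have h0 := h.load_le_of_star hc hz hz' (hgA 0) (hgz 0)
    have h1 := h.load_le_of_star hc hz hz' (hgA 1) (hgz 1)
    have h2 := h.load_le_of_star hc hz hz' (hgA 2) (hgz 2)
    have l0 : load c N (g 0) = 0 := by omega
    have l1 : load c N (g 1) = 0 := by omega
    have l2 : load c N (g 2) = 0 := by omega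
    intro i
    fin_cases i
    exacts [l0, l1, l2]
  have hex : ∀ i, ∃ y a x, c y = g i ∧ Tight N As Xs y a x := by
    intro i
    obtain ⟨A, hA, y, hy, hcy⟩ := exists_mem_of_occ_pos (hgA i)
    obtain ⟨X, hX, y', hy', hcy'⟩ := exists_mem_of_occ_pos (hgX i)
    have hyy : y = y' := by
      refine Finset.card_le_one.1 ((hcard (g i)).trans (by rw [hload i])) y ?_ y' ?_ <;>
        simp [hcy, hcy']
    subst hyy
    obtain ⟨a, x, -, -, ht⟩ := h.exists_tight
      (isolated_of_load_eq_zero hc (by rw [hcy]; exact hload i)) hA hX hy hy'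
    exact ⟨y, a, x, hcy, ht⟩
  choose y a x hcy ht using hex
  refine not_three_tight h.toSystem (by have := h.small; have := h.four_le; omega) ht
    (fun A hA => h.card_eq_two hA) (fun X hX => h.reverse.card_eq_two hX) ?_ ?_
  · intro i j hij he
    have hmem : y i ∈ ({y j, a j} : Finset V) := he ▸ by simp
    have hca := (hz _ _ ⟨_, _, (ht j).memA, hcy j, rfl⟩).resolve_left (hgz j).symm
    simp only [Finset.mem_insert, Finset.mem_singleton] at hmem
    rcases hmem with hm | hm
    · exact hij (hg (by rw [← hcy i, ← hcy j, hm]))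
    · exact hgz i (by rw [← hcy i, hm, hca])
  · intro i j hij he
    have hmem : y i ∈ ({y j, x j} : Finset V) := he ▸ by simp
    have hca := (hz' _ _ ⟨_, _, (ht j).memX, hcy j, rfl⟩).resolve_left (hgz j).symm
    simp only [Finset.mem_insert, Finset.mem_singleton] at hmem
    rcases hmem with hm | hm
    · exact hij (hg (by rw [← hcy i, ← hcy j, hm]))
    · exact hgz i (by rw [← hcy i, hm, hca])

theorem MinSystem.false (h : MinSystem G k N As Xs) : False := by
  obtain ⟨c, hc, hcard⟩ := exists_classes N
  set good : Finset V := Finset.univ.filter fun κ => 2 * load c N κ < occ c As κ + occ c Xs κ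
    with hgood
  -- A class has at most `load + 1` persons, so its surplus over twice the load is at most 2.
  -- Summation over the classes gives at least `k` classes with a surplus.
  have hpoint : ∀ κ, occ c As κ + occ c Xs κ ≤
      2 * load c N κ + 2 * if 2 * load c N κ < occ c As κ + occ c Xs κ then 1 else 0 := by
    intro κ
    have h1 := occ_le (c := c) As κ
    have h2 := occ_le (c := c) Xs κ
    have h3 := hcard κ
    split_ifs <;> omega
  have hleft : ∑ κ, (occ c As κ + occ c Xs κ) = 2 * As.card + 2 * Xs.card := by
    rw [Finset.sum_add_distrib, sum_occ h, sum_occ h.reverse]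
  have hright : ∑ κ, (2 * load c N κ + 2 *
      if 2 * load c N κ < occ c As κ + occ c Xs κ then 1 else 0) ≤ 2 * N.length + 2 * good.card := by
    rw [Finset.sum_add_distrib, ← Finset.mul_sum, ← Finset.mul_sum, hgood, Finset.card_filter]
    have := sum_load_le c N Finset.univ
    omega
  have hle := Finset.sum_le_sum fun κ (_ : κ ∈ Finset.univ) => hpoint κ
  have hsmall := h.small
  have hfour := h.four_le
  have hX : ∀ κ ∈ good, 0 < occ c Xs κ := fun κ hκ =>
    h.occ_pos hc hcard (Finset.mem_filter.1 hκ).2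
  have hA : ∀ κ ∈ good, 0 < occ c As κ := fun κ hκ =>
    h.reverse.occ_pos (fun e he => hc e (List.mem_reverse.1 he))
      (fun κ => by rw [load_reverse]; exact hcard κ)
      (by rw [load_reverse, add_comm]; exact (Finset.mem_filter.1 hκ).2)
  obtain ⟨g₁, hg₁, g₂, hg₂, g₃, hg₃, g₄, hg₄, h12, h13, h14, h23, h24, h34⟩ :=
    Finset.three_lt_card.1 (show 3 < good.card by omega)
  have hgg : ∀ g, g = g₁ ∨ g = g₂ ∨ g = g₃ ∨ g = g₄ → g ∈ good := by
    rintro g (rfl | rfl | rfl | rfl) <;> assumption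
  rcases cross_structure (R := Linked c As) (B := Linked c Xs) (fun _ _ => Linked.symm)
    (fun _ _ => Linked.symm) (fun _ _ _ _ => h.toSystem.linked hc) h12 h13 h14 h23 h24 h34
    (fun g hg => h.exists_linked (hA g (hgg g hg)))
    (fun g hg => h.reverse.exists_linked (hX g (hgg g hg))) with
    ⟨z, hz, hz'⟩ | ⟨p, q, r, s, hpq, hpr, hps, hqr, hqs, hrs, Apq, Ars, Xpr, Xqs⟩
  · have key : ∀ a b d : V, a ∈ good → b ∈ good → d ∈ good → a ≠ b → a ≠ d → b ≠ d → a ≠ z → b ≠ z →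
        d ≠ z → False := by
      intro a b d ha hb hd hab had hbd haz hbz hdz
      refine h.not_star hc hcard hz hz' (g := ![a, b, d]) ?_ ?_ ?_ ?_
      · intro i j hij
        fin_cases i <;> fin_cases j <;> simp_all
      · intro i; fin_cases i <;> simp [haz, hbz, hdz]
      · intro i; fin_cases i <;> simp [hA _ ha, hA _ hb, hA _ hd]
      · intro i; fin_cases i <;> simp [hX _ ha, hX _ hb, hX _ hd]
    by_cases h1 : g₁ = z
    · subst h1
      exact key _ _ _ hg₂ hg₃ hg₄ h23 h24 h34 h12.symm h13.symm h14.symm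
    by_cases h2 : g₂ = z
    · subst h2
      exact key _ _ _ hg₁ hg₃ hg₄ h13 h14 h34 h12 h23.symm h24.symm
    by_cases h3 : g₃ = z
    · subst h3
      exact key _ _ _ hg₁ hg₂ hg₄ h12 h14 h24 h13 h23 h34.symm
    · exact key _ _ _ hg₁ hg₂ hg₃ h12 h13 h23 h1 h2 h3
  -- A sender meets the receivers `pr` and `qs`, so both its ends are among the four classes. With
  -- at least `k` good classes this forces `k = 4`.
  · have hsub : good ⊆ {p, q, r, s} := by
      intro κ hκ
      obtain ⟨y, hy⟩ := h.exists_linked (hA κ hκ)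
      have e1 := h.toSystem.linked hc hy Xpr
      have e2 := h.toSystem.linked hc hy Xqs
      simp only [Finset.mem_insert, Finset.mem_singleton]
      by_contra! hcon
      obtain ⟨n1, n2, n3, n4⟩ := hcon
      have f1 := (e1.resolve_left n1).resolve_left n3
      have f2 := (e2.resolve_left n2).resolve_left n4
      rcases f1 with rfl | rfl <;> rcases f2 with f2 | f2
      exacts [hpq f2, hps f2, hqr f2.symm, hrs f2]
    have hfourset : ({p, q, r, s} : Finset V).card = 4 := by
      rw [Finset.card_insert_of_notMem (by simp [hpq, hpr, hps]),
        Finset.card_insert_of_notMem (by simp [hqr, hqs]), Finset.card_pair hrs]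
    have hgc := Finset.card_le_card hsub
    rw [hfourset] at hgc
    have hgeq := Finset.eq_of_subset_of_card_le hsub (by omega)
    -- The four good classes leave no slack: the sum of the bounds `hpoint` is attained, hence each
    -- of them. So every person of a good class lies in a sender and in a receiver.
    have heq := (Finset.sum_eq_sum_iff_of_le fun κ (_ : κ ∈ Finset.univ) => hpoint κ).1 (by omega)
    have hfull : ∀ κ, (κ = p ∨ κ = q ∨ κ = r ∨ κ = s) →
        occ c As κ = (Finset.univ.filter fun v => c v = κ).card ∧
        occ c Xs κ = (Finset.univ.filter fun v => c v = κ).card ∧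
        load c N κ + 1 = (Finset.univ.filter fun v => c v = κ).card := by
      intro κ hκ
      have hκg : κ ∈ good := by rw [hgeq]; simpa using hκ
      have h0 := heq κ (Finset.mem_univ _)
      rw [if_pos (Finset.mem_filter.1 hκg).2] at h0
      have h1 := occ_le (c := c) As κ
      have h2 := occ_le (c := c) Xs κ
      have h3 := hcard κ
      omega
    have form : ∀ {x y}, Linked c As x y → (x = p ∨ x = r) ∧ (y = q ∨ y = s) ∨
        (y = p ∨ y = r) ∧ (x = q ∨ x = s) := by
      intro x y hxy
      have e1 := h.toSystem.linked hc hxy Xpr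
      have e2 := h.toSystem.linked hc hxy Xqs
      grind
    have form' : ∀ {x y}, Linked c Xs x y → (x = p ∨ x = q) ∧ (y = r ∨ y = s) ∨
        (y = p ∨ y = q) ∧ (x = r ∨ x = s) := by
      intro x y hxy
      have e1 := h.toSystem.linked hc Apq hxy
      have e2 := h.toSystem.linked hc Ars hxy
      grind
    have hFC : FourClasses N As Xs c p q r s := by
      refine ⟨hc, hpq, hpr, hps, hqr, hqs, hrs, Apq, Ars, Xpr, Xqs, ?_, ?_,
        fun v hv => exists_mem_of_occ_eq (hfull _ hv).1 rfl,
        fun v hv => exists_mem_of_occ_eq (hfull _ hv).2.1 rfl, fun v hv => (hfull _ hv).2.2⟩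
      · intro A hA
        obtain ⟨v, hv⟩ := (h.itemA A hA).nonempty
        obtain ⟨a, -, -, rfl⟩ := h.exists_eq_pair hA hv
        rcases form ⟨v, a, hA, rfl, rfl⟩ with h' | h'
        exacts [⟨v, a, rfl, h'⟩, ⟨a, v, Finset.pair_comm _ _, h'⟩]
      · intro A hA
        obtain ⟨v, hv⟩ := (h.itemX A hA).nonempty
        obtain ⟨a, -, -, rfl⟩ := h.reverse.exists_eq_pair hA hv
        rcases form' ⟨v, a, hA, rfl, rfl⟩ with h' | h'
        exacts [⟨v, a, rfl, h'⟩, ⟨a, v, Finset.pair_comm _ _, h'⟩]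
    exact hFC.false h (h.noFourCycle (by omega))

/-- The lower bound for the number of calls. -/
theorem System.card_lt (h : System G N As Xs) (hk : 4 ≤ k) (hG : k = 4 → NoFourCycle G)
    (hA : 2 ≤ As.card) (hX : 2 ≤ Xs.card) : As.card + Xs.card < N.length + k := by
  induction hm : N.length + As.card + Xs.card using Nat.strong_induction_on
    generalizing N As Xs with
  | _ m ih =>
    subst hm
    by_contra! hcon
    exact MinSystem.false (G := G) (k := k) ⟨h, hk, hG, hA, hX, hcon,
      fun N' As' Xs' hlt hS hA hX => ih _ hlt hS hA hX rfl⟩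

end Assembly

end MAL

/-! ### From labelings to calls -/

namespace MAL

section Labels

variable {V : Type} {G : SimpleGraph V}

/-- The calls along timed edges. -/
noncomputable def callsOf (L : List (Sym2 V × ℕ)) : List (V × V) := L.map fun e => Quot.out e.1

theorem mk_out (e : Sym2 V) : s((Quot.out e).1, (Quot.out e).2) = e := Quot.out_eq e

/-- The times along a temporal path increase strictly, so its calls occur in `L` in this order,
however calls at equal times are arranged. -/
theorem informs_of_walk [DecidableEq V] {v w : V} (p : G.Walk v w) :
    ∀ (L : List (Sym2 V × ℕ)) (ts : List ℕ), L.Pairwise (fun a b => a.2 ≤ b.2) →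
      List.Forall₂ (fun e t => (e, t) ∈ L) p.edges ts → ts.Pairwise (· < ·) →
      Informs (callsOf L) v w := by
  induction p with
  | nil => intro L ts _ _ _; exact Informs.refl _ _
  | @cons u v w h p ih =>
    intro L ts hL hf hts
    rw [SimpleGraph.Walk.edges_cons] at hf
    cases hf with
    | @cons _ t _ ts ht hf =>
      obtain ⟨L₁, L₂, rfl⟩ := List.append_of_mem ht
      rw [List.pairwise_cons] at hts
      rw [List.pairwise_append] at hL
      have hf' : List.Forall₂ (fun e t => (e, t) ∈ L₂) p.edges ts := by
        refine List.forall₂_iff_get.2 ⟨hf.length_eq, fun i h₁ h₂ => ?_⟩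
        have h0 := hf.get h₁ h₂
        have hlt := hts.1 _ (List.get_mem ts ⟨i, h₂⟩)
        rcases List.mem_append.1 h0 with h' | h'
        · exact absurd (hL.2.2 _ h' _ List.mem_cons_self) (by simpa using hlt)
        · rcases List.mem_cons.1 h' with h' | h'
          · rw [Prod.mk.injEq] at h'
            exact absurd h'.2 hlt.ne'
          · exact h'
      have hi := ih L₂ ts (List.pairwise_cons.1 hL.2.1).2 hf' hts.2
      unfold callsOf
      rw [List.map_append, List.map_cons, informs_append]
      refine ⟨u, Informs.refl _ _, informs_cons.2 ⟨v, mem_learn.2 (Or.inr ?_), hi⟩⟩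
      have hout := mk_out s(u, v)
      rw [Sym2.eq_iff] at hout
      simp only [Finset.mem_singleton]
      rcases hout with ⟨h1, h2⟩ | ⟨h1, h2⟩
      · exact ⟨Or.inl h1, Or.inr h2.symm⟩
      · exact ⟨Or.inr h2, Or.inl h1.symm⟩

variable [Fintype V] [DecidableEq V]

/-- The lower bound for the number of labels of a temporally connected labeling. -/
theorem Labeling.TemporallyConnected.two_mul_card_lt {lam : Labeling G}
    (h : lam.TemporallyConnected) (hV : 2 ≤ Fintype.card V) {k : ℕ} (hk : 4 ≤ k)
    (hG : k = 4 → NoFourCycle G) : 2 * Fintype.card V < lam.numLabels + k := by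
  set S : Finset (Σ _ : Sym2 V, ℕ) := Finset.univ.sigma lam.labels with hS
  set L : List (Sym2 V × ℕ) := (S.toList.map fun e => (e.1, e.2)).mergeSort
    fun a b => decide (a.2 ≤ b.2) with hL
  have hlen : (callsOf L).length = lam.numLabels := by
    rw [callsOf, List.length_map, hL, List.length_mergeSort, List.length_map, Finset.length_toList,
      hS, Finset.card_sigma]
    rfl
  have hmem : ∀ e t, (e, t) ∈ L ↔ t ∈ lam.labels e := by
    intro e t
    simp [hL, hS]
  have hsorted : L.Pairwise fun a b => a.2 ≤ b.2 := by
    have := List.pairwise_mergeSort (le := fun a b : Sym2 V × ℕ => decide (a.2 ≤ b.2))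
      (by simp only [decide_eq_true_eq]; omega)
      (by simp only [Bool.or_eq_true, decide_eq_true_eq]; omega)
      (S.toList.map fun e => (e.1, e.2))
    simpa using this
  -- Every vertex by itself is both a sender and a receiver.
  have hsys : System G (callsOf L) (Finset.univ.image singleton) (Finset.univ.image singleton) := by
    have hitem : ∀ A ∈ (Finset.univ : Finset V).image singleton, IsItem G A := by
      intro A hA
      obtain ⟨a, -, rfl⟩ := Finset.mem_image.1 hA
      exact ⟨a, a, by simp, Or.inl rfl⟩
    have hdisj : Disj ((Finset.univ : Finset V).image singleton) := by
      intro A hA B hB v hvA hvB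
      obtain ⟨a, -, rfl⟩ := Finset.mem_image.1 hA
      obtain ⟨b, -, rfl⟩ := Finset.mem_image.1 hB
      rw [← Finset.mem_singleton.1 hvA, ← Finset.mem_singleton.1 hvB]
    refine ⟨?_, hitem, hitem, hdisj, hdisj, ?_⟩
    · intro e he
      obtain ⟨⟨e', t⟩, he', rfl⟩ := List.mem_map.1 he
      rw [hmem] at he'
      rw [← SimpleGraph.mem_edgeSet, mk_out]
      by_contra hcon
      rw [lam.eq_empty _ hcon] at he'
      simp at he'
    · intro A hA X hX
      obtain ⟨a, -, rfl⟩ := Finset.mem_image.1 hA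
      obtain ⟨x, -, rfl⟩ := Finset.mem_image.1 hX
      refine ⟨a, by simp, x, by simp, ?_⟩
      by_cases hax : a = x
      · rw [hax]; exact Informs.refl _ _
      · obtain ⟨p, ts, -, hf, hts⟩ := h a x hax
        exact informs_of_walk p L ts hsorted (hf.imp fun e t => (hmem e t).2) hts
  have hcard : ((Finset.univ : Finset V).image (singleton : V → Finset V)).card = Fintype.card V := by
    rw [Finset.card_image_of_injective _ Finset.singleton_injective, Finset.card_univ]
  have := hsys.card_lt hk hG (by rwa [hcard]) (by rwa [hcard])
  rw [hcard, hlen] at this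
  omega

/-- The choice `k = 5` makes the condition on four-cycles vacuous. -/
theorem Labeling.TemporallyConnected.two_mul_card_le {lam : Labeling G}
    (h : lam.TemporallyConnected) (hV : 2 ≤ Fintype.card V) :
    2 * Fintype.card V ≤ lam.numLabels + 4 := by
  have := h.two_mul_card_lt hV (k := 5) (by omega) (by omega)
  omega

theorem Labeling.TemporallyConnected.two_mul_card_le_of_noFourCycle {lam : Labeling G}
    (h : lam.TemporallyConnected) (hV : 2 ≤ Fintype.card V) (hG : NoFourCycle G) :
    2 * Fintype.card V ≤ lam.numLabels + 3 := by
  have := h.two_mul_card_lt hV (k := 4) le_rfl fun _ => hG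
  omega

theorem Labeling.IsSolution.opt_le {lam : Labeling G} {a : ℕ} (h : lam.IsSolution a) :
    opt G a ≤ lam.numLabels :=
  Nat.sInf_le ⟨lam, h, rfl⟩

theorem Labeling.IsSolution.exists_opt {lam : Labeling G} {a : ℕ} (h : lam.IsSolution a) :
    ∃ lam' : Labeling G, lam'.IsSolution a ∧ lam'.numLabels = opt G a :=
  Nat.sInf_mem (s := {k | ∃ lam : Labeling G, lam.IsSolution a ∧ lam.numLabels = k})
    ⟨_, lam, h, rfl⟩

end Labels

end MAL

/-! ## Programs with bounded loops -/

namespace MAL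

/-- Programs whose loops run over the numbers below the variable `0`. -/
inductive FProg where
  | skip
  | assign (x : ℕ) (e : Expr)
  | store (A : ℕ) (i e : Expr)
  | seq (p q : FProg)
  | ite (b : Expr) (p q : FProg)
  | forN (x : ℕ) (p : FProg)

/-- The state after `i` iterations of a loop over the variable `x`. -/
def loopState (f : State → State) (x : ℕ) (σ : State) : ℕ → State
  | 0 => σ.setVar x 0
  | i + 1 => (f (loopState f x σ i)).setVar x (i + 1)

namespace FProg

/-- The final state. -/
def eval : FProg → State → State
  | skip, σ => σ
  | assign x e, σ => σ.setVar x (e.eval σ)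
  | store A i e, σ => σ.setArr A (i.eval σ) (e.eval σ)
  | seq p q, σ => q.eval (p.eval σ)
  | ite b p q, σ => if b.eval σ ≠ 0 then p.eval σ else q.eval σ
  | forN x p, σ => loopState p.eval x σ (σ.var 0)

/-- The translation into a program of the machine. -/
def compile : FProg → Prog
  | skip => .skip
  | assign x e => .assign x e
  | store A i e => .store A i e
  | seq p q => .seq p.compile q.compile
  | ite b p q => .ite b p.compile q.compile
  | forN x p => .seq (.assign x (.const 0)) (.loop (.sub (.var 0) (.var x))
      (.seq p.compile (.assign x (.add (.var x) (.const 1)))))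

/-- Does the program contain an assignment to the variable `y`? -/
def writesVar (y : ℕ) : FProg → Bool
  | skip => false
  | assign x _ => x == y
  | store _ _ _ => false
  | seq p q => p.writesVar y || q.writesVar y
  | ite _ p q => p.writesVar y || q.writesVar y
  | forN x p => x == y || p.writesVar y

/-- Does the program contain an assignment to a cell of the array `B`? -/
def writesArr (B : ℕ) : FProg → Bool
  | skip => false
  | assign _ _ => false
  | store A _ _ => A == B
  | seq p q => p.writesArr B || q.writesArr B
  | ite _ p q => p.writesArr B || q.writesArr B
  | forN _ p => p.writesArr B

/-- Loop variables are not changed in the body of the loop. -/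
def wf : FProg → Bool
  | skip => true
  | assign _ _ => true
  | store _ _ _ => true
  | seq p q => p.wf && q.wf
  | ite _ p q => p.wf && q.wf
  | forN x p => !p.writesVar x && p.wf

/-- A bound for the number of steps. -/
noncomputable def cost : FProg → Polynomial ℕ
  | skip => 1
  | assign _ e => (e.cost + 1 : ℕ)
  | store _ i e => (i.cost + e.cost + 1 : ℕ)
  | seq p q => p.cost + q.cost
  | ite b p q => (b.cost + 1 : ℕ) + (p.cost + q.cost)
  | forN _ p => 2 + (Polynomial.X * (8 + p.cost) + 4)

end FProg

@[simp] theorem State.setVar_var_same (σ : State) (x v : ℕ) : (σ.setVar x v).var x = v := by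
  simp [State.setVar]

@[simp] theorem State.setVar_var (σ : State) (x v y : ℕ) :
    (σ.setVar x v).var y = if y = x then v else σ.var y := by
  simp [State.setVar, Function.update_apply]

@[simp] theorem State.setVar_arr (σ : State) (x v : ℕ) : (σ.setVar x v).arr = σ.arr := rfl

@[simp] theorem State.setArr_var (σ : State) (A i v : ℕ) : (σ.setArr A i v).var = σ.var := rfl

@[simp] theorem State.setArr_arr (σ : State) (A i v B j : ℕ) :
    (σ.setArr A i v).arr B j = if B = A ∧ j = i then v else σ.arr B j := by
  by_cases h : B = A
  · subst h
    simp [State.setArr, Function.update_apply]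
  · simp [State.setArr, h]

theorem loopState_var_self (f : State → State) (x : ℕ) (σ : State) (i : ℕ) :
    (loopState f x σ i).var x = i := by
  cases i <;> simp [loopState]

theorem loopState_var {f : State → State} {y : ℕ} (hf : ∀ τ, (f τ).var y = τ.var y) {x : ℕ}
    (hxy : x ≠ y) (σ : State) (i : ℕ) : (loopState f x σ i).var y = σ.var y := by
  induction i with
  | zero => simp [loopState, hxy.symm]
  | succ i ih => simp [loopState, hxy.symm, hf, ih]

theorem loopState_arr {f : State → State} {B : ℕ} (hf : ∀ τ, (f τ).arr B = τ.arr B) (x : ℕ)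
    (σ : State) (i : ℕ) : (loopState f x σ i).arr B = σ.arr B := by
  induction i with
  | zero => rfl
  | succ i ih => rw [loopState, State.setVar_arr, hf, ih]

theorem FProg.eval_var {p : FProg} {y : ℕ} (h : p.writesVar y = false) (σ : State) :
    (p.eval σ).var y = σ.var y := by
  induction p generalizing σ with
  | skip => rfl
  | assign x e =>
    have : y ≠ x := by rintro rfl; simp [writesVar] at h
    simp [eval, this]
  | store => rfl
  | seq p q ihp ihq =>
    simp only [writesVar, Bool.or_eq_false_iff] at h
    rw [eval, ihq h.2, ihp h.1]
  | ite b p q ihp ihq =>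
    simp only [writesVar, Bool.or_eq_false_iff] at h
    rw [eval]
    split_ifs
    exacts [ihp h.1 σ, ihq h.2 σ]
  | forN x p ih =>
    simp only [writesVar, Bool.or_eq_false_iff, beq_eq_false_iff_ne] at h
    exact loopState_var (ih h.2) h.1 σ _

theorem FProg.eval_arr {p : FProg} {B : ℕ} (h : p.writesArr B = false) (σ : State) :
    (p.eval σ).arr B = σ.arr B := by
  induction p generalizing σ with
  | skip => rfl
  | assign x e => rfl
  | store A i e =>
    have : B ≠ A := by rintro rfl; simp [writesArr] at h
    ext j
    simp [eval, this]
  | seq p q ihp ihq =>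
    simp only [writesArr, Bool.or_eq_false_iff] at h
    rw [eval, ihq h.2, ihp h.1]
  | ite b p q ihp ihq =>
    simp only [writesArr, Bool.or_eq_false_iff] at h
    rw [eval]
    split_ifs
    exacts [ihp h.1 σ, ihq h.2 σ]
  | forN x p ih =>
    simp only [writesArr] at h
    exact loopState_arr (ih h) x σ _

/-- Since variable `0` is never written, all loops have the same fixed number of iterations, and one
polynomial in its value bounds the time. -/
theorem FProg.exec {p : FProg} (h0 : p.writesVar 0 = false) (hwf : p.wf = true) (σ : State) :
    ∃ t, Exec p.compile σ t (p.eval σ) ∧ t ≤ p.cost.eval (σ.var 0) := by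
  induction p generalizing σ with
  | skip => exact ⟨1, .skip σ, by simp [cost]⟩
  | assign x e => exact ⟨_, .assign x e σ, by simp [cost]⟩
  | store A i e => exact ⟨_, .store A i e σ, by simp [cost]⟩
  | seq p q ihp ihq =>
    simp only [writesVar, Bool.or_eq_false_iff] at h0
    simp only [wf, Bool.and_eq_true] at hwf
    obtain ⟨s, hs, hs'⟩ := ihp h0.1 hwf.1 σ
    obtain ⟨t, ht, ht'⟩ := ihq h0.2 hwf.2 (p.eval σ)
    rw [eval_var h0.1] at ht'
    exact ⟨_, .seq hs ht, by rw [cost, Polynomial.eval_add]; omega⟩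
  | ite b p q ihp ihq =>
    simp only [writesVar, Bool.or_eq_false_iff] at h0
    simp only [wf, Bool.and_eq_true] at hwf
    have hcost : (ite b p q).cost.eval (σ.var 0) =
        b.cost + 1 + (p.cost.eval (σ.var 0) + q.cost.eval (σ.var 0)) := by
      simp only [cost, Polynomial.eval_add, Polynomial.eval_natCast, Nat.cast_id]
    by_cases hb : b.eval σ ≠ 0
    · obtain ⟨s, hs, hs'⟩ := ihp h0.1 hwf.1 σ
      refine ⟨_, ?_, (?_ : b.cost + 1 + s ≤ _)⟩
      · rw [eval, if_pos hb]; exact .ite_true hb hs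
      · rw [hcost]; omega
    · obtain ⟨s, hs, hs'⟩ := ihq h0.2 hwf.2 σ
      refine ⟨_, ?_, (?_ : b.cost + 1 + s ≤ _)⟩
      · rw [eval, if_neg hb]; exact .ite_false (not_not.1 hb) hs
      · rw [hcost]; omega
  | forN x p ih =>
    simp only [writesVar, Bool.or_eq_false_iff, beq_eq_false_iff_ne] at h0
    simp only [wf, Bool.and_eq_true, Bool.not_eq_true'] at hwf
    set n := σ.var 0 with hn
    set c := p.cost.eval n with hc
    have hvar : ∀ i, (loopState p.eval x σ i).var 0 = n := fun i =>
      loopState_var (eval_var h0.2) h0.1 σ i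
    -- With `j` iterations left: each costs 4 steps for the test and 4 for the increment besides the
    -- body, and the final failing test costs 4.
    have key : ∀ j ≤ n, ∃ t, Exec (.loop (.sub (.var 0) (.var x))
        (.seq p.compile (.assign x (.add (.var x) (.const 1))))) (loopState p.eval x σ (n - j)) t
        (loopState p.eval x σ n) ∧ t ≤ j * (8 + c) + 4 := by
      intro j
      induction j with
      | zero =>
        intro _
        exact ⟨_, .loop_false (by simp [Expr.eval, hvar, loopState_var_self]), by simp [Expr.cost]⟩
      | succ j ihj =>
        intro hj
        obtain ⟨t, ht, ht'⟩ := ihj (by omega)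
        obtain ⟨s, hs, hs'⟩ := ih h0.2 hwf.2 (loopState p.eval x σ (n - (j + 1)))
        have hstep : loopState p.eval x σ (n - j) =
            (p.eval (loopState p.eval x σ (n - (j + 1)))).setVar x
              ((Expr.add (.var x) (.const 1)).eval
                (p.eval (loopState p.eval x σ (n - (j + 1))))) := by
          rw [show n - j = n - (j + 1) + 1 by omega, loopState]
          simp only [Expr.eval]
          rw [eval_var hwf.1, loopState_var_self]
        rw [hstep] at ht
        refine ⟨_, .loop_true (by simp [Expr.eval, hvar, loopState_var_self]; omega)
          (.seq hs (.assign x _ _)) ht, ?_⟩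
        rw [hvar] at hs'
        simp only [Expr.cost]
        rw [add_mul]
        omega
    obtain ⟨t, ht, ht'⟩ := key n le_rfl
    rw [Nat.sub_self] at ht
    refine ⟨_, .seq (.assign x (.const 0) σ) ht, ?_⟩
    have : (forN x p).cost.eval n = 2 + (n * (8 + c) + 4) := by
      simp only [cost, Polynomial.eval_add, Polynomial.eval_mul, Polynomial.eval_X,
        Polynomial.eval_ofNat, hc]
    rw [this]
    simp only [Expr.cost]
    omega

theorem polynomial_eval_mono (P : Polynomial ℕ) {m n : ℕ} (h : m ≤ n) :
    P.eval m ≤ P.eval n := by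
  rw [Polynomial.eval_eq_sum_range, Polynomial.eval_eq_sum_range]
  exact Finset.sum_le_sum fun i _ => Nat.mul_le_mul_left _ (Nat.pow_le_pow_left h i)

/-- A loop preserves an invariant that may depend on the number of iterations. -/
theorem FProg.forN_induct {x : ℕ} {p : FProg} {σ : State} (I : ℕ → State → Prop)
    (hinit : I 0 (σ.setVar x 0))
    (hstep : ∀ i < σ.var 0, ∀ τ, (∀ y, (forN x p).writesVar y = false → τ.var y = σ.var y) →
      (∀ B, p.writesArr B = false → τ.arr B = σ.arr B) → τ.var x = i → I i τ →
      I (i + 1) ((p.eval τ).setVar x (i + 1))) :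
    I (σ.var 0) ((forN x p).eval σ) := by
  have key : ∀ i ≤ σ.var 0, I i (loopState p.eval x σ i) := by
    intro i
    induction i with
    | zero => exact fun _ => hinit
    | succ i ih =>
      intro hi
      refine hstep i hi _ (fun y hy => ?_) (fun B hB => loopState_arr (eval_arr hB) x σ i)
        (loopState_var_self _ _ _ _) (ih (by omega))
      simp only [writesVar, Bool.or_eq_false_iff, beq_eq_false_iff_ne] at hy
      exact loopState_var (eval_var hy.2) hy.1 σ i
  exact key _ le_rfl

end MAL

/-! ## Labelings from layered trees -/

namespace MAL

section Reach

variable {V : Type} {G : SimpleGraph V}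

/-- There is a temporal path from `v` to `w` without labels below `lo`. -/
def ReachesFrom (lam : Labeling G) (lo : ℕ) (v w : V) : Prop :=
  ∃ (p : G.Walk v w) (ts : List ℕ), p.IsPath ∧
    List.Forall₂ (fun e t => t ∈ lam.labels e) p.edges ts ∧ ts.Pairwise (· < ·) ∧ ∀ t ∈ ts, lo ≤ t

variable {lam : Labeling G} {lo lo' t : ℕ} {u v w : V}

theorem ReachesFrom.refl (lam : Labeling G) (lo : ℕ) (v : V) : ReachesFrom lam lo v v :=
  ⟨.nil, [], .nil, .nil, .nil, by simp⟩

theorem ReachesFrom.mono (h : ReachesFrom lam lo v w) (hlo : lo' ≤ lo) :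
    ReachesFrom lam lo' v w := by
  obtain ⟨p, ts, hp, hf, hts, hl⟩ := h
  exact ⟨p, ts, hp, hf, hts, fun t ht => hlo.trans (hl t ht)⟩

theorem ReachesFrom.cons (h : ReachesFrom lam (t + 1) v w) (ht : t ∈ lam.labels s(u, v)) :
    ReachesFrom lam t u w := by
  classical
  obtain ⟨p, ts, hp, hf, hts, hl⟩ := h
  -- If the path already passes through `u`, the part before `u` is discarded instead of prepending
  -- the edge; the result must be a path, not merely a walk.
  by_cases hu : u ∈ p.support
  · have he : p.edges = (p.takeUntil u hu).edges ++ (p.dropUntil u hu).edges := by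
      rw [← SimpleGraph.Walk.edges_append, SimpleGraph.Walk.take_spec]
    have hf' := List.forall₂_drop (p.takeUntil u hu).edges.length hf
    rw [he, List.drop_left] at hf'
    exact ⟨p.dropUntil u hu, _, hp.dropUntil hu, hf', hts.sublist (List.drop_sublist _ _),
      fun t' ht' => by have := hl t' (List.mem_of_mem_drop ht'); omega⟩
  · have hadj : G.Adj u v := by
      rw [← SimpleGraph.mem_edgeSet]
      by_contra hcon
      rw [lam.eq_empty _ hcon] at ht
      simp at ht
    refine ⟨.cons hadj p, t :: ts, hp.cons hu, ?_, ?_, ?_⟩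
    · rw [SimpleGraph.Walk.edges_cons]
      exact .cons ht hf
    · exact List.pairwise_cons.2 ⟨fun t' ht' => hl t' ht', hts⟩
    · intro t' ht'
      rcases List.mem_cons.1 ht' with rfl | ht'
      · exact le_rfl
      · have := hl t' ht'; omega

theorem ReachesFrom.reaches (h : ReachesFrom lam lo v w) : lam.Reaches v w := by
  obtain ⟨p, ts, hp, hf, hts, -⟩ := h
  exact ⟨p, ts, hp, hf, hts⟩

end Reach

section OfList

variable {n : ℕ} {G : SimpleGraph (Fin n)}

/-- The labeling given by a list of triples. -/
def labelingOf (L : List (ℕ × ℕ × ℕ))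
    (hL : ∀ x ∈ L, ∃ u v : Fin n, x.1 = u ∧ x.2.1 = v ∧ G.Adj u v ∧ 0 < x.2.2) : Labeling G where
  labels e := (L.toFinset.filter fun x : ℕ × ℕ × ℕ =>
    ∃ u v : Fin n, x.1 = u.val ∧ x.2.1 = v.val ∧ s(u, v) = e).image fun x => x.2.2
  eq_empty e he := by
    rw [Finset.image_eq_empty, Finset.filter_eq_empty_iff]
    rintro x hx ⟨u, v, hu, hv, rfl⟩
    obtain ⟨u', v', hu', hv', h, -⟩ := hL x (List.mem_toFinset.1 hx)
    obtain rfl : u = u' := Fin.ext (hu.symm.trans hu')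
    obtain rfl : v = v' := Fin.ext (hv.symm.trans hv')
    exact he h
  pos e t ht := by
    obtain ⟨x, hx, rfl⟩ := Finset.mem_image.1 ht
    obtain ⟨u', v', hu', hv', -, h⟩ := hL x (List.mem_toFinset.1 (Finset.mem_filter.1 hx).1)
    exact h

variable {L : List (ℕ × ℕ × ℕ)}
  {hL : ∀ x ∈ L, ∃ u v : Fin n, x.1 = u ∧ x.2.1 = v ∧ G.Adj u v ∧ 0 < x.2.2}

theorem mem_labelingOf {u v : Fin n} {t : ℕ} : t ∈ (labelingOf L hL).labels s(u, v) ↔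
    (u.val, v.val, t) ∈ L ∨ (v.val, u.val, t) ∈ L := by
  simp only [labelingOf, Finset.mem_image, Finset.mem_filter, List.mem_toFinset]
  constructor
  · rintro ⟨⟨x, y, z⟩, ⟨hx, u', v', rfl, rfl, he⟩, rfl⟩
    rcases Sym2.eq_iff.1 he with ⟨rfl, rfl⟩ | ⟨rfl, rfl⟩
    exacts [Or.inl hx, Or.inr hx]
  · rintro (h | h)
    · exact ⟨_, ⟨h, u, v, rfl, rfl, rfl⟩, rfl⟩
    · exact ⟨_, ⟨h, v, u, rfl, rfl, Sym2.eq_swap⟩, rfl⟩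

theorem numLabels_labelingOf_le : (labelingOf L hL).numLabels ≤ L.length := by
  refine le_trans (Finset.sum_le_sum fun e _ => Finset.card_image_le) ?_
  refine le_trans ?_ L.toFinset_card_le
  simp only [Finset.card_filter]
  rw [Finset.sum_comm, Finset.card_eq_sum_ones]
  refine Finset.sum_le_sum fun x _ => ?_
  rw [← Finset.card_filter, Finset.card_le_one]
  intro e he e' he'
  obtain ⟨u, v, hu, hv, rfl⟩ := (Finset.mem_filter.1 he).2
  obtain ⟨u', v', hu', hv', rfl⟩ := (Finset.mem_filter.1 he').2
  rw [Fin.ext (hu.symm.trans hu'), Fin.ext (hv.symm.trans hv')]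

theorem lifetime_labelingOf_le {a : ℕ} (ha : ∀ x ∈ L, x.2.2 ≤ a) :
    (labelingOf L hL).lifetime ≤ a := by
  refine Finset.sup_le fun e _ => Finset.sup_le fun t ht => ?_
  obtain ⟨x, hx, rfl⟩ := Finset.mem_image.1 ht
  exact ha x (List.mem_toFinset.1 (Finset.mem_filter.1 hx).1)

end OfList

/-! ### Cores and the labelings built on them -/

/-- The subgraphs in which all information is gathered, before it is distributed again. -/
inductive Core where
  | vertex
  | edge
  | cycle

namespace Core

/-- The number of rounds of calls in the core. -/
def rounds : Core → ℕ
  | vertex => 0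
  | edge => 1
  | cycle => 2

/-- The difference between twice the number of vertices and the number of calls. -/
def slack : Core → ℕ
  | vertex => 2
  | edge => 3
  | cycle => 4

/-- The vertices `p`, `q`, `r`, `s` are the vertices of a core. -/
def Valid {n : ℕ} (G : SimpleGraph (Fin n)) (p q r s : Fin n) : Core → Prop
  | vertex => p = q ∧ p = r ∧ p = s
  | edge => G.Adj p q ∧ p = r ∧ p = s
  | cycle => G.Adj p q ∧ G.Adj q r ∧ G.Adj r s ∧ G.Adj s p ∧ p ≠ r ∧ q ≠ s

/-- The calls in the core. -/
def calls (p q r s H : ℕ) : Core → List (ℕ × ℕ × ℕ)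
  | vertex => []
  | edge => [(p, q, H)]
  | cycle => [(p, q, H), (r, s, H), (q, r, H + 1), (s, p, H + 1)]

variable {n : ℕ} {G : SimpleGraph (Fin n)} {p q r s : Fin n} {κ : Core} {H : ℕ}

theorem Valid.calls_mem (h : κ.Valid G p q r s) :
    ∀ x ∈ κ.calls p q r s H, ∃ u v : Fin n, x.1 = u ∧ x.2.1 = v ∧ G.Adj u v ∧ H ≤ x.2.2 ∧
      x.2.2 + 1 ≤ H + κ.rounds := by
  intro x hx
  cases κ with
  | vertex => simp [calls] at hx
  | edge =>
    simp only [calls, List.mem_singleton] at hx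
    subst hx
    exact ⟨p, q, rfl, rfl, h.1, le_rfl, le_rfl⟩
  | cycle =>
    obtain ⟨h1, h2, h3, h4, -⟩ := h
    simp only [calls, List.mem_cons, List.not_mem_nil, or_false] at hx
    rcases hx with rfl | rfl | rfl | rfl
    · exact ⟨p, q, rfl, rfl, h1, le_rfl, by simp [rounds]⟩
    · exact ⟨r, s, rfl, rfl, h3, le_rfl, by simp [rounds]⟩
    · exact ⟨q, r, rfl, rfl, h2, by simp, by simp [rounds]⟩
    · exact ⟨s, p, rfl, rfl, h4, by simp, by simp [rounds]⟩

theorem Valid.length_calls (h : κ.Valid G p q r s) :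
    (κ.calls p q r s H).length + κ.slack = 2 * ({p, q, r, s} : Finset (Fin n)).card := by
  cases κ with
  | vertex => obtain ⟨rfl, rfl, rfl⟩ := h; simp [calls, slack]
  | edge =>
    obtain ⟨h, rfl, rfl⟩ := h
    have : ({p, q, p, p} : Finset (Fin n)) = {p, q} := by ext; simp; tauto
    rw [this, Finset.card_pair h.ne]
    simp [calls, slack]
  | cycle =>
    obtain ⟨h1, h2, h3, h4, h5, h6⟩ := h
    rw [Finset.card_insert_of_notMem (by simp [h1.ne, h5, h4.ne.symm]),
        Finset.card_insert_of_notMem (by simp [h2.ne, h6]), Finset.card_pair h3.ne]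
    simp [calls, slack]

/-- All vertices of the core share their information during its rounds, so a continuation from any
of them is available to all. -/
theorem Valid.reachesFrom (h : κ.Valid G p q r s) {lam : Labeling G}
    (hlam : ∀ u v : Fin n, ∀ t, (u.val, v.val, t) ∈ κ.calls p q r s H → t ∈ lam.labels s(u, v))
    {c c' x : Fin n} (hc : c ∈ ({p, q, r, s} : Finset (Fin n)))
    (hc' : c' ∈ ({p, q, r, s} : Finset (Fin n))) (hx : ReachesFrom lam (H + κ.rounds) c' x) :
    ReachesFrom lam H c x := by
  simp only [Finset.mem_insert, Finset.mem_singleton] at hc hc'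
  cases κ with
  | vertex =>
    obtain ⟨rfl, rfl, rfl⟩ := h
    obtain rfl : c = p := by tauto
    obtain rfl : c' = c := by tauto
    exact hx
  | edge =>
    obtain ⟨h, rfl, rfl⟩ := h
    have h1 := hlam p q H (by simp [calls])
    have h2 : H ∈ lam.labels s(q, p) := by rwa [Sym2.eq_swap]
    simp only [rounds] at hx
    obtain rfl | rfl : c = p ∨ c = q := by tauto
    · obtain rfl | rfl : c' = c ∨ c' = q := by tauto
      exacts [hx.mono (by omega), hx.cons h1]
    · obtain rfl | rfl : c' = p ∨ c' = c := by tauto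
      exacts [hx.cons h2, hx.mono (by omega)]
  | cycle =>
    simp only [rounds] at hx
    have pq := hlam p q H (by simp [calls])
    have rs := hlam r s H (by simp [calls])
    have qr := hlam q r (H + 1) (by simp [calls])
    have sp := hlam s p (H + 1) (by simp [calls])
    have qp : H ∈ lam.labels s(q, p) := by rwa [Sym2.eq_swap]
    have sr : H ∈ lam.labels s(s, r) := by rwa [Sym2.eq_swap]
    have rq : H + 1 ∈ lam.labels s(r, q) := by rwa [Sym2.eq_swap]
    have ps : H + 1 ∈ lam.labels s(p, s) := by rwa [Sym2.eq_swap]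
    have hm := hx.mono (lo' := H + 1) (by omega)
    -- The second round makes `c'` accessible from both ends of `qr` or from both ends of `sp`.
    -- Every vertex of the core belongs to this pair or calls one of its vertices in the first
    -- round.
    have hcase : (ReachesFrom lam (H + 1) q x ∧ ReachesFrom lam (H + 1) r x) ∨
        (ReachesFrom lam (H + 1) p x ∧ ReachesFrom lam (H + 1) s x) := by
      rcases hc' with rfl | rfl | rfl | rfl
      · exact Or.inr ⟨hm, hx.cons sp⟩
      · exact Or.inl ⟨hm, hx.cons rq⟩
      · exact Or.inl ⟨hx.cons qr, hm⟩
      · exact Or.inr ⟨hx.cons ps, hm⟩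
    rcases hcase with ⟨a1, a2⟩ | ⟨a1, a2⟩ <;> rcases hc with rfl | rfl | rfl | rfl
    exacts [a1.cons pq, a1.mono (by omega), a2.mono (by omega), a2.cons sr,
      a1.mono (by omega), a1.cons qp, a2.cons rs, a2.mono (by omega)]

end Core

/-- The vertices in `S` are the roots of trees, with `Par v` as the parent of `v`, if `D v` is at
most `n`, and `D` decreases along the way to the root. -/
structure Layers {n : ℕ} (G : SimpleGraph (Fin n)) (S : Finset (Fin n)) (D Par : ℕ → ℕ) : Prop where
  pos : ∀ v : Fin n, 1 ≤ D v
  one : ∀ v : Fin n, D v = 1 ↔ v ∈ S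
  par : ∀ v : Fin n, 1 < D v → D v ≤ n → ∃ u : Fin n, Par v = u ∧ G.Adj v u ∧ D u < D v

/-- The two calls between `v` and its parent. -/
def treeCalls (k H : ℕ) (D Par : ℕ → ℕ) (v : ℕ) : List (ℕ × ℕ × ℕ) :=
  if D v - 1 ≠ 0 then [(v, Par v, H + 1 - D v), (v, Par v, H + D v + k - 2)] else []

theorem length_flatMap_treeCalls {n : ℕ} {G : SimpleGraph (Fin n)} {S : Finset (Fin n)}
    {D Par : ℕ → ℕ} (h : Layers G S D Par) (k H : ℕ) :
    ((List.range n).flatMap (treeCalls k H D Par)).length + 2 * S.card = 2 * n := by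
  have h1 : ∀ m, ((List.range m).flatMap (treeCalls k H D Par)).length =
      ∑ v ∈ Finset.range m, if D v - 1 ≠ 0 then 2 else 0 := by
    intro m
    induction m with
    | zero => simp
    | succ m ih =>
      rw [List.range_succ, List.flatMap_append, List.length_append, ih, Finset.sum_range_succ]
      simp only [List.flatMap_singleton, treeCalls]
      split_ifs <;> simp
  have h2 : 2 * S.card = ∑ v : Fin n, if v ∈ S then 2 else 0 := by
    rw [← Finset.sum_filter, Finset.sum_const, Finset.filter_mem_eq_inter, Finset.univ_inter,
      smul_eq_mul, mul_comm]
  rw [h1, Finset.sum_range, h2, ← Finset.sum_add_distrib]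
  rw [Finset.sum_congr rfl (g := fun _ => 2)]
  · simp [mul_comm]
  · intro v _
    have := h.pos v
    by_cases hv : v ∈ S
    · rw [if_pos hv, if_neg (by have := (h.one v).2 hv; omega)]
    · rw [if_neg hv, if_pos (by have := mt (h.one v).1 hv; omega)]

/-- A vertex with value `D v` calls its parent at time `H + 1 - D v` on the way in and at `H + D v +
κ.rounds - 2` on the way out, with the times from `H` to `H + κ.rounds - 1` for the core in between.
As `D` decreases towards the core, the times increase along every route; none exceeds `2 * H +
κ.rounds - 2`. -/
theorem Layers.exists_solution {n : ℕ} {G : SimpleGraph (Fin n)} {p q r s : Fin n} {κ : Core}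
    {D Par : ℕ → ℕ} (h : Layers G {p, q, r, s} D Par) (hκ : κ.Valid G p q r s) {H a : ℕ}
    (hH : ∀ v : Fin n, D v ≤ H) (hn : ∀ v : Fin n, D v ≤ n) (ha : 2 * H + κ.rounds ≤ a + 2)
    {L : List (ℕ × ℕ × ℕ)}
    (hL : L = κ.calls p q r s H ++ (List.range n).flatMap (treeCalls κ.rounds H D Par)) :
    ∃ lam : Labeling G, (∀ u v : Fin n, ∀ t, t ∈ lam.labels s(u, v) ↔
        (u.val, v.val, t) ∈ L ∨ (v.val, u.val, t) ∈ L) ∧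
      (∀ x ∈ L, ∃ u v : Fin n, x.1 = u ∧ x.2.1 = v) ∧
      lam.IsSolution a ∧ lam.numLabels + κ.slack ≤ 2 * n := by
  have hp1 : D p = 1 := (h.one p).2 (by simp)
  have hH1 := hH p
  have hmem : ∀ x ∈ L, ∃ u v : Fin n, x.1 = u ∧ x.2.1 = v ∧ G.Adj u v ∧ 0 < x.2.2 ∧ x.2.2 ≤ a := by
    intro x hx
    rw [hL, List.mem_append, List.mem_flatMap] at hx
    rcases hx with hx | ⟨v, hv, hx⟩
    · obtain ⟨u, v, hu, hv, hadj, h1, h2⟩ := hκ.calls_mem x hx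
      exact ⟨u, v, hu, hv, hadj, by omega, by omega⟩
    · rw [List.mem_range] at hv
      rw [treeCalls] at hx
      split_ifs at hx with hD
      · obtain ⟨u, hu, hadj, hlt⟩ := h.par ⟨v, hv⟩ (by simp only; omega) (hn _)
        have h1 := hH ⟨v, hv⟩
        have h2 := h.pos u
        simp only at hu hlt h1
        simp only [List.mem_cons, List.not_mem_nil, or_false] at hx
        rcases hx with rfl | rfl
        · exact ⟨⟨v, hv⟩, u, rfl, hu, hadj, by simp only; omega, by simp only; omega⟩
        · exact ⟨⟨v, hv⟩, u, rfl, hu, hadj, by simp only; omega, by simp only; omega⟩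
      · simp at hx
  have hL' : ∀ x ∈ L, ∃ u v : Fin n, x.1 = u ∧ x.2.1 = v ∧ G.Adj u v ∧ 0 < x.2.2 := fun x hx => by
    obtain ⟨u, v, h1, h2, h3, h4, -⟩ := hmem x hx
    exact ⟨u, v, h1, h2, h3, h4⟩
  set lam := labelingOf L hL' with hlam
  have hcore : ∀ u v : Fin n, ∀ t, (u.val, v.val, t) ∈ κ.calls p q r s H →
      t ∈ lam.labels s(u, v) := by
    intro u v t ht
    rw [hlam, mem_labelingOf, hL]
    exact Or.inl (List.mem_append_left _ ht)
  have htree : ∀ v : Fin n, v ∉ ({p, q, r, s} : Finset (Fin n)) → ∃ u : Fin n, D u < D v ∧ 1 ≤ D u ∧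
      H + 1 - D v ∈ lam.labels s(v, u) ∧ H + D v + κ.rounds - 2 ∈ lam.labels s(v, u) := by
    intro v hv
    have h1 := h.pos v
    have h2 := mt (h.one v).1 hv
    obtain ⟨u, hu, hadj, hlt⟩ := h.par v (by omega) (hn v)
    have hcalls : treeCalls κ.rounds H D Par v =
        [(v.val, u.val, H + 1 - D v), (v.val, u.val, H + D v + κ.rounds - 2)] := by
      rw [treeCalls, if_pos (by omega), hu]
    have hin : ∀ x ∈ treeCalls κ.rounds H D Par v, x ∈ L := by
      intro x hx
      rw [hL]
      exact List.mem_append_right _ (List.mem_flatMap.2 ⟨v, List.mem_range.2 v.2, hx⟩)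
    rw [hcalls] at hin
    refine ⟨u, hlt, h.pos u, ?_, ?_⟩ <;> rw [hlam, mem_labelingOf] <;> left <;>
      exact hin _ (by simp)
  -- The way out is built from its end: calls towards the target are prepended until the core is
  -- reached.
  have hdown : ∀ d, ∀ w x : Fin n, D w = d → ReachesFrom lam (H + D w + κ.rounds - 1) w x →
      ∃ c ∈ ({p, q, r, s} : Finset (Fin n)), ReachesFrom lam (H + κ.rounds) c x := by
    intro d
    induction d using Nat.strong_induction_on with
    | _ d ih =>
      rintro w x rfl hw
      by_cases hS : w ∈ ({p, q, r, s} : Finset (Fin n))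
      · have := (h.one w).2 hS
        exact ⟨w, hS, hw.mono (by omega)⟩
      · obtain ⟨u, hu, hu1, -, hlab⟩ := htree w hS
        rw [Sym2.eq_swap] at hlab
        refine ih _ hu u x rfl (ReachesFrom.mono (ReachesFrom.cons (hw.mono ?_) hlab) ?_) <;> omega
  have hup : ∀ d, ∀ v x : Fin n, D v = d →
      (∀ c ∈ ({p, q, r, s} : Finset (Fin n)), ReachesFrom lam H c x) →
      ReachesFrom lam (H + 1 - D v) v x := by
    intro d
    induction d using Nat.strong_induction_on with
    | _ d ih =>
      rintro v x rfl hc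
      by_cases hS : v ∈ ({p, q, r, s} : Finset (Fin n))
      · have := (h.one v).2 hS
        exact (hc v hS).mono (by omega)
      · obtain ⟨u, hu, hu1, hlab, -⟩ := htree v hS
        have := hH v
        exact ReachesFrom.cons ((ih _ hu u x rfl hc).mono (by omega)) hlab
  refine ⟨lam, fun u v t => mem_labelingOf, fun x hx => ?_, ⟨?_, ?_⟩, ?_⟩
  · obtain ⟨u, v, h1, h2, -⟩ := hmem x hx
    exact ⟨u, v, h1, h2⟩
  · intro v w _
    obtain ⟨c', hc', hr⟩ := hdown _ w w rfl (ReachesFrom.refl _ _ _)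
    exact (hup _ v w rfl fun c hc => hκ.reachesFrom hcore hc hc' hr).reaches
  · exact lifetime_labelingOf_le fun x hx => by
      obtain ⟨u, v, -, -, -, -, h5⟩ := hmem x hx
      exact h5
  · have h1 : lam.numLabels ≤ L.length := numLabels_labelingOf_le
    have h2 := length_flatMap_treeCalls h κ.rounds H
    have h3 := hκ.length_calls (H := H)
    have h4 : L.length = _ := congrArg List.length hL
    rw [List.length_append] at h4
    omega

end MAL

/-! ## The algorithm -/

namespace MAL

/-- The entry of the adjacency matrix in row `x` and column `y`. -/
def adjExpr (x y : ℕ) : Expr := .read 0 (.add (.read 4 (.var x)) (.var y))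

/-- The distance of two numbers. -/
def diffExpr (x y : ℕ) : Expr := .add (.sub (.var x) (.var y)) (.sub (.var y) (.var x))

/-- Array `4` contains the positions of the rows of the adjacency matrix. -/
def prelude : FProg :=
  .forN 9 (.seq (.store 4 (.var 9) (.var 12)) (.assign 12 (.add (.var 12) (.var 0))))

/-- Initialization of the distances to the core. -/
def initDist : FProg :=
  .seq (.forN 10 (.store 5 (.var 10) (.add (.var 0) (.const 1))))
    (.seq (.store 5 (.var 3) (.const 1)) (.seq (.store 5 (.var 4) (.const 1))
      (.seq (.store 5 (.var 5) (.const 1)) (.store 5 (.var 6) (.const 1)))))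

/-- Update of a distance. -/
def relaxStep : FProg :=
  .ite (adjExpr 9 10)
    (.ite (.sub (.read 5 (.var 10)) (.add (.read 5 (.var 9)) (.const 1)))
      (.seq (.store 6 (.var 10) (.var 9))
        (.store 5 (.var 10) (.add (.read 5 (.var 9)) (.const 1)))) .skip) .skip

/-- Computation of the distances to the core. -/
def relaxAll : FProg := .forN 8 (.forN 9 (.forN 10 relaxStep))

/-- Computation of the largest distance. -/
def maxDist : FProg :=
  .seq (.assign 11 (.const 0))
    (.forN 10 (.assign 11 (.add (.var 11) (.sub (.read 5 (.var 10)) (.var 11)))))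

/-- Output of a triple. -/
def emit (x y t : Expr) : FProg :=
  .seq (.store 1 (.var 2) x) (.seq (.store 2 (.var 2) y) (.seq (.store 3 (.var 2) t)
    (.assign 2 (.add (.var 2) (.const 1)))))

/-- Output of the calls in the core. -/
def Core.output : Core → FProg
  | vertex => .skip
  | edge => emit (.var 3) (.var 4) (.var 11)
  | cycle => .seq (emit (.var 3) (.var 4) (.var 11)) (.seq (emit (.var 5) (.var 6) (.var 11))
      (.seq (emit (.var 4) (.var 5) (.add (.var 11) (.const 1)))
        (emit (.var 6) (.var 3) (.add (.var 11) (.const 1)))))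

/-- Output of the calls outside the core. -/
def treeOutput (κ : Core) : FProg :=
  .forN 10 (.ite (.sub (.read 5 (.var 10)) (.const 1))
    (.seq (emit (.var 10) (.read 6 (.var 10))
        (.sub (.add (.var 11) (.const 1)) (.read 5 (.var 10))))
      (emit (.var 10) (.read 6 (.var 10))
        (.sub (.add (.add (.var 11) (.read 5 (.var 10))) (.const κ.rounds)) (.const 2)))) .skip)

/-- The test whether the lifetime suffices. -/
def testExpr (κ : Core) : Expr :=
  .sub (.add (.var 1) (.const 3)) (.add (.add (.var 11) (.var 11)) (.const κ.rounds))

/-- The test whether four vertices are the vertices of a core. -/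
def Core.cond : Core → Expr
  | vertex => .sub (.const 1) (.add (diffExpr 3 4) (.add (diffExpr 3 5) (diffExpr 3 6)))
  | edge => .sub (adjExpr 3 4) (.add (diffExpr 3 5) (diffExpr 3 6))
  | cycle => .sub
      (.sub (.add (.add (adjExpr 3 4) (adjExpr 4 5)) (.add (adjExpr 5 6) (adjExpr 6 3))) (.const 3))
      (.add (.sub (.const 1) (diffExpr 3 5)) (.sub (.const 1) (diffExpr 4 6)))

/-- Computation of the labeling for a given core. -/
def attempt (κ : Core) : FProg :=
  .seq initDist (.seq relaxAll (.seq maxDist (.ite (testExpr κ)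
    (.seq κ.output (.seq (treeOutput κ) (.assign 7 (.const κ.slack)))) .skip)))

/-- Search for a core. -/
def search (κ : Core) : FProg :=
  .forN 3 (.forN 4 (.forN 5 (.forN 6 (.ite (.var 7) .skip (.ite κ.cond (attempt κ) .skip)))))

variable {n : ℕ} {G : SimpleGraph (Fin n)} {a : ℕ} {σ τ : State} {κ : Core} {p q r s : Fin n}

open Classical in
/-- The memory contains the instance and the positions of the rows of the adjacency matrix. -/
structure Env (G : SimpleGraph (Fin n)) (a : ℕ) (σ : State) : Prop where
  var0 : σ.var 0 = n
  var1 : σ.var 1 = a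
  arr0 : ∀ u v : Fin n, σ.arr 0 (u * n + v) = if G.Adj u v then 1 else 0
  arr4 : ∀ u : Fin n, σ.arr 4 u = u * n

theorem Env.congr (h : Env G a σ) (h0 : τ.var 0 = σ.var 0) (h1 : τ.var 1 = σ.var 1)
    (h2 : τ.arr 0 = σ.arr 0) (h3 : τ.arr 4 = σ.arr 4) : Env G a τ :=
  ⟨h0.trans h.var0, h1.trans h.var1, fun u v => by rw [h2]; exact h.arr0 u v,
    fun u => by rw [h3]; exact h.arr4 u⟩

theorem Env.eval (h : Env G a σ) {P : FProg} (h0 : P.writesVar 0 = false)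
    (h1 : P.writesVar 1 = false) (h2 : P.writesArr 0 = false) (h3 : P.writesArr 4 = false) :
    Env G a (P.eval σ) :=
  h.congr (P.eval_var h0 σ) (P.eval_var h1 σ) (P.eval_arr h2 σ) (P.eval_arr h3 σ)

theorem Env.adjExpr (h : Env G a σ) {x y : ℕ} {u v : Fin n} (hx : σ.var x = u) (hy : σ.var y = v)
    [Decidable (G.Adj u v)] : (adjExpr x y).eval σ = if G.Adj u v then 1 else 0 := by
  simp only [MAL.adjExpr, Expr.eval, hx, hy, h.arr4, h.arr0]
  congr

/-- The machine cannot multiply, so the offsets `u * n` of the rows are tabulated by repeated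
addition in variable `12`. -/
theorem prelude_spec (G : SimpleGraph (Fin n)) (a : ℕ) : Env G a (prelude.eval (inputState G a)) := by
  have hvar : (prelude.eval (inputState G a)).var 0 = n := FProg.eval_var rfl _
  refine ⟨hvar, FProg.eval_var rfl _, fun u v => ?_, fun u => ?_⟩
  · rw [FProg.eval_arr rfl]
    simp only [inputState]
    congr 1
    rw [eq_iff_iff]
    refine ⟨?_, fun h => ⟨rfl, u, v, rfl, h⟩⟩
    rintro ⟨-, i, j, hij, h⟩
    have hn : 0 < n := u.pos
    have h1 := congrArg (· / n) hij
    have h2 := congrArg (· % n) hij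
    simp only [mul_comm _ n, Nat.mul_add_div hn, Nat.mul_add_mod, Nat.div_eq_of_lt v.2,
      Nat.div_eq_of_lt j.2, Nat.mod_eq_of_lt v.2, Nat.mod_eq_of_lt j.2,
      add_zero] at h1 h2
    rwa [Fin.ext h1, Fin.ext h2]
  · have := FProg.forN_induct (x := 9)
      (p := .seq (.store 4 (.var 9) (.var 12)) (.assign 12 (.add (.var 12) (.var 0))))
      (σ := inputState G a) (fun i τ => τ.var 12 = i * n ∧ ∀ u < i, τ.arr 4 u = u * n)
      ⟨by simp [inputState], by simp⟩ ?_
    · exact this.2 u u.2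
    · rintro i - τ hv - hx ⟨h1, h2⟩
      have h0 : τ.var 0 = n := hv 0 rfl
      refine ⟨by simp [FProg.eval, Expr.eval, h1, h0, add_mul], fun u hu => ?_⟩
      simp only [FProg.eval, Expr.eval, State.setVar_arr, State.setArr_arr, hx, h1, true_and]
      split_ifs with h
      · rw [h]
      · exact h2 u (by omega)

/-- Truncated subtraction serves as logic: a difference is 0 exactly for equal numbers, and four
adjacency bits minus 3 are nonzero exactly if all four bits are 1. -/
theorem Core.cond_spec (h : Env G a σ) (hp : σ.var 3 = p) (hq : σ.var 4 = q) (hr : σ.var 5 = r)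
    (hs : σ.var 6 = s) : κ.cond.eval σ ≠ 0 ↔ κ.Valid G p q r s := by
  classical
  cases κ with
  | vertex =>
    simp only [cond, Valid, diffExpr, Expr.eval, hp, hq, hr, hs, Fin.ext_iff]
    omega
  | edge =>
    simp only [cond, Valid, Expr.eval, h.adjExpr hp hq]
    simp only [diffExpr, Expr.eval, hp, hr, hs, Fin.ext_iff]
    split_ifs with h1 <;> simp only [h1, true_and, false_and, iff_false, ne_eq, not_not] <;> omega
  | cycle =>
    simp only [cond, Valid, Expr.eval, h.adjExpr hp hq, h.adjExpr hq hr, h.adjExpr hr hs,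
      h.adjExpr hs hp]
    simp only [diffExpr, Expr.eval, hp, hq, hr, hs, ne_eq, Fin.ext_iff]
    by_cases h1 : G.Adj p q <;> by_cases h2 : G.Adj q r <;> by_cases h3 : G.Adj r s <;>
      by_cases h4 : G.Adj s p <;>
      simp only [h1, h2, h3, h4, if_true, if_false, true_and, false_and, and_false, iff_false,
        not_not] <;> omega

/-- The values are distances plus one, so that core vertices have 1; the value `n + 1` means that no
parent is known. -/
theorem initDist_spec (h : Env G a σ) (hp : σ.var 3 = p) (hq : σ.var 4 = q) (hr : σ.var 5 = r)
    (hs : σ.var 6 = s) (v : Fin n) : (initDist.eval σ).arr 5 v =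
      if v ∈ ({p, q, r, s} : Finset (Fin n)) then 1 else n + 1 := by
  have h1 := FProg.forN_induct (x := 10) (p := .store 5 (.var 10) (.add (.var 0) (.const 1)))
    (σ := σ) (fun i τ => ∀ u < i, τ.arr 5 u = n + 1) (by simp) (by
      intro i _ τ hv _ hx hI u hu
      have h0 : τ.var 0 = n := (hv 0 rfl).trans h.var0
      simp only [FProg.eval, Expr.eval, State.setVar_arr, State.setArr_arr, hx, h0, true_and]
      split_ifs with h
      · rfl
      · exact hI u (by omega)) v (by rw [h.var0]; exact v.2)
  set σ' := (FProg.forN 10 (.store 5 (.var 10) (.add (.var 0) (.const 1)))).eval σ with hσ'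
  have e3 : σ'.var 3 = p := (FProg.eval_var rfl σ).trans hp
  have e4 : σ'.var 4 = q := (FProg.eval_var rfl σ).trans hq
  have e5 : σ'.var 5 = r := (FProg.eval_var rfl σ).trans hr
  have e6 : σ'.var 6 = s := (FProg.eval_var rfl σ).trans hs
  rw [initDist, FProg.eval, ← hσ']
  simp only [FProg.eval, Expr.eval, State.setArr_var, State.setArr_arr, e3, e4, e5, e6, true_and,
    Finset.mem_insert, Finset.mem_singleton, h1, Fin.ext_iff]
  split_ifs <;> first | rfl | (exfalso; omega)

/-- Lowering the value of `v` keeps it below the values of its children, and its new parent `u` has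
a value smaller by exactly one. -/
theorem Layers.relax {S : Finset (Fin n)} {D Par D' Par' : ℕ → ℕ} (h : Layers G S D Par)
    {u v : Fin n} (hadj : G.Adj u v) (hlt : D u + 1 < D v)
    (hD : ∀ x, D' x = if x = v.val then D u + 1 else D x)
    (hP : ∀ x, Par' x = if x = v.val then u.val else Par x) : Layers G S D' Par' where
  pos x := by
    rw [hD]
    split_ifs
    · omega
    · exact h.pos x
  one x := by
    rw [hD]
    split_ifs with hx
    · have hu := h.pos u
      have hxv : x = v := Fin.ext hx
      subst hxv
      have := mt (h.one x).2 (by omega)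
      simp only [this, iff_false]
      omega
    · exact h.one x
  par x := by
    simp only [hD, hP]
    have huv : u.val ≠ v.val := fun h => by rw [h] at hlt; omega
    by_cases hx : x.val = v.val
    · obtain rfl : x = v := Fin.ext hx
      intro h1 h2
      refine ⟨u, by simp, hadj.symm, ?_⟩
      rw [if_neg huv, if_pos rfl]
      omega
    · rw [if_neg hx, if_neg hx]
      intro h1 h2
      obtain ⟨w, hw, hadj', hlt'⟩ := h.par x h1 h2
      refine ⟨w, hw, hadj', ?_⟩
      split_ifs with hwv
      · rw [hwv] at hlt'; omega
      · exact hlt'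

/-- The arrays `5` and `6` contain upper bounds for the distances from `S` and parents. -/
structure Tree (G : SimpleGraph (Fin n)) (S : Finset (Fin n)) (σ : State) : Prop where
  layers : Layers G S (σ.arr 5) (σ.arr 6)
  le : ∀ v : Fin n, σ.arr 5 v ≤ n + 1

variable {S : Finset (Fin n)}

theorem relaxStep_spec (h : Env G a σ) (ht : Tree G S σ) {u v : Fin n} (hu : σ.var 9 = u)
    (hv : σ.var 10 = v) : Tree G S (relaxStep.eval σ) ∧
      (∀ x, (relaxStep.eval σ).arr 5 x ≤ σ.arr 5 x) ∧
      (G.Adj u v → (relaxStep.eval σ).arr 5 v ≤ σ.arr 5 u + 1) := by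
  classical
  simp only [relaxStep, FProg.eval, h.adjExpr hu hv]
  by_cases hadj : G.Adj u v
  · simp only [hadj, if_true, ne_eq, one_ne_zero, not_false_eq_true, true_implies]
    simp only [Expr.eval, hu, hv]
    by_cases hlt : σ.arr 5 v - (σ.arr 5 u + 1) = 0
    · simp only [hlt, not_true_eq_false, if_false]
      exact ⟨ht, fun _ => le_rfl, by omega⟩
    · simp only [hlt, not_false_eq_true, if_true, State.setArr_var, State.setArr_arr, hu, hv]
      refine ⟨⟨ht.layers.relax hadj (by omega) ?_ ?_, ?_⟩, ?_, ?_⟩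
      · intro x; simp
      · intro x; simp
      · intro x
        have := ht.le x
        have := ht.le v
        simp only [State.setArr_arr, Nat.reduceEqDiff, false_and, if_false, true_and]
        split_ifs <;> omega
      · intro x
        simp only [Nat.reduceEqDiff, false_and, if_false, true_and]
        split_ifs with hx
        · rw [hx]; omega
        · exact le_rfl
      · simp
  · simp only [hadj, if_false, ne_eq, not_true_eq_false, false_implies]
    exact ⟨ht, fun _ => le_rfl, trivial⟩

theorem relaxRow_spec (h : Env G a σ) (ht : Tree G S σ) {u : Fin n} (hu : σ.var 9 = u) :
    Tree G S ((FProg.forN 10 relaxStep).eval σ) ∧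
      (∀ x, ((FProg.forN 10 relaxStep).eval σ).arr 5 x ≤ σ.arr 5 x) ∧
      ∀ v, G.Adj u v → ((FProg.forN 10 relaxStep).eval σ).arr 5 v ≤ σ.arr 5 u + 1 := by
  have := FProg.forN_induct (x := 10) (p := relaxStep) (σ := σ) (fun i τ => Tree G S τ ∧
    (∀ x, τ.arr 5 x ≤ σ.arr 5 x) ∧ ∀ v : Fin n, v < i → G.Adj u v → τ.arr 5 v ≤ σ.arr 5 u + 1)
    ⟨⟨ht.layers, ht.le⟩, fun _ => le_rfl, by simp⟩ ?_
  · obtain ⟨h1, h2, h3⟩ := this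
    exact ⟨h1, h2, fun v => h3 v (by rw [h.var0]; exact v.2)⟩
  · rintro i hi τ hv ha hx ⟨h1, h2, h3⟩
    rw [h.var0] at hi
    obtain ⟨e1, e2, e3⟩ := relaxStep_spec (u := u) (v := ⟨i, hi⟩)
      (h.congr (hv 0 rfl) (hv 1 rfl) (ha 0 rfl) (ha 4 rfl)) h1 ((hv 9 rfl).trans hu) hx
    refine ⟨⟨e1.layers, e1.le⟩, fun x => (e2 x).trans (h2 x), fun v hvi hadj => ?_⟩
    by_cases hvi' : v.val = i
    · obtain rfl : v = ⟨i, hi⟩ := Fin.ext hvi'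
      exact (e3 hadj).trans (by have := h2 u; omega)
    · exact (e2 v).trans (h3 v (by omega) hadj)

theorem relaxRound_spec (h : Env G a σ) (ht : Tree G S σ) :
    Tree G S ((FProg.forN 9 (.forN 10 relaxStep)).eval σ) ∧
      ∀ u v, G.Adj u v →
        ((FProg.forN 9 (.forN 10 relaxStep)).eval σ).arr 5 v ≤ σ.arr 5 u + 1 := by
  have := FProg.forN_induct (x := 9) (p := .forN 10 relaxStep) (σ := σ) (fun i τ => Tree G S τ ∧
    (∀ x, τ.arr 5 x ≤ σ.arr 5 x) ∧
      ∀ u v : Fin n, u < i → G.Adj u v → τ.arr 5 v ≤ σ.arr 5 u + 1)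
    ⟨⟨ht.layers, ht.le⟩, fun _ => le_rfl, by simp⟩ ?_
  · obtain ⟨h1, h2, h3⟩ := this
    exact ⟨h1, fun u v => h3 u v (by rw [h.var0]; exact u.2)⟩
  · rintro i hi τ hv ha hx ⟨h1, h2, h3⟩
    rw [h.var0] at hi
    obtain ⟨e1, e2, e3⟩ := relaxRow_spec (u := ⟨i, hi⟩)
      (h.congr (hv 0 rfl) (hv 1 rfl) (ha 0 rfl) (ha 4 rfl)) h1 hx
    refine ⟨⟨e1.layers, e1.le⟩, fun x => (e2 x).trans (h2 x), fun u v hui hadj => ?_⟩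
    by_cases hui' : u.val = i
    · obtain rfl : u = ⟨i, hi⟩ := Fin.ext hui'
      exact (e3 v hadj).trans (by have := h2 i; simp only; omega)
    · exact (e2 v).trans (h3 u v (by omega) hadj)

/-- After `i` rounds of relaxation, every walk to `S` of length at most `i` has been taken into
account. Only upper bounds are needed, not that the values are the distances. -/
theorem relaxAll_spec (h : Env G a σ) (ht : Tree G S σ) : Tree G S (relaxAll.eval σ) ∧
    ∀ (v c : Fin n) (w : G.Walk v c), c ∈ S → w.length ≤ n →
      (relaxAll.eval σ).arr 5 v ≤ w.length + 1 := by
  have := FProg.forN_induct (x := 8) (p := .forN 9 (.forN 10 relaxStep)) (σ := σ)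
    (fun i τ => Tree G S τ ∧ ∀ (v c : Fin n) (w : G.Walk v c), c ∈ S → w.length ≤ i →
      τ.arr 5 v ≤ w.length + 1) ⟨⟨ht.layers, ht.le⟩, ?_⟩ ?_
  · rwa [h.var0] at this
  · intro v c w hc hw
    cases w with
    | nil => exact ((ht.layers.one v).2 hc).le
    | cons => simp at hw
  · rintro i hi τ hv ha hx ⟨h1, h2⟩
    obtain ⟨e1, e2⟩ := relaxRound_spec (h.congr (hv 0 rfl) (hv 1 rfl) (ha 0 rfl) (ha 4 rfl)) h1
    refine ⟨⟨e1.layers, e1.le⟩, fun v c w hc hw => ?_⟩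
    cases w with
    | nil => exact ((e1.layers.one v).2 hc).le
    | @cons _ u _ hadj w =>
      rw [SimpleGraph.Walk.length_cons] at hw ⊢
      have := h2 u c w hc (by omega)
      exact (e2 u v hadj.symm).trans (by omega)

/-- With truncated subtraction, `x + (y - x)` is the maximum of `x` and `y`. -/
theorem maxDist_spec (h : Env G a σ) : (∀ v : Fin n, σ.arr 5 v ≤ (maxDist.eval σ).var 11) ∧
    ∀ B, (∀ v : Fin n, σ.arr 5 v ≤ B) → (maxDist.eval σ).var 11 ≤ B := by
  have := FProg.forN_induct (x := 10)
    (p := .assign 11 (.add (.var 11) (.sub (.read 5 (.var 10)) (.var 11)))) (σ := σ.setVar 11 0)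
    (fun i τ => (∀ v : Fin n, v < i → σ.arr 5 v ≤ τ.var 11) ∧
      ∀ B, (∀ v : Fin n, σ.arr 5 v ≤ B) → τ.var 11 ≤ B) ⟨by simp, by simp⟩ ?_
  · obtain ⟨h1, h2⟩ := this
    exact ⟨fun v => h1 v (by simp [h.var0]), h2⟩
  · rintro i hi τ hv ha hx ⟨h1, h2⟩
    have h5 : τ.arr 5 = σ.arr 5 := ha 5 rfl
    have hval : ((FProg.assign 11 (.add (.var 11) (.sub (.read 5 (.var 10)) (.var 11)))).eval
        τ).var 11 = τ.var 11 + (σ.arr 5 i - τ.var 11) := by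
      simp [FProg.eval, Expr.eval, hx, h5]
    have hi' : i < n := by simpa [h.var0] using hi
    refine ⟨fun v hvi => ?_, fun B hB => ?_⟩ <;>
      rw [State.setVar_var, if_neg (by decide), hval]
    · by_cases hvi' : v.val = i
      · rw [hvi']; omega
      · have := h1 v (by omega); omega
    · have := h2 B hB
      have := hB ⟨i, hi'⟩
      simp only at this
      omega

end MAL

/-! ## Correctness of the algorithm -/

namespace MAL

variable {n : ℕ} {G : SimpleGraph (Fin n)} {a : ℕ} {σ τ : State} {κ : Core} {p q r s : Fin n}
  {S : Finset (Fin n)} {L : List (ℕ × ℕ × ℕ)} {d : ℕ}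

/-- The output consists of the triples in `L`. -/
def OutList (σ : State) (L : List (ℕ × ℕ × ℕ)) : Prop :=
  σ.var 2 = L.length ∧ ∀ i (hi : i < L.length),
    σ.arr 1 i = L[i].1 ∧ σ.arr 2 i = L[i].2.1 ∧ σ.arr 3 i = L[i].2.2

theorem OutList.congr (h : OutList σ L) (h2 : τ.var 2 = σ.var 2) (h1 : τ.arr = σ.arr) :
    OutList τ L := by
  unfold OutList
  rw [h1, h2]
  exact h

/-- The value of the expression does not depend on the output. -/
def OutFree (e : Expr) : Prop :=
  ∀ σ τ : State, τ.var = σ.var → (∀ A, A ≠ 1 → A ≠ 2 → A ≠ 3 → τ.arr A = σ.arr A) →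
    e.eval τ = e.eval σ

theorem OutList.emit (h : OutList σ L) {x y t : Expr} (hy : OutFree y) (ht : OutFree t) :
    OutList ((emit x y t).eval σ) (L ++ [(x.eval σ, y.eval σ, t.eval σ)]) := by
  obtain ⟨h2, h⟩ := h
  have ey : y.eval (σ.setArr 1 (σ.var 2) (x.eval σ)) = y.eval σ :=
    hy _ _ rfl fun A h1 _ _ => by ext; simp [h1]
  have et : t.eval ((σ.setArr 1 (σ.var 2) (x.eval σ)).setArr 2 (σ.var 2) (y.eval σ)) = t.eval σ :=
    ht _ _ rfl fun A h1 h2 _ => by ext; simp [h1, h2]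
  have e2 : ∀ τ, (Expr.var 2).eval τ = τ.var 2 := fun _ => rfl
  simp only [MAL.emit, FProg.eval, e2, State.setArr_var, ey, et]
  refine ⟨by simp [Expr.eval, h2], fun i hi => ?_⟩
  simp only [State.setVar_arr, State.setArr_arr, Nat.reduceEqDiff, false_and, if_false, true_and]
  rw [List.length_append, List.length_singleton] at hi
  by_cases hi' : i = L.length
  · subst hi'
    simp [h2]
  · rw [List.getElem_append_left (by omega)]
    simp only [h2, hi', if_false]
    exact h i (by omega)

theorem outFree_var (x : ℕ) : OutFree (.var x) := fun σ τ h _ => by simp [Expr.eval, h]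

theorem Core.output_spec (h : OutList σ []) (hp : σ.var 3 = p) (hq : σ.var 4 = q)
    (hr : σ.var 5 = r) (hs : σ.var 6 = s) :
    OutList (κ.output.eval σ) (κ.calls p q r s (σ.var 11)) := by
  have hf : OutFree (.add (.var 11) (.const 1)) := fun σ τ h _ => by simp [Expr.eval, h]
  cases κ with
  | vertex => exact h
  | edge =>
    have := h.emit (x := .var 3) (outFree_var 4) (outFree_var 11)
    simp only [Expr.eval, hp, hq] at this
    exact this
  | cycle =>
    have h1 := h.emit (x := .var 3) (outFree_var 4) (outFree_var 11)
    have h2 := h1.emit (x := .var 5) (outFree_var 6) (outFree_var 11)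
    have h3 := h2.emit (x := .var 4) (outFree_var 5) hf
    have h4 := h3.emit (x := .var 6) (outFree_var 3) hf
    have hv : ∀ x y t y', y' ≠ 2 → ∀ σ, ((MAL.emit x y t).eval σ).var y' = σ.var y' := by
      intro x y t y' hy' σ
      exact FProg.eval_var (by simp [MAL.emit, FProg.writesVar, hy'.symm]) σ
    simp only [Expr.eval, hv _ _ _ 3 (by decide), hv _ _ _ 4 (by decide), hv _ _ _ 5 (by decide),
      hv _ _ _ 6 (by decide), hv _ _ _ 11 (by decide), hp, hq, hr, hs] at h4
    exact h4

theorem treeOutput_spec (h : OutList σ L) : OutList ((treeOutput κ).eval σ)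
    (L ++ (List.range (σ.var 0)).flatMap
      (treeCalls κ.rounds (σ.var 11) (σ.arr 5) (σ.arr 6))) := by
  refine FProg.forN_induct (fun i τ => OutList τ (L ++ (List.range i).flatMap
      (treeCalls κ.rounds (σ.var 11) (σ.arr 5) (σ.arr 6)))) ?_ ?_
  · simpa using h.congr (τ := σ.setVar 10 0) (by simp) rfl
  · intro i hi τ hv ha hx hI
    refine OutList.congr (σ := FProg.eval _ τ) ?_ (by simp) rfl
    have h11 : τ.var 11 = σ.var 11 := hv 11 rfl
    have h5 : τ.arr 5 = σ.arr 5 := ha 5 rfl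
    have h6 : τ.arr 6 = σ.arr 6 := ha 6 rfl
    have hP : OutFree (.read 6 (.var 10)) := fun σ τ h h' => by
      simp [Expr.eval, h, h' 6]
    have hup : OutFree (.sub (.add (.var 11) (.const 1)) (.read 5 (.var 10))) := fun σ τ h h' => by
      simp [Expr.eval, h, h' 5]
    have hdown : OutFree (.sub (.add (.add (.var 11) (.read 5 (.var 10))) (.const κ.rounds))
        (.const 2)) := fun σ τ h h' => by simp [Expr.eval, h, h' 5]
    have h1 := hI.emit (x := .var 10) hP hup
    have h2 := h1.emit (x := .var 10) hP hdown
    have f10 : ∀ x y t σ, ((MAL.emit x y t).eval σ).var 10 = σ.var 10 := fun _ _ _ σ =>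
      FProg.eval_var rfl σ
    have f11 : ∀ x y t σ, ((MAL.emit x y t).eval σ).var 11 = σ.var 11 := fun _ _ _ σ =>
      FProg.eval_var rfl σ
    have f5 : ∀ x y t σ, ((MAL.emit x y t).eval σ).arr 5 = σ.arr 5 := fun _ _ _ σ =>
      FProg.eval_arr rfl σ
    have f6 : ∀ x y t σ, ((MAL.emit x y t).eval σ).arr 6 = σ.arr 6 := fun _ _ _ σ =>
      FProg.eval_arr rfl σ
    rw [List.range_succ, List.flatMap_append, List.flatMap_singleton, ← List.append_assoc, treeCalls,
      FProg.eval]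
    have hb : (Expr.sub (.read 5 (.var 10)) (.const 1)).eval τ = σ.arr 5 i - 1 := by
      simp [Expr.eval, hx, h5]
    rw [hb]
    split_ifs with hc
    · simpa only [FProg.eval, Expr.eval, f10, f11, f5, f6, hx, h11, h5, h6, List.append_assoc,
        List.cons_append, List.nil_append] using h2
    · simpa [FProg.eval] using hI

/-- There is a solution in the output, and its number of labels is at most `2 * n - d`. -/
def Found (G : SimpleGraph (Fin n)) (a d : ℕ) (σ : State) : Prop :=
  ∃ lam : Labeling G, Outputs σ lam ∧ lam.IsSolution a ∧ lam.numLabels + d ≤ 2 * n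

theorem OutList.outputs (h : OutList σ L) {lam : Labeling G}
    (hlam : ∀ u v : Fin n, ∀ t, t ∈ lam.labels s(u, v) ↔
      (u.val, v.val, t) ∈ L ∨ (v.val, u.val, t) ∈ L)
    (hL : ∀ x ∈ L, ∃ u v : Fin n, x.1 = u ∧ x.2.1 = v) : Outputs σ lam := by
  obtain ⟨h2, h⟩ := h
  refine ⟨fun i hi => ?_, fun u v t ht => ?_⟩
  · rw [h2] at hi
    obtain ⟨e1, e2, e3⟩ := h i hi
    obtain ⟨u, v, hu, hv⟩ := hL _ (List.getElem_mem hi)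
    refine ⟨u, v, e1.trans hu, e2.trans hv, (hlam _ _ _).2 (Or.inl ?_)⟩
    rw [← hu, ← hv, e3]
    exact List.getElem_mem hi
  · rcases (hlam _ _ _).1 ht with h' | h' <;> obtain ⟨i, hi, hi'⟩ := List.getElem_of_mem h' <;>
      obtain ⟨e1, e2, e3⟩ := h i hi <;> rw [hi'] at e1 e2 e3 <;>
      refine ⟨i, by rwa [h2], e3, ?_⟩
    exacts [Or.inl ⟨e1, e2⟩, Or.inr ⟨e1, e2⟩]

/-- A failed attempt writes no output and proves that the core is too far from some vertex; a
successful one writes the labeling and records the slack of the core in variable `7`. -/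
theorem attempt_spec (hG : G.Connected) (h : Env G a σ) (hp : σ.var 3 = p) (hq : σ.var 4 = q)
    (hr : σ.var 5 = r) (hs : σ.var 6 = s) (hκ : κ.Valid G p q r s) (h2 : σ.var 2 = 0) :
    (((attempt κ).eval σ).var 7 = σ.var 7 ∧ ((attempt κ).eval σ).var 2 = 0 ∧
      ¬ ∀ v, ∃ c ∈ ({p, q, r, s} : Finset (Fin n)), 2 * G.dist v c + κ.rounds ≤ a) ∨
    (((attempt κ).eval σ).var 7 = κ.slack ∧ Found G a κ.slack ((attempt κ).eval σ)) := by
  classical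
  set S : Finset (Fin n) := {p, q, r, s} with hS
  set σ₁ := initDist.eval σ with hσ₁
  set σ₂ := relaxAll.eval σ₁ with hσ₂
  set σ₃ := maxDist.eval σ₂ with hσ₃
  have env₁ : Env G a σ₁ := h.eval rfl rfl rfl rfl
  have env₂ : Env G a σ₂ := env₁.eval rfl rfl rfl rfl
  have env₃ : Env G a σ₃ := env₂.eval rfl rfl rfl rfl
  have hinit := initDist_spec h hp hq hr hs
  have tree₁ : Tree G S σ₁ := by
    refine ⟨⟨fun v => ?_, fun v => ?_, fun v => ?_⟩, fun v => ?_⟩ <;> rw [hinit v] <;>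
      split_ifs with hv
    · exact le_rfl
    · omega
    · exact iff_of_true rfl hv
    · exact iff_of_false (by have := v.pos; omega) hv
    · omega
    · omega
    · omega
    · exact le_rfl
  obtain ⟨tree₂, hdist⟩ := relaxAll_spec env₁ tree₁
  obtain ⟨hmax, hmin⟩ : (∀ v : Fin n, σ₂.arr 5 v ≤ σ₃.var 11) ∧
    ∀ B, (∀ v : Fin n, σ₂.arr 5 v ≤ B) → σ₃.var 11 ≤ B := maxDist_spec env₂
  have hle : ∀ v c : Fin n, c ∈ S → σ₂.arr 5 v ≤ G.dist v c + 1 ∧ σ₂.arr 5 v ≤ n := by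
    intro v c hc
    obtain ⟨w, hw⟩ := hG.exists_walk_length_eq_dist v c
    have hlt : w.length < n := by
      have := (w.isPath_of_length_eq_dist hw).length_lt
      rwa [Fintype.card_fin] at this
    have := hdist v c w hc hlt.le
    rw [← hw]
    exact ⟨this, this.trans hlt⟩
  have harr : σ₃.arr = σ₂.arr := by
    ext A : 1
    exact FProg.eval_arr rfl σ₂
  have var : ∀ y, y ≠ 8 → y ≠ 9 → y ≠ 10 → y ≠ 11 → σ₃.var y = σ.var y := by
    intro y h8 h9 h10 h11
    rw [hσ₃, hσ₂, hσ₁, FProg.eval_var, FProg.eval_var, FProg.eval_var] <;>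
      simp [initDist, relaxAll, relaxStep, maxDist, FProg.writesVar, h8.symm, h9.symm, h10.symm,
        h11.symm]
  -- Variable `11` holds the largest value, a distance plus one counted twice; hence `a + 2` here,
  -- and `a + 3` in the strict form computed by the program.
  have htest : (testExpr κ).eval σ₃ ≠ 0 ↔ 2 * σ₃.var 11 + κ.rounds ≤ a + 2 := by
    simp only [testExpr, Expr.eval, env₃.var1]
    omega
  rw [attempt, FProg.eval, FProg.eval, FProg.eval, ← hσ₁, ← hσ₂, ← hσ₃, FProg.eval]
  by_cases ht : (testExpr κ).eval σ₃ ≠ 0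
  · rw [if_pos ht]
    right
    rw [htest] at ht
    set σ₄ := κ.output.eval σ₃ with hσ₄
    set σ₅ := (treeOutput κ).eval σ₄ with hσ₅
    have o₃ : OutList σ₃ [] := ⟨(var 2 (by decide) (by decide) (by decide) (by decide)).trans h2,
      by simp⟩
    have o₄ := Core.output_spec (κ := κ) o₃
      ((var 3 (by decide) (by decide) (by decide) (by decide)).trans hp)
      ((var 4 (by decide) (by decide) (by decide) (by decide)).trans hq)
      ((var 5 (by decide) (by decide) (by decide) (by decide)).trans hr)
      ((var 6 (by decide) (by decide) (by decide) (by decide)).trans hs)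
    have o₅ := treeOutput_spec (κ := κ) o₄
    have e0 : σ₄.var 0 = n := (FProg.eval_var (by cases κ <;> rfl) σ₃).trans env₃.var0
    have e11 : σ₄.var 11 = σ₃.var 11 := FProg.eval_var (by cases κ <;> rfl) σ₃
    have e5 : σ₄.arr 5 = σ₂.arr 5 := (FProg.eval_arr (by cases κ <;> rfl) σ₃).trans (by rw [harr])
    have e6 : σ₄.arr 6 = σ₂.arr 6 := (FProg.eval_arr (by cases κ <;> rfl) σ₃).trans (by rw [harr])
    rw [← hσ₄, ← hσ₅, e0, e11, e5, e6] at o₅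
    obtain ⟨lam, hlam, hL, hsol, hnum⟩ := tree₂.layers.exists_solution hκ hmax
      (fun v => (hle v p (by simp [hS])).2) ht rfl
    have o₆ : OutList (σ₅.setVar 7 κ.slack) _ := o₅.congr (by simp) rfl
    exact ⟨by simp [FProg.eval, Expr.eval], lam, o₆.outputs hlam hL, hsol, hnum⟩
  · rw [if_neg ht]
    left
    rw [htest] at ht
    refine ⟨var 7 (by decide) (by decide) (by decide) (by decide),
      (var 2 (by decide) (by decide) (by decide) (by decide)).trans h2, fun hclose => ht ?_⟩
    have hr2 : κ.rounds ≤ a + 2 := by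
      obtain ⟨c, -, hc⟩ := hclose p
      omega
    have := hmin ((a + 2 - κ.rounds) / 2) fun v => by
      obtain ⟨c, hc, hd⟩ := hclose v
      have := (hle v c hc).1
      omega
    omega

/-- The state of the memory during the search: variable `7` indicates whether the output is
complete, and the quality of the output. -/
def Searching (G : SimpleGraph (Fin n)) (a d : ℕ) (σ : State) : Prop :=
  Env G a σ ∧ (σ.var 7 = 0 ∧ σ.var 2 = 0 ∨ d ≤ σ.var 7 ∧ Found G a (σ.var 7) σ)

/-- The effect of a part of the search, which is successful if `T` holds. -/
def Progress (G : SimpleGraph (Fin n)) (a d : ℕ) (T : Prop) (σ τ : State) : Prop :=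
  Searching G a d τ ∧ (∀ e, 1 ≤ e → e ≤ σ.var 7 → e ≤ τ.var 7) ∧ (T → d ≤ τ.var 7)

theorem Searching.setVar (h : Searching G a d σ) {x v : ℕ} (h0 : x ≠ 0) (h1 : x ≠ 1) (h2 : x ≠ 2)
    (h7 : x ≠ 7) : Searching G a d (σ.setVar x v) := by
  refine ⟨h.1.congr ?_ ?_ rfl rfl, ?_⟩
  · simp [h0.symm]
  · simp [h1.symm]
  · have e2 : (σ.setVar x v).var 2 = σ.var 2 := by simp [h2.symm]
    have e7 : (σ.setVar x v).var 7 = σ.var 7 := by simp [h7.symm]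
    unfold Found Outputs
    rw [e2, e7]
    exact h.2

theorem Searching.forN (h : Searching G a d σ) (hd : 1 ≤ d) {x : ℕ} {P : FProg} (h0 : x ≠ 0)
    (h1 : x ≠ 1) (h2 : x ≠ 2) (h7 : x ≠ 7) (T : ℕ → Prop)
    (hstep : ∀ i < n, ∀ τ, (∀ y, (FProg.forN x P).writesVar y = false → τ.var y = σ.var y) →
      τ.var x = i → Searching G a d τ → Progress G a d (T i) τ (P.eval τ)) :
    Progress G a d (∃ i < n, T i) σ ((FProg.forN x P).eval σ) := by
  have := FProg.forN_induct (x := x) (p := P) (σ := σ)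
    (fun i τ => Progress G a d (∃ j < i, T j) σ τ) ⟨h.setVar h0 h1 h2 h7, ?_, by simp⟩ ?_
  · rwa [h.1.var0] at this
  · intro e _ he
    simpa [h7.symm] using he
  · rintro i hi τ hv - hx ⟨e1, e2, e3⟩
    rw [h.1.var0] at hi
    obtain ⟨f1, f2, f3⟩ := hstep i hi τ hv hx e1
    refine ⟨f1.setVar h0 h1 h2 h7, ?_, ?_⟩ <;> rw [State.setVar_var, if_neg h7.symm]
    · exact fun e he he' => f2 e he (e2 e he he')
    · rintro ⟨j, hj, hT⟩
      by_cases hji : j = i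
      · subst hji
        exact f3 hT
      · exact f2 d hd (e3 ⟨j, by omega, hT⟩)

/-- The numbers `p`, `q`, `r`, `s` are the vertices of a core with small eccentricity. -/
def Suitable (G : SimpleGraph (Fin n)) (a : ℕ) (κ : Core) (p q r s : ℕ) : Prop :=
  ∃ p' q' r' s' : Fin n, p = p' ∧ q = q' ∧ r = r' ∧ s = s' ∧ κ.Valid G p' q' r' s' ∧
    ∀ v, ∃ c ∈ ({p', q', r', s'} : Finset (Fin n)), 2 * G.dist v c + κ.rounds ≤ a

/-- The test of variable `7` stops all attempts after the first success, so the output is never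
overwritten, and a suitable core that is tried before any success causes one. -/
theorem search_spec (hG : G.Connected) (hd0 : 1 ≤ d) (hd : d ≤ κ.slack) (h : Searching G a d σ) :
    Progress G a d (∃ p < n, ∃ q < n, ∃ r < n, ∃ s < n, Suitable G a κ p q r s) σ
      ((search κ).eval σ) := by
  refine h.forN hd0 (by decide) (by decide) (by decide) (by decide) _ ?_
  intro p hp σ₁ _ hσp h₁
  refine h₁.forN hd0 (by decide) (by decide) (by decide) (by decide) _ ?_
  intro q hq σ₂ hv₂ hσq h₂
  refine h₂.forN hd0 (by decide) (by decide) (by decide) (by decide) _ ?_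
  intro r hr σ₃ hv₃ hσr h₃
  refine h₃.forN hd0 (by decide) (by decide) (by decide) (by decide) _ ?_
  intro s hs σ₄ hv₄ hσs h₄
  have e3 : σ₄.var 3 = (⟨p, hp⟩ : Fin n) := (hv₄ 3 (by cases κ <;> rfl)).trans
    ((hv₃ 3 (by cases κ <;> rfl)).trans ((hv₂ 3 (by cases κ <;> rfl)).trans hσp))
  have e4 : σ₄.var 4 = (⟨q, hq⟩ : Fin n) := (hv₄ 4 (by cases κ <;> rfl)).trans
    ((hv₃ 4 (by cases κ <;> rfl)).trans hσq)
  have e5 : σ₄.var 5 = (⟨r, hr⟩ : Fin n) := (hv₄ 5 (by cases κ <;> rfl)).trans hσr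
  have e6 : σ₄.var 6 = (⟨s, hs⟩ : Fin n) := hσs
  have heval : ∀ b P Q, (FProg.ite b P Q).eval σ₄ = if b.eval σ₄ ≠ 0 then P.eval σ₄ else
    Q.eval σ₄ := fun _ _ _ => rfl
  have hskip : FProg.skip.eval σ₄ = σ₄ := rfl
  have h7 : (Expr.var 7).eval σ₄ = σ₄.var 7 := rfl
  rw [heval, heval, hskip, h7]
  by_cases hdone : σ₄.var 7 = 0
  · rw [if_neg (not_not.2 hdone)]
    have hcond := Core.cond_spec (κ := κ) h₄.1 e3 e4 e5 e6
    by_cases hc : κ.cond.eval σ₄ ≠ 0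
    · rw [if_pos hc]
      have hvalid := hcond.1 hc
      have h02 : σ₄.var 2 = 0 := by
        rcases h₄.2 with h' | h'
        · exact h'.2
        · omega
      have henv : Env G a ((attempt κ).eval σ₄) :=
        h₄.1.eval (by cases κ <;> rfl) (by cases κ <;> rfl) (by cases κ <;> rfl) (by cases κ <;> rfl)
      rcases attempt_spec hG h₄.1 e3 e4 e5 e6 hvalid h02 with ⟨f1, f2, f3⟩ | ⟨f1, f2⟩
      · refine ⟨⟨henv, Or.inl ⟨f1.trans hdone, f2⟩⟩, fun e _ he => by rwa [f1], ?_⟩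
        rintro ⟨p', q', r', s', rfl, rfl, rfl, rfl, -, hclose⟩
        exact absurd hclose f3
      · exact ⟨⟨henv, Or.inr ⟨by rw [f1]; exact hd, by rw [f1]; exact f2⟩⟩,
          fun e _ he => by omega, fun _ => by rw [f1]; exact hd⟩
    · rw [if_neg hc]
      refine ⟨h₄, fun _ _ he => he, ?_⟩
      rintro ⟨p', q', r', s', rfl, rfl, rfl, rfl, hvalid, -⟩
      exact absurd (hcond.2 hvalid) hc
  · rw [if_pos hdone]
    refine ⟨h₄, fun _ _ he => he, fun _ => ?_⟩
    rcases h₄.2 with h' | h'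
    · exact absurd h'.1 hdone
    · exact h'.1

end MAL

/-! ## The main results -/

namespace MAL

section Final

variable {n : ℕ} {G : SimpleGraph (Fin n)} {a : ℕ} {σ τ : State} {κ : Core} {p q r s : Fin n}
  {d : ℕ}

theorem polyTimeComputable_of_eval {Inst : ∀ n : ℕ, SimpleGraph (Fin n) → ℕ → Prop}
    {Good : ∀ (n : ℕ) (G : SimpleGraph (Fin n)), ℕ → Labeling G → Prop} (P : FProg)
    (h0 : P.writesVar 0 = false) (hwf : P.wf = true)
    (h : ∀ (n : ℕ) (G : SimpleGraph (Fin n)) (a : ℕ), Inst n G a →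
      ∃ lam : Labeling G, Outputs (P.eval (inputState G a)) lam ∧ Good n G a lam) :
    PolyTimeComputable Inst Good := by
  refine ⟨P.compile, P.cost, fun n G a hI => ?_⟩
  obtain ⟨t, ht, htime⟩ := P.exec h0 hwf (inputState G a)
  obtain ⟨lam, hout, hgood⟩ := h n G a hI
  refine ⟨t, _, lam, ht, htime.trans (polynomial_eval_mono _ ?_), hout, hgood⟩
  -- The time bound depends on the number of vertices only, which is at most its square and so at
  -- most the input size.
  exact (Nat.le_self_pow two_ne_zero n).trans (Nat.le_add_right _ _)

theorem searching_prelude (G : SimpleGraph (Fin n)) (a d : ℕ) :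
    Searching G a d (prelude.eval (inputState G a)) :=
  ⟨prelude_spec G a, Or.inl ⟨FProg.eval_var rfl _, FProg.eval_var rfl _⟩⟩

theorem Searching.found (h : Searching G a d σ) {e : ℕ} (he : 1 ≤ e) (hσ : e ≤ σ.var 7) :
    Found G a e σ := by
  rcases h.2 with ⟨h', -⟩ | ⟨-, lam, h1, h2, h3⟩
  · omega
  · exact ⟨lam, h1, h2, by omega⟩

theorem Searching.mono (h : Searching G a d σ) {e : ℕ} (he : e ≤ d) : Searching G a e σ :=
  ⟨h.1, h.2.imp_right fun h => ⟨he.trans h.1, h.2⟩⟩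

/-- The lower bound needs two vertices. With one vertex either nothing was found and the empty
output is a solution, or the found labeling has at most `2 * 1 - d` labels, that is, none. -/
theorem Searching.of_subsingleton (h : Searching G a d σ) (hd : 2 ≤ d) (hn : n = 1) :
    ∃ lam : Labeling G, Outputs σ lam ∧ lam.IsSolution a ∧ lam.numLabels = 0 := by
  rcases h.2 with ⟨-, h2⟩ | ⟨h7, lam, h1, h2, h3⟩
  · subst hn
    refine ⟨⟨fun _ => ∅, fun _ _ => rfl, by simp⟩, ⟨by simp [h2], by simp⟩, ⟨?_, ?_⟩, ?_⟩
    · exact fun v w hvw => absurd (Subsingleton.elim v w) hvw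
    · simp [Labeling.lifetime]
    · simp [Labeling.numLabels]
  · exact ⟨lam, h1, h2, by omega⟩

theorem Core.Valid.suitable (h : κ.Valid G p q r s)
    (hclose : ∀ v, ∃ c ∈ ({p, q, r, s} : Finset (Fin n)), 2 * G.dist v c + κ.rounds ≤ a) :
    ∃ p < n, ∃ q < n, ∃ r < n, ∃ s < n, Suitable G a κ p q r s :=
  ⟨p, p.2, q, q.2, r, r.2, s, s.2, p, q, r, s, rfl, rfl, rfl, rfl, h, hclose⟩

theorem exists_center (hG : G.Connected) {k : ℕ} (h : 2 * G.radius + k ≤ (a : ℕ∞)) :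
    ∃ c, ∀ v, 2 * G.dist v c + k ≤ a := by
  have := hG.nonempty
  obtain ⟨c, hc⟩ := G.exists_eccent_eq_radius
  refine ⟨c, fun v => ?_⟩
  have h1 : (G.dist v c : ℕ∞) ≤ G.radius := by
    rw [SimpleGraph.dist_comm, (hG.preconnected c v).coe_dist_eq_edist, ← hc]
    exact SimpleGraph.edist_le_eccent
  have h2 : 2 * (G.dist v c : ℕ∞) + k ≤ a := le_trans (by gcongr) h
  exact_mod_cast h2

theorem dist_le_of_ediam (hG : G.Connected) {k : ℕ} (h : 2 * G.ediam + k ≤ (a : ℕ∞)) (v w : Fin n) :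
    2 * G.dist v w + k ≤ a := by
  have h1 : (G.dist v w : ℕ∞) ≤ G.ediam := by
    rw [(hG.preconnected v w).coe_dist_eq_edist]
    exact SimpleGraph.edist_le_ediam
  have h2 : 2 * (G.dist v w : ℕ∞) + k ≤ a := le_trans (by gcongr) h
  exact_mod_cast h2

theorem Labeling.IsSolution.two_mul_le_opt {lam : Labeling G} (h : lam.IsSolution a)
    (hn : 2 ≤ n) : 2 * n ≤ opt G a + 4 := by
  obtain ⟨lam', h', hopt⟩ := h.exists_opt
  have := h'.1.two_mul_card_le (by rwa [Fintype.card_fin])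
  rwa [Fintype.card_fin, hopt] at this

theorem Labeling.IsSolution.two_mul_le_opt_of_noFourCycle {lam : Labeling G} (h : lam.IsSolution a)
    (hn : 2 ≤ n) (hG : NoFourCycle G) : 2 * n ≤ opt G a + 3 := by
  obtain ⟨lam', h', hopt⟩ := h.exists_opt
  have := h'.1.two_mul_card_le_of_noFourCycle (by rwa [Fintype.card_fin]) hG
  rwa [Fintype.card_fin, hopt] at this

theorem eq_one_or_two_le (hG : G.Connected) : n = 1 ∨ 2 ≤ n := by
  obtain ⟨v⟩ := hG.nonempty
  have := v.pos
  omega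

theorem exists_adj_of_two_le (hG : G.Connected) (hn : 2 ≤ n) (v : Fin n) : ∃ w, G.Adj v w := by
  have : Nontrivial (Fin n) := Fin.nontrivial_iff_two_le.2 hn
  exact hG.preconnected.exists_adj_of_nontrivial v

theorem polyTimeComputable_add_two : PolyTimeComputable
    (fun _ G a => G.Connected ∧ 2 * G.radius ≤ (a : ℕ∞))
    (fun _ G a lam => lam.IsSolution a ∧ lam.numLabels ≤ opt G a + 2) := by
  refine polyTimeComputable_of_eval (.seq prelude (search .vertex)) rfl rfl ?_
  rintro n G a ⟨hG, ha⟩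
  obtain ⟨h1, -, h3⟩ := search_spec (κ := .vertex) (d := 2) hG (by decide) le_rfl
    (searching_prelude G a 2)
  rcases eq_one_or_two_le hG with hn | hn
  · obtain ⟨lam, e1, e2, e3⟩ := h1.of_subsingleton le_rfl hn
    exact ⟨lam, e1, e2, by omega⟩
  · obtain ⟨c, hc⟩ := exists_center (k := 0) hG (by simpa using ha)
    obtain ⟨lam, e1, e2, e3⟩ := h1.found (by decide) (h3 (Core.Valid.suitable (p := c) (q := c)
      (r := c) (s := c) ⟨rfl, rfl, rfl⟩ fun v => ⟨c, by simp, hc v⟩))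
    have := e2.two_mul_le_opt hn
    exact ⟨lam, e1, e2, by omega⟩

theorem polyTimeComputable_add_one : PolyTimeComputable
    (fun _ G a => G.Connected ∧ 2 * G.radius + 1 ≤ (a : ℕ∞))
    (fun _ G a lam => lam.IsSolution a ∧ lam.numLabels ≤ opt G a + 1) := by
  refine polyTimeComputable_of_eval (.seq prelude (search .edge)) rfl rfl ?_
  rintro n G a ⟨hG, ha⟩
  obtain ⟨h1, -, h3⟩ := search_spec (κ := .edge) (d := 3) hG (by decide) le_rfl
    (searching_prelude G a 3)
  rcases eq_one_or_two_le hG with hn | hn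
  · obtain ⟨lam, e1, e2, e3⟩ := h1.of_subsingleton (by decide) hn
    exact ⟨lam, e1, e2, by omega⟩
  · obtain ⟨c, hc⟩ := exists_center (k := 1) hG (by simpa using ha)
    obtain ⟨w, hw⟩ := exists_adj_of_two_le hG hn c
    obtain ⟨lam, e1, e2, e3⟩ := h1.found (by decide) (h3 (Core.Valid.suitable (p := c) (q := w)
      (r := c) (s := c) ⟨hw, rfl, rfl⟩ fun v => ⟨c, by simp, hc v⟩))
    have := e2.two_mul_le_opt hn
    exact ⟨lam, e1, e2, by omega⟩

/-- The four-cycles are tried first; a success gives at most `2n - 4` labels and blocks the search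
for edges. If there is no four-cycle, an edge gives at most `2n - 3` labels, and then this is also
the lower bound. -/
theorem polyTimeComputable_opt : PolyTimeComputable
    (fun _ G a => G.Connected ∧ 2 * G.ediam + 2 ≤ (a : ℕ∞))
    (fun _ G a lam => lam.IsSolution a ∧ lam.numLabels = opt G a) := by
  refine polyTimeComputable_of_eval (.seq prelude (.seq (search .cycle) (search .edge))) rfl rfl ?_
  rintro n G a ⟨hG, ha⟩
  have hdist := dist_le_of_ediam (k := 2) hG ha
  obtain ⟨h1, -, h3⟩ := search_spec (κ := .cycle) (d := 4) hG (by decide) le_rfl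
    (searching_prelude G a 4)
  obtain ⟨f1, f2, f3⟩ := search_spec (κ := .edge) (d := 3) hG (by decide) le_rfl
    (h1.mono (by decide))
  rcases eq_one_or_two_le hG with hn | hn
  · obtain ⟨lam, e1, e2, e3⟩ := f1.of_subsingleton (by decide) hn
    have := e2.opt_le
    exact ⟨lam, e1, e2, by omega⟩
  by_cases hC : NoFourCycle G
  · obtain ⟨v⟩ := hG.nonempty
    obtain ⟨w, hw⟩ := exists_adj_of_two_le hG hn v
    obtain ⟨lam, e1, e2, e3⟩ := f1.found (by decide) (f3 (Core.Valid.suitable (p := v) (q := w)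
      (r := v) (s := v) ⟨hw, rfl, rfl⟩ fun u => ⟨v, by simp, by
        have := hdist u v
        simp only [Core.rounds]
        omega⟩))
    have := e2.two_mul_le_opt_of_noFourCycle hn hC
    have := e2.opt_le
    exact ⟨lam, e1, e2, by omega⟩
  · unfold NoFourCycle at hC
    push Not at hC
    obtain ⟨v₁, v₂, v₃, v₄, h12, h23, h34, h41, h13, h24⟩ := hC
    obtain ⟨lam, e1, e2, e3⟩ := f1.found (e := 4) (by decide) (f2 4 (by decide) (h3
      (Core.Valid.suitable (p := v₁) (q := v₂) (r := v₃) (s := v₄)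
        ⟨h12, h23, h34, h41, h13, h24⟩ fun u => ⟨v₁, by simp, hdist u v₁⟩)))
    have := e2.two_mul_le_opt hn
    have := e2.opt_le
    exact ⟨lam, e1, e2, by omega⟩

end Final

end MAL

theorem mainTheorem7 :
    MAL.PolyTimeComputable
      (fun _ G a => G.Connected ∧ 2 * G.radius ≤ (a : ℕ∞))
      (fun _ G a lam => lam.IsSolution a ∧ lam.numLabels ≤ MAL.opt G a + 2) ∧
    MAL.PolyTimeComputable
      (fun _ G a => G.Connected ∧ 2 * G.radius + 1 ≤ (a : ℕ∞))
      (fun _ G a lam => lam.IsSolution a ∧ lam.numLabels ≤ MAL.opt G a + 1) ∧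
    MAL.PolyTimeComputable
      (fun _ G a => G.Connected ∧ 2 * G.ediam + 2 ≤ (a : ℕ∞))
      (fun _ G a lam => lam.IsSolution a ∧ lam.numLabels = MAL.opt G a) := by
  exact ⟨MAL.polyTimeComputable_add_two, MAL.polyTimeComputable_add_one,
    MAL.polyTimeComputable_opt⟩
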